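/- For $k\ge 1$, let $\pi=\pi_1\circ\cdots\circ\pi_k:M=M_k\to\cdots\to M_1\to M_0=\mathbb R^2$ and $\pi'=\pi'_1\circ\cdots\circ\pi'_k:M'=M'_k\to\cdots\to M'_1\to M'_0=\mathbb R^2$ be compositions of $k$ point blowings-up of real analytic surfaces, the first center being the origin $0$ and every other center lying over $0$. Put $E_i=(\pi_1\circ\cdots\circ\pi_i)^{-1}(0)$, $E=E_k$, and define $E'_i$, $E'$ likewise. The components of $E$ are the strict transforms in $M$ of the exceptional curves of $\pi_1,\dots,\pi_k$; similarly for $E'$. Let $h:(\mathbb R^2,0)\to(\mathbb R^2,0)$ be a cascade blow-analytic homeomorphism germ with respect to $\pi,\pi'$. This means that $h$ is represented by a homeomorphism $U\to U'$ between open neighbourhoods of $0$ with $h(0)=0$, and that for $1\le i\le k$ there are homeomorphisms $h_i$ from the preimage of $U$ in $M_i$ onto the preimage of $U'$ in $M'_i$ with $\pi'_i\circ h_i=h_{i-1}\circ\pi_i$ (where $h_0=h$) and $h_i(E_i)=E'_i$, such that $\Phi:=h_k:\pi^{-1}(U)\to\pi'^{-1}(U')$ is a real analytic isomorphism. Let $I_\pi=\pi^*\mathfrak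 m$ be the pull-back of the ideal of the origin of $\mathbb R^2$ (the ideal sheaf on $M$ generated by the functions $f\circ\pi$, $f$ analytic with $f(0)=0$). Let $J_\pi$ be the ideal sheaf on $M$ generated by the determinant of $d\pi$ in analytic local coordinates. Define $I_{\pi'}$, $J_{\pi'}$ on $M'$ likewise. Then, on $\pi^{-1}(U)$, $$\Phi^*I_{\pi'}=I_\pi\qquad\text{and}\qquad \Phi^*J_{\pi'}=J_\pi .$$ In particular, let $H$ be a component of $E$. Then $\Phi(H)$ is a component of $E'$, the Hsiang–Pati local data of $\pi$ along $H$ is well defined, and it is equal to the Hsiang–Pati local data of $\pi'$ along $\Phi(H)$. Here the Hsiang–Pati local data of $\pi$ along $H$ is the pair $(l,m)$ of integers $1\le l\le m$ such that, at every point $a\in H$ that is a regular (non-corner) point of $E$, there are analytic local coordinates $(u,v)$ of $M$ centered at $a$, with $(E,a)=\{u=0\}$, in which, up to a rotation of the target $\mathbb R^2$, $$\pi(u,v)=\bigl(\alpha u^l,\;u^l\varphi(u)+\beta u^m v\bigr),\qquad \alpha,\beta\in\{-1,1\},\ \varphi \text{ analytic at } 0 .$$ -/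

import Mathlib

open Set Filter Topology
open scoped Manifold ContDiff

universe u v

/-! ### Real analytic surfaces: germs, ideals and point blowings-up

A real analytic surface is a Hausdorff `C^ω` manifold modelled on `ℝ × ℝ`. -/

section Stalks

variable {M : Type u} [TopologicalSpace M] [ChartedSpace (ℝ × ℝ) M]
variable {N : Type v} [TopologicalSpace N] [ChartedSpace (ℝ × ℝ) N]

/-- The stalk at `a` of the structural sheaf of `M`: the ring of germs at `a` of real analytic
functions. -/
def analyticGerms (a : M) : Subring (Germ (𝓝 a) ℝ) where
  carrier := {g | ∃ f : M → ℝ, ContMDiffAt 𝓘(ℝ, ℝ × ℝ) 𝓘(ℝ, ℝ) ω f a ∧ g = (f : Germ (𝓝 a) ℝ)}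
  mul_mem' := by
    rintro _ _ ⟨f, hf, rfl⟩ ⟨g, hg, rfl⟩
    exact ⟨f * g, hf.mul hg, rfl⟩
  one_mem' := ⟨1, contMDiffAt_const, rfl⟩
  add_mem' := by
    rintro _ _ ⟨f, hf, rfl⟩ ⟨g, hg, rfl⟩
    exact ⟨f + g, hf.add hg, rfl⟩
  zero_mem' := ⟨0, contMDiffAt_const, rfl⟩
  neg_mem' := by
    rintro _ ⟨f, hf, rfl⟩
    exact ⟨-f, hf.neg, rfl⟩

/-- The pull-back by `F : M → N` (analytic at `a`) of an ideal `K` of analytic germs at `F a`: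
the ideal of analytic germs at `a` generated by all the germs `f ∘ F` with `f` in `K`. -/
def pullbackIdeal (F : M → N) (a : M) (K : Ideal (analyticGerms (F a))) :
    Ideal (analyticGerms a) :=
  Ideal.span {g | ∃ (k : analyticGerms (F a)) (f : N → ℝ), k ∈ K ∧
    (k : Germ (𝓝 (F a)) ℝ) = (f : Germ (𝓝 (F a)) ℝ) ∧
    (g : Germ (𝓝 a) ℝ) = ((f ∘ F : M → ℝ) : Germ (𝓝 a) ℝ)}

/-- The stalk at `z` of the ideal sheaf of the origin of the plane: the maximal ideal of the germs
vanishing at the origin if `z = 0`, the unit ideal otherwise. -/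
def originIdeal (z : ℝ × ℝ) : Ideal (analyticGerms z) where
  carrier := {g | z = 0 → (g : Germ (𝓝 z) ℝ).value = 0}
  add_mem' := by
    rintro ⟨_, f, _, rfl⟩ ⟨_, g, _, rfl⟩ hf hg hz
    have h1 : f z = 0 := hf hz
    have h2 : g z = 0 := hg hz
    change f z + g z = 0
    rw [h1, h2, add_zero]
  zero_mem' := fun _ => rfl
  smul_mem' := by
    rintro ⟨_, f, _, rfl⟩ ⟨_, g, _, rfl⟩ hg hz
    have h2 : g z = 0 := hg hz
    change f z * g z = 0
    rw [h2, mul_zero]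

/-- The stalk at `a` of `I_π`, the pull-back by `π` of the maximal ideal at the origin. -/
def maximalPullback (π : M → ℝ × ℝ) (a : M) : Ideal (analyticGerms a) :=
  pullbackIdeal π a (originIdeal (π a))

/-- The stalk at `a` of `J_π`, the ideal generated by the determinant of the differential of `π`
(computed in analytic local coordinates of `M` at `a`; two choices differ by a unit). -/
def jacobianIdeal (π : M → ℝ × ℝ) (a : M) : Ideal (analyticGerms a) :=
  Ideal.span {g | ∃ χ ∈ IsManifold.maximalAtlas 𝓘(ℝ, ℝ × ℝ) ω M, a ∈ χ.source ∧
    (g : Germ (𝓝 a) ℝ) =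
      ((fun q => (fderiv ℝ (π ∘ χ.symm) (χ q)).det : M → ℝ) : Germ (𝓝 a) ℝ)}

/-- `π : M → N` is the blowing-up of the point `p` of `N`: it is analytic, an analytic isomorphism
outside `p`, and, in a coordinate chart `ψ` centred at `p`, it is the standard blowing-up
`{(z, L) | z ∈ L} → ℝ²`, `L` running over the projective line. The latter surface is
described by its two charts `(x, y) ↦ ((x, x y), [1 : y])` and `(x, y) ↦ ((x y, y), [x : 1])`. -/
structure IsPointBlowUp (π : M → N) (p : N) : Prop where
  analytic : ContMDiff 𝓘(ℝ, ℝ × ℝ) 𝓘(ℝ, ℝ × ℝ) ω π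
  iso_off : ∃ e : OpenPartialHomeomorph M N, e.source = π ⁻¹' {p}ᶜ ∧ e.target = {p}ᶜ ∧
    EqOn e π e.source ∧ ContMDiffOn 𝓘(ℝ, ℝ × ℝ) 𝓘(ℝ, ℝ × ℝ) ω e.symm e.target
  local_model : ∃ ψ ∈ IsManifold.maximalAtlas 𝓘(ℝ, ℝ × ℝ) ω N,
    ∃ χ₁ ∈ IsManifold.maximalAtlas 𝓘(ℝ, ℝ × ℝ) ω M,
    ∃ χ₂ ∈ IsManifold.maximalAtlas 𝓘(ℝ, ℝ × ℝ) ω M,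
      p ∈ ψ.source ∧ ψ p = 0 ∧
      χ₁.source ∪ χ₂.source = π ⁻¹' ψ.source ∧
      χ₁.target = {z | (z.1, z.1 * z.2) ∈ ψ.target} ∧
      χ₂.target = {z | (z.1 * z.2, z.2) ∈ ψ.target} ∧
      (∀ z ∈ χ₁.target, ψ (π (χ₁.symm z)) = (z.1, z.1 * z.2)) ∧
      (∀ z ∈ χ₂.target, ψ (π (χ₂.symm z)) = (z.1 * z.2, z.2)) ∧
      ∀ z ∈ χ₁.target, ∀ w ∈ χ₂.target,
        (χ₁.symm z = χ₂.symm w ↔ z.2 * w.1 = 1 ∧ w.2 = z.1 * z.2)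

/-- `χ` is an analytic coordinate chart centred at `a` in which the curve `E` is `{u = 0}`, where
`(u, v)` are the coordinates given by `χ`. -/
def IsAdaptedChart (E : Set M) (a : M) (χ : OpenPartialHomeomorph M (ℝ × ℝ)) : Prop :=
  χ ∈ IsManifold.maximalAtlas 𝓘(ℝ, ℝ × ℝ) ω M ∧ a ∈ χ.source ∧ χ a = 0 ∧
    ∀ q ∈ χ.source, (q ∈ E ↔ (χ q).1 = 0)

/-- `a` is a regular (non corner) point of `E`: the germ of `E` at `a` is `{u = 0}` in suitable
analytic coordinates `(u, v)` centred at `a`. -/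
def IsRegularPoint (E : Set M) (a : M) : Prop :=
  ∃ χ : OpenPartialHomeomorph M (ℝ × ℝ), IsAdaptedChart E a χ

/-- In some analytic coordinates `(u, v)` at `a` adapted to `E`, and up to a rotation of the
plane, `π` is `(u, v) ↦ (α u ^ l, u ^ l φ(u) + β u ^ m v)` with positive integers `l ≤ m`,
signs `α`, `β` and `φ` analytic. -/
def HasHsiangPatiForm (E : Set M) (π : M → ℝ × ℝ) (a : M) (l m : ℕ) : Prop :=
  0 < l ∧ l ≤ m ∧ ∃ χ : OpenPartialHomeomorph M (ℝ × ℝ), IsAdaptedChart E a χ ∧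
    ∃ c s α β : ℝ, c ^ 2 + s ^ 2 = 1 ∧ (α = 1 ∨ α = -1) ∧ (β = 1 ∨ β = -1) ∧
      ∃ φ : ℝ → ℝ, AnalyticAt ℝ φ 0 ∧ ∀ q ∈ χ.source,
        c * (π q).1 - s * (π q).2 = α * (χ q).1 ^ l ∧
        s * (π q).1 + c * (π q).2 = (χ q).1 ^ l * φ (χ q).1 + β * (χ q).1 ^ m * (χ q).2

end Stalks

/-! ### Towers of point blowings-up -/

/-- A composition of `n + 1` point blowings-up
`M_{n+1} → M_n → ⋯ → M_1 → ℝ²`, the first one being that of the origin and every other center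
lying over the origin. Here `surf i` is `M_{i+1}`, `base : M_1 → ℝ²`, and `step i` is the
blowing-up `M_{i+2} → M_{i+1}` of the point `center i`. -/
structure BlowUpTower (n : ℕ) where
  surf : Fin (n + 1) → Type u
  [top : ∀ i, TopologicalSpace (surf i)]
  [charted : ∀ i, ChartedSpace (ℝ × ℝ) (surf i)]
  [manifold : ∀ i, IsManifold 𝓘(ℝ, ℝ × ℝ) ω (surf i)]
  [hausdorff : ∀ i, T2Space (surf i)]
  base : surf 0 → ℝ × ℝ
  step : ∀ i : Fin n, surf i.succ → surf i.castSucc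
  center : ∀ i : Fin n, surf i.castSucc
  base_blowUp : IsPointBlowUp base 0
  step_blowUp : ∀ i, IsPointBlowUp (step i) (center i)
  center_mem : ∀ i : Fin n,
    Fin.induction (motive := fun j => surf j → ℝ × ℝ) base (fun j p => p ∘ step j) i.castSucc
      (center i) = 0

namespace BlowUpTower

attribute [instance] BlowUpTower.top BlowUpTower.charted BlowUpTower.manifold
  BlowUpTower.hausdorff

variable {n : ℕ} (T : BlowUpTower.{u} n)

/-- The composed blowing-down mapping from the `i`-th surface to the plane. -/
def proj (i : Fin (n + 1)) : T.surf i → ℝ × ℝ :=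
  Fin.induction (motive := fun j => T.surf j → ℝ × ℝ) T.base (fun j p => p ∘ T.step j) i

/-- The exceptional divisor of the `i`-th surface. -/
def exc (i : Fin (n + 1)) : Set (T.surf i) := T.proj i ⁻¹' {0}

/-- The components of the exceptional divisor of the `i`-th surface: the exceptional curve of the
last blowing-up, and the strict transforms of the components of the previous divisor. -/
def components (i : Fin (n + 1)) : Set (Set (T.surf i)) :=
  Fin.induction (motive := fun j => Set (Set (T.surf j))) {T.base ⁻¹' {0}}
    (fun j C => insert (T.step j ⁻¹' {T.center j})
      ((fun H => closure (T.step j ⁻¹' (H \ {T.center j}))) '' C)) i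

/-- The last surface of the tower. -/
abbrev total : Type u := T.surf (Fin.last n)

/-- The blowing-down mapping `π` of the whole tower. -/
abbrev toPlane : T.total → ℝ × ℝ := T.proj (Fin.last n)

/-- `d = (l, m)` is the Hsiang & Pati local data along the component `H` of the exceptional
divisor: `π` has the corresponding local form at every regular point of the divisor on `H`. -/
def IsHsiangPatiData (H : Set T.total) (d : ℕ × ℕ) : Prop :=
  ∀ a ∈ H, IsRegularPoint (T.exc (Fin.last n)) a →
    HasHsiangPatiForm (T.exc (Fin.last n)) T.toPlane a d.1 d.2

end BlowUpTower

/-- A commutative diagram exhibiting the germ at the origin of `h` as a cascade blow-analytic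
homeomorphism. Germs are given by representatives: `h` is a homeomorphism between two open
neighbourhoods of the origin and the `hom i` are homeomorphisms between the preimages of these
neighbourhoods, the last of which is an analytic isomorphism. -/
structure CascadeDiagram {n : ℕ} (T : BlowUpTower.{u} n) (T' : BlowUpTower.{v} n)
    (h : OpenPartialHomeomorph (ℝ × ℝ) (ℝ × ℝ)) where
  zero_mem : (0 : ℝ × ℝ) ∈ h.source
  map_zero : h 0 = 0
  hom : ∀ i, OpenPartialHomeomorph (T.surf i) (T'.surf i)
  source_eq : ∀ i, (hom i).source = T.proj i ⁻¹' h.source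
  target_eq : ∀ i, (hom i).target = T'.proj i ⁻¹' h.target
  comm_base : ∀ q ∈ (hom 0).source, T'.base (hom 0 q) = h (T.base q)
  comm_step : ∀ (i : Fin n), ∀ q ∈ (hom i.succ).source,
    T'.step i (hom i.succ q) = hom i.castSucc (T.step i q)
  map_exc : ∀ i, hom i '' T.exc i = T'.exc i
  analytic : ContMDiffOn 𝓘(ℝ, ℝ × ℝ) 𝓘(ℝ, ℝ × ℝ) ω (hom (Fin.last n))
    (hom (Fin.last n)).source
  analytic_symm : ContMDiffOn 𝓘(ℝ, ℝ × ℝ) 𝓘(ℝ, ℝ × ℝ) ω (hom (Fin.last n)).symm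
    (hom (Fin.last n)).target

/-- The analytic isomorphism `Φ` between the blown-up surfaces. -/
abbrev CascadeDiagram.iso {n : ℕ} {T : BlowUpTower.{u} n} {T' : BlowUpTower.{v} n}
    {h : OpenPartialHomeomorph (ℝ × ℝ) (ℝ × ℝ)} (D : CascadeDiagram T T' h) :
    OpenPartialHomeomorph T.total T'.total :=
  D.hom (Fin.last n)

/-! Each exceptional curve `k` carries two integers: the order `l k` to which `π` vanishes along it
and the order `j k` to which `det dπ` vanishes along it. Locally `π` is `∏ f k ^ l k` times a
nonvanishing vector and `det dπ` is `∏ f k ^ j k` times a unit, where the `f k` are reduced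
equations of pairwise transverse curves (`PlaneModel`, made global in `CurveSystem`). Blowing up a
point of the divisor leaves the old integers unchanged and gives the new curve the sum of the `l k`,
and one plus the sum of the `j k`, over the curves through the center (`PlaneModel.blowUp`). So all
the integers depend only on which curves pass through each center.

The homeomorphisms of a cascade preserve this incidence. A center must go to a center, because its
fibre has two points while the other blowing-down is injective off its own center
(`map_center_of_comm`); hence strict transforms go to strict transforms. By induction, corresponding
curves have equal integers (`exists_curveSystem`). Analyticity is needed only on the last surfaces:
there `Φ` pulls reduced equations back to reduced equations, so the generators of the ideals
correspond up to units (`pullback_ideals`).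

At a regular point of the divisor the same integers give the Hsiang–Pati data. After a rotation, the
nonvanishing vector has a nonzero first component, whose `l`-th root is absorbed into `u`, so that
`π = (± u ^ l, u ^ l b)`. The jacobian `± l u ^ (2 l - 1) ∂b/∂y` has order `j`; integrating in `y`
gives `b = φ(u) + u ^ (j - 2 l + 1) v` with `v` a coordinate (`exists_hsiangPati_coordinates`).
Hence `m = j + 1 - l`, and conversely any normal form has these exponents
(`eq_of_hsiangPati_coordinates`). -/

set_option linter.unusedSectionVars false

/-! ### Division of analytic germs by a coordinate, at the level of power series -/

/-- The projection of the plane to the second axis. -/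
def sndAxis : (ℝ × ℝ) →L[ℝ] (ℝ × ℝ) :=
  (ContinuousLinearMap.inr ℝ ℝ ℝ).comp (ContinuousLinearMap.snd ℝ ℝ ℝ)

theorem sndAxis_apply (z : ℝ × ℝ) : sndAxis z = (0, z.2) := rfl

theorem norm_sndAxis_le : ‖sndAxis‖ ≤ 1 :=
  ContinuousLinearMap.opNorm_le_bound _ zero_le_one fun z => by
    rw [sndAxis_apply, one_mul, Prod.norm_def, Prod.norm_def]
    simp

/-- The coefficients of the quotient of `f - f (0, ·)` by the first coordinate. -/
noncomputable def quotSeries (p : FormalMultilinearSeries ℝ (ℝ × ℝ) ℝ) :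
    FormalMultilinearSeries ℝ (ℝ × ℝ) ℝ := fun n =>
  ∑ k : Fin (n + 1), ((p (n + 1)).curryMid k (1, 0)).compContinuousLinearMap
    (fun i : Fin n => if k.succAbove i < k then sndAxis else ContinuousLinearMap.id ℝ (ℝ × ℝ))

theorem norm_quotSeries_le (p : FormalMultilinearSeries ℝ (ℝ × ℝ) ℝ) (n : ℕ) :
    ‖quotSeries p n‖ ≤ (n + 1) * ‖p (n + 1)‖ := by
  unfold quotSeries
  refine (norm_sum_le _ _).trans ?_
  have h : ∀ k ∈ (Finset.univ : Finset (Fin (n + 1))),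
      ‖((p (n + 1)).curryMid k (1, 0)).compContinuousLinearMap
        (fun i : Fin n => if k.succAbove i < k then sndAxis
          else ContinuousLinearMap.id ℝ (ℝ × ℝ))‖ ≤ ‖p (n + 1)‖ := by
    intro k _
    refine (ContinuousMultilinearMap.norm_compContinuousLinearMap_le _ _).trans ?_
    have h1 : ‖(p (n + 1)).curryMid k (1, 0)‖ ≤ ‖p (n + 1)‖ := by
      refine (ContinuousLinearMap.le_opNorm _ _).trans ?_
      rw [ContinuousMultilinearMap.norm_curryMid, Prod.norm_def]
      simp
    have h2 : (∏ i : Fin n, ‖(if k.succAbove i < k then sndAxis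
          else ContinuousLinearMap.id ℝ (ℝ × ℝ))‖) ≤ 1 := by
      refine Finset.prod_le_one (fun _ _ => norm_nonneg _) fun i _ => ?_
      split_ifs
      · exact norm_sndAxis_le
      · exact ContinuousLinearMap.norm_id_le
    calc _ ≤ ‖p (n + 1)‖ * 1 := by gcongr
      _ = _ := mul_one _
  refine (Finset.sum_le_card_nsmul _ _ _ h).trans ?_
  simp

/-- Telescoping: replace `z` by its projection `(0, z.2)` one slot at a time. By linearity the
change in slot `k` is `z.1` times the value with `(1, 0)` in that slot, which is the `k`-th summand
of `quotSeries`. -/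
theorem mul_quotSeries (p : FormalMultilinearSeries ℝ (ℝ × ℝ) ℝ) (n : ℕ) (z : ℝ × ℝ) :
    z.1 * quotSeries p n (fun _ => z) =
      p (n + 1) (fun _ => z) - p (n + 1) (fun _ => (0, z.2)) := by
  set T : ℕ → ℝ := fun m => p (n + 1) (fun i => if (i : ℕ) < m then sndAxis z else z) with hT
  have h0 : T 0 = p (n + 1) (fun _ => z) := by simp [hT]
  have h1 : T (n + 1) = p (n + 1) (fun _ => (0, z.2)) := by
    simp only [hT]
    congr 1
    funext i
    rw [if_pos i.2, sndAxis_apply]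
  rw [← h0, ← h1, ← Finset.sum_range_sub' T (n + 1),
    ← Fin.sum_univ_eq_sum_range (fun i => T i - T (i + 1)), quotSeries,
    sum_apply, Finset.mul_sum]
  refine Finset.sum_congr rfl fun k _ => ?_
  rw [ContinuousMultilinearMap.compContinuousLinearMap_apply]
  set m : Fin n → ℝ × ℝ := fun i => (if k.succAbove i < k then sndAxis
          else ContinuousLinearMap.id ℝ (ℝ × ℝ)) z with hm
  have hk : T k = (p (n + 1)).curryMid k z m := by
    rw [ContinuousMultilinearMap.curryMid_apply]
    refine congrArg (p (n + 1)) ?_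
    rw [Fin.eq_insertNth_iff]
    refine ⟨by simp, ?_⟩
    funext i
    simp only [Fin.removeNth, hm, Fin.lt_def]
    split_ifs <;> rfl
  have hk' : T (k + 1) = (p (n + 1)).curryMid k (sndAxis z) m := by
    rw [ContinuousMultilinearMap.curryMid_apply]
    refine congrArg (p (n + 1)) ?_
    rw [Fin.eq_insertNth_iff]
    refine ⟨by simp, ?_⟩
    funext i
    have : (k.succAbove i : ℕ) ≠ k := fun h => Fin.succAbove_ne k i (Fin.ext h)
    simp only [Fin.removeNth, hm, Fin.lt_def]
    split_ifs <;> first | rfl | omega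
  have hz : z - sndAxis z = z.1 • ((1 : ℝ), (0 : ℝ)) := by
    rw [sndAxis_apply]; ext <;> simp
  rw [hk, hk', ← sub_apply, ← map_sub, hz, map_smul]
  rfl

/-- The factor `n + 1` in the norm bound is at most `2 ^ n`, so halving the radius absorbs it. -/
theorem quotSeries_radius_pos {p : FormalMultilinearSeries ℝ (ℝ × ℝ) ℝ} (hp : 0 < p.radius) :
    0 < (quotSeries p).radius := by
  obtain ⟨r, hr0, hr⟩ := ENNReal.lt_iff_exists_nnreal_btwn.1 hp
  have hr0' : 0 < r := by exact_mod_cast hr0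
  obtain ⟨C, hC, hle⟩ := p.norm_mul_pow_le_of_lt_radius hr
  have hr2 : (0 : ℝ) < (r : ℝ) := by exact_mod_cast hr0'
  refine lt_of_lt_of_le ?_ ((quotSeries p).le_radius_of_bound (C / r) (r := r / 2) ?_)
  · exact_mod_cast half_pos hr0'
  · intro n
    have h2 : ((n : ℝ) + 1) ≤ 2 ^ n := by exact_mod_cast n.lt_two_pow_self
    have h3 : ((r / 2 : NNReal) : ℝ) = (r : ℝ) / 2 := by push_cast; rfl
    rw [h3, div_pow, le_div_iff₀ hr2]
    have h4 := norm_quotSeries_le p n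
    have h5 := hle (n + 1)
    have h6 : ‖quotSeries p n‖ * ((r : ℝ) ^ n / 2 ^ n) * r
        = ‖quotSeries p n‖ * ((r : ℝ) ^ (n + 1)) / 2 ^ n := by ring
    rw [h6, div_le_iff₀ (by positivity)]
    calc ‖quotSeries p n‖ * (r : ℝ) ^ (n + 1) ≤ ((n + 1) * ‖p (n + 1)‖) * (r : ℝ) ^ (n + 1) := by
          gcongr
      _ = (n + 1) * (‖p (n + 1)‖ * (r : ℝ) ^ (n + 1)) := by ring
      _ ≤ 2 ^ n * C := by gcongr
      _ = C * 2 ^ n := mul_comm _ _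

/-- Division by the first coordinate. -/
theorem exists_eq_add_fst_mul {f : ℝ × ℝ → ℝ} (hf : AnalyticAt ℝ f 0) :
    ∃ g : ℝ × ℝ → ℝ, AnalyticAt ℝ g 0 ∧ ∀ᶠ z in 𝓝 (0 : ℝ × ℝ), f z = f (0, z.2) + z.1 * g z := by
  obtain ⟨p, hp⟩ := hf
  have hq := quotSeries_radius_pos hp.radius_pos
  have hg := ((quotSeries p).hasFPowerSeriesOnBall hq)
  refine ⟨(quotSeries p).sum, hg.analyticAt, ?_⟩
  have hA : Tendsto sndAxis (𝓝 0) (𝓝 0) := by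
    simpa using sndAxis.continuous.tendsto 0
  filter_upwards [hp.eventually_hasSum, hA.eventually hp.eventually_hasSum,
    hg.hasFPowerSeriesAt.eventually_hasSum] with z h1 h2 h3
  rw [zero_add] at h1 h2 h3
  rw [sndAxis_apply] at h2
  have h4 := h1.sub h2
  have h5 := h3.mul_left z.1
  simp only [mul_quotSeries] at h5
  -- Degree `n` of the quotient matches degree `n + 1` of `f`; the constant terms, split off by this
  -- shift, cancel.
  rw [← hasSum_nat_add_iff' 1] at h4
  have h6 := h4.unique h5
  have h7 : p 0 (fun _ => z) = p 0 (fun _ => (0, z.2)) := by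
    congr 1; funext i; exact i.elim0
  simp only [Finset.range_one, Finset.sum_singleton, h7, sub_self, sub_zero] at h6
  linarith

/-! ### Analytic changes of coordinates of the plane -/

theorem ContinuousLinearMap.det_plane (A : (ℝ × ℝ) →L[ℝ] (ℝ × ℝ)) :
    A.det = (A (1, 0)).1 * (A (0, 1)).2 - (A (0, 1)).1 * (A (1, 0)).2 := by
  rw [ContinuousLinearMap.det, ← LinearMap.det_toMatrix (Module.Basis.finTwoProd ℝ),
    Matrix.det_fin_two]
  simp [LinearMap.toMatrix_apply]

theorem ContinuousLinearMap.det_comp_plane (A B : (ℝ × ℝ) →L[ℝ] (ℝ × ℝ)) :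
    (A.comp B).det = A.det * B.det := by
  simp only [ContinuousLinearMap.det]
  exact LinearMap.det_comp _ _

theorem ContinuousLinearMap.apply_plane (φ : (ℝ × ℝ) →L[ℝ] ℝ) (z : ℝ × ℝ) :
    φ z = z.1 * φ (1, 0) + z.2 * φ (0, 1) := by
  have h : z = z.1 • ((1 : ℝ), (0 : ℝ)) + z.2 • ((0 : ℝ), (1 : ℝ)) := by ext <;> simp
  conv_lhs => rw [h]
  rw [map_add, map_smul, map_smul, smul_eq_mul, smul_eq_mul]

theorem ContinuousLinearMap.plane_ne_zero {φ : (ℝ × ℝ) →L[ℝ] ℝ} (h : φ ≠ 0) :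
    φ (1, 0) ≠ 0 ∨ φ (0, 1) ≠ 0 := by
  by_contra! hc
  refine h (ContinuousLinearMap.ext fun z => ?_)
  rw [φ.apply_plane, hc.1, hc.2]
  simp

/-- A germ at the origin of an analytic change of coordinates of the plane. -/
structure IsCoordChange (θ : ℝ × ℝ → ℝ × ℝ) : Prop where
  analytic : AnalyticAt ℝ θ 0
  map_zero : θ 0 = 0
  det_ne : (fderiv ℝ θ 0).det ≠ 0

namespace IsCoordChange

variable {θ η : ℝ × ℝ → ℝ × ℝ}

theorem tendsto (h : IsCoordChange θ) : Tendsto θ (𝓝 0) (𝓝 0) := by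
  have := h.analytic.continuousAt.tendsto
  rwa [h.map_zero] at this

theorem eventually (h : IsCoordChange θ) {P : ℝ × ℝ → Prop} (hP : ∀ᶠ z in 𝓝 0, P z) :
    ∀ᶠ z in 𝓝 0, P (θ z) := h.tendsto.eventually hP

theorem comp_analyticAt {F : Type*} [NormedAddCommGroup F] [NormedSpace ℝ F]
    {f : ℝ × ℝ → F} (hf : AnalyticAt ℝ f 0) (h : IsCoordChange θ) :
    AnalyticAt ℝ (fun z => f (θ z)) 0 :=
  AnalyticAt.comp (g := f) (f := θ) (by rwa [h.map_zero]) h.analytic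

theorem comp (h : IsCoordChange θ) (h' : IsCoordChange η) : IsCoordChange (fun z => θ (η z)) where
  analytic := h'.comp_analyticAt h.analytic
  map_zero := by rw [h'.map_zero, h.map_zero]
  det_ne := by
    have h1 : DifferentiableAt ℝ θ (η 0) := by
      rw [h'.map_zero]; exact h.analytic.differentiableAt
    have h2 := fderiv_comp (g := θ) (f := η) 0 h1 h'.analytic.differentiableAt
    rw [show (fun z => θ (η z)) = θ ∘ η from rfl, h2, ContinuousLinearMap.det_comp_plane,
      h'.map_zero]
    exact mul_ne_zero h.det_ne h'.det_ne

/-- By the chain rule the two jacobian determinants at the origin have product `1`. -/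
theorem of_leftInverse (hθ : AnalyticAt ℝ θ 0) (hη : AnalyticAt ℝ η 0) (h0 : θ 0 = 0)
    (h : ∀ᶠ z in 𝓝 0, η (θ z) = z) : IsCoordChange θ where
  analytic := hθ
  map_zero := h0
  det_ne := by
    have h1 : DifferentiableAt ℝ η (θ 0) := by rw [h0]; exact hη.differentiableAt
    have h2 := fderiv_comp (g := η) (f := θ) 0 h1 hθ.differentiableAt
    have h3 : (η ∘ θ) =ᶠ[𝓝 0] id := h
    rw [h3.fderiv_eq, fderiv_id] at h2
    have h4 := congrArg ContinuousLinearMap.det h2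
    rw [ContinuousLinearMap.det_comp_plane] at h4
    intro h5
    rw [h5, mul_zero, ContinuousLinearMap.det_plane] at h4
    simp at h4

/-- The inverse function theorem, for analytic germs. -/
theorem exists_openPartialHomeomorph (h : IsCoordChange θ) :
    ∃ e : OpenPartialHomeomorph (ℝ × ℝ) (ℝ × ℝ), 0 ∈ e.source ∧ (∀ z, e z = θ z) ∧
      ContDiffOn ℝ ω e e.source ∧ ContDiffOn ℝ ω e.symm e.target := by
  have hc : ContDiffAt ℝ ω θ 0 := h.analytic.contDiffAt
  set L := (fderiv ℝ θ 0).toContinuousLinearEquivOfDetNeZero h.det_ne with hL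
  have hd : HasFDerivAt θ (L : (ℝ × ℝ) →L[ℝ] (ℝ × ℝ)) 0 := by
    rw [hL, ContinuousLinearMap.coe_toContinuousLinearEquivOfDetNeZero]
    exact h.analytic.differentiableAt.hasFDerivAt
  set e := hc.toOpenPartialHomeomorph θ hd (by simp) with he
  have he0 : 0 ∈ e.source := hc.mem_toOpenPartialHomeomorph_source hd (by simp)
  have hec : ∀ z, e z = θ z := fun z => rfl
  have hsymm : ContDiffAt ℝ ω e.symm 0 := by
    have := hc.to_localInverse hd (by simp)
    rw [h.map_zero] at this
    exact this
  have hes : e.symm 0 = 0 := by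
    have := e.left_inv he0
    rwa [hec, h.map_zero] at this
  -- Analyticity of `θ` and of its inverse at the origin spreads to a neighbourhood, to which the
  -- local homeomorphism is then restricted.
  have h1 : ∀ᶠ z in 𝓝 (0 : ℝ × ℝ), ContDiffAt ℝ ω θ z := hc.eventually (by simp)
  have h2 : ∀ᶠ z in 𝓝 (0 : ℝ × ℝ), ContDiffAt ℝ ω e.symm z := hsymm.eventually (by simp)
  have h3 := h1.and (h.eventually h2)
  obtain ⟨U, hU, hUo, hU0⟩ := eventually_nhds_iff.1 h3
  refine ⟨e.restrOpen U hUo, ⟨he0, hU0⟩, hec, ?_, ?_⟩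
  · intro z hz
    exact (hU z hz.2).1.contDiffWithinAt
  · intro w hw
    have hw' : e.symm w ∈ U := by
      have := (e.restrOpen U hUo).map_target hw
      exact this.2
    have hwt : w ∈ e.target := hw.1
    have := (hU _ hw').2
    rw [← hec, e.right_inv hwt] at this
    exact this.contDiffWithinAt

theorem exists_inverse (h : IsCoordChange θ) : ∃ η, IsCoordChange η ∧
    (∀ᶠ z in 𝓝 0, η (θ z) = z) ∧ (∀ᶠ z in 𝓝 0, θ (η z) = z) := by
  obtain ⟨e, h0, he, h1, h2⟩ := h.exists_openPartialHomeomorph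
  have ht : (0 : ℝ × ℝ) ∈ e.target := by
    have := e.map_source h0
    rwa [he, h.map_zero] at this
  have hs : e.symm 0 = 0 := by
    have := e.left_inv h0
    rwa [he, h.map_zero] at this
  have ha : AnalyticAt ℝ e.symm 0 :=
    (h2.contDiffAt (e.open_target.mem_nhds ht)).analyticAt
  have hl : ∀ᶠ z in 𝓝 (0 : ℝ × ℝ), e.symm (θ z) = z := by
    filter_upwards [e.open_source.mem_nhds h0] with z hz
    rw [← he]; exact e.left_inv hz
  have hr : ∀ᶠ z in 𝓝 (0 : ℝ × ℝ), θ (e.symm z) = z := by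
    filter_upwards [e.open_target.mem_nhds ht] with z hz
    rw [← he]; exact e.right_inv hz
  exact ⟨e.symm, of_leftInverse ha h.analytic hs hr, hl, hr⟩

theorem of_prodMk {f g : ℝ × ℝ → ℝ} (hf : AnalyticAt ℝ f 0) (hg : AnalyticAt ℝ g 0)
    (hf0 : f 0 = 0) (hg0 : g 0 = 0)
    (h : fderiv ℝ f 0 (1, 0) * fderiv ℝ g 0 (0, 1) ≠ fderiv ℝ f 0 (0, 1) * fderiv ℝ g 0 (1, 0)) :
    IsCoordChange (fun z => (f z, g z)) where
  analytic := hf.prod hg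
  map_zero := by simp [hf0, hg0]
  det_ne := by
    rw [hf.differentiableAt.fderiv_prodMk hg.differentiableAt,
      ContinuousLinearMap.det_plane]
    exact sub_ne_zero.2 h

end IsCoordChange

/-! ### Reduced equations of smooth curve germs -/

theorem exists_isCoordChange_fst {u : ℝ × ℝ → ℝ} (hu : AnalyticAt ℝ u 0) (hu0 : u 0 = 0)
    (hdu : fderiv ℝ u 0 ≠ 0) : ∃ w : ℝ × ℝ → ℝ, IsCoordChange (fun z => (u z, w z)) := by
  set a := fderiv ℝ u 0 (1, 0)
  set b := fderiv ℝ u 0 (0, 1)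
  -- The differential of `u` turned by a right angle: the jacobian of `(u, L)` at the origin is `a²
  -- + b²`.
  let L : (ℝ × ℝ) →L[ℝ] ℝ :=
    a • ContinuousLinearMap.snd ℝ ℝ ℝ - b • ContinuousLinearMap.fst ℝ ℝ ℝ
  refine ⟨L, .of_prodMk hu (L.analyticAt 0) hu0 (map_zero L) ?_⟩
  rw [ContinuousLinearMap.fderiv]
  have h1 : L (1, 0) = -b := by simp [L]
  have h2 : L (0, 1) = a := by simp [L]
  rw [h1, h2]
  intro h
  have h3 : a * a + b * b = 0 := by
    change a * a = b * -b at h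
    linarith
  rcases ContinuousLinearMap.plane_ne_zero hdu with h4 | h4
  · have : 0 < a * a := mul_self_pos.2 h4
    nlinarith [mul_self_nonneg b]
  · have : 0 < b * b := mul_self_pos.2 h4
    nlinarith [mul_self_nonneg a]

/-- An analytic germ vanishing on the first axis is divisible by the first coordinate. -/
theorem exists_eq_fst_mul {f : ℝ × ℝ → ℝ} (hf : AnalyticAt ℝ f 0)
    (h : ∀ᶠ z in 𝓝 (0 : ℝ × ℝ), z.1 = 0 → f z = 0) :
    ∃ g : ℝ × ℝ → ℝ, AnalyticAt ℝ g 0 ∧ ∀ᶠ z in 𝓝 (0 : ℝ × ℝ), f z = z.1 * g z := by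
  obtain ⟨g, hg, hfg⟩ := exists_eq_add_fst_mul hf
  refine ⟨g, hg, ?_⟩
  have hA : Tendsto sndAxis (𝓝 0) (𝓝 0) := by
    simpa using sndAxis.continuous.tendsto 0
  filter_upwards [hfg, hA.eventually h] with z h1 h2
  rw [h1, ← sndAxis_apply, h2 rfl, zero_add]

/-- In coordinates whose first one is `u`, this is division by the first coordinate. -/
theorem exists_eq_mul_of_zeros {f u : ℝ × ℝ → ℝ} (hf : AnalyticAt ℝ f 0) (hu : AnalyticAt ℝ u 0)
    (hu0 : u 0 = 0) (hdu : fderiv ℝ u 0 ≠ 0) (h : ∀ᶠ z in 𝓝 (0 : ℝ × ℝ), u z = 0 → f z = 0) :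
    ∃ g : ℝ × ℝ → ℝ, AnalyticAt ℝ g 0 ∧ ∀ᶠ z in 𝓝 (0 : ℝ × ℝ), f z = u z * g z := by
  obtain ⟨w, hw⟩ := exists_isCoordChange_fst hu hu0 hdu
  obtain ⟨η, hη, hl, hr⟩ := hw.exists_inverse
  obtain ⟨g, hg, hfg⟩ := exists_eq_fst_mul (hη.comp_analyticAt hf) (by
    filter_upwards [hr, hη.eventually h] with z h1 h2 hz
    refine h2 ?_
    have := congrArg Prod.fst h1
    simpa [hz] using this)
  refine ⟨fun z => g (u z, w z), hw.comp_analyticAt hg, ?_⟩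
  filter_upwards [hl, hw.eventually hfg] with z h1 h2
  simpa only [h1] using h2

/-- Two reduced equations of the same smooth germ of curve differ by a unit. -/
theorem exists_unit_mul_of_zeros_iff {f u : ℝ × ℝ → ℝ} (hf : AnalyticAt ℝ f 0)
    (hu : AnalyticAt ℝ u 0) (hdf : f 0 = 0 → fderiv ℝ f 0 ≠ 0) (hdu : u 0 = 0 → fderiv ℝ u 0 ≠ 0)
    (h : ∀ᶠ z in 𝓝 (0 : ℝ × ℝ), u z = 0 ↔ f z = 0) :
    ∃ g : ℝ × ℝ → ℝ, AnalyticAt ℝ g 0 ∧ g 0 ≠ 0 ∧ ∀ᶠ z in 𝓝 (0 : ℝ × ℝ), f z = u z * g z := by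
  by_cases hu0 : u 0 = 0
  · obtain ⟨g, hg, hfg⟩ := exists_eq_mul_of_zeros hf hu hu0 (hdu hu0) (h.mono fun z hz => hz.1)
    refine ⟨g, hg, fun hg0 => ?_, hfg⟩
    -- If both `u` and the quotient vanished at the origin, the differential of `f` would vanish
    -- there too.
    refine hdf (h.self_of_nhds.1 hu0) ?_
    have h1 : f =ᶠ[𝓝 0] fun z => u z * g z := hfg
    rw [h1.fderiv_eq, fderiv_fun_mul hu.differentiableAt hg.differentiableAt, hu0, hg0]
    simp
  · have hf0 : f 0 ≠ 0 := fun hf0 => hu0 (h.self_of_nhds.2 hf0)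
    refine ⟨fun z => f z / u z, hf.div hu hu0, div_ne_zero hf0 hu0, ?_⟩
    filter_upwards [hu.continuousAt.eventually_ne hu0] with z hz
    field_simp

/-- The maximal ideal is generated by the coordinates. -/
theorem exists_eq_fst_mul_add_snd_mul {f : ℝ × ℝ → ℝ} (hf : AnalyticAt ℝ f 0) (h0 : f 0 = 0) :
    ∃ g₁ g₂ : ℝ × ℝ → ℝ, AnalyticAt ℝ g₁ 0 ∧ AnalyticAt ℝ g₂ 0 ∧
      ∀ᶠ z in 𝓝 (0 : ℝ × ℝ), f z = z.1 * g₁ z + z.2 * g₂ z := by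
  obtain ⟨g₁, hg₁, h₁⟩ := exists_eq_add_fst_mul hf
  have hL : AnalyticAt ℝ (fun z : ℝ × ℝ => ((0 : ℝ), z.1)) 0 :=
    analyticAt_const.prod analyticAt_fst
  have hs : AnalyticAt ℝ (fun z : ℝ × ℝ => (z.2, z.1)) 0 :=
    analyticAt_snd.prod analyticAt_fst
  -- The remainder `f (0, y)` is divided by `y` with the two coordinates exchanged; its constant
  -- term is `f 0 = 0`.
  obtain ⟨g₂, hg₂, h₂⟩ := exists_eq_add_fst_mul (f := fun z => f (0, z.1))
    (AnalyticAt.comp (g := f) (f := fun z : ℝ × ℝ => ((0 : ℝ), z.1)) hf hL)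
  refine ⟨g₁, fun z => g₂ (z.2, z.1), hg₁,
    AnalyticAt.comp (g := g₂) (f := fun z : ℝ × ℝ => (z.2, z.1)) hg₂ hs, ?_⟩
  have ht : Tendsto (fun z : ℝ × ℝ => (z.2, z.1)) (𝓝 0) (𝓝 0) := hs.continuousAt.tendsto
  filter_upwards [h₁, ht.eventually h₂] with z h3 h4
  have h5 : f (0, 0) = 0 := h0
  simp only [h5] at h4
  rw [h3, h4]
  ring

namespace IsCoordChange

variable {θ : ℝ × ℝ → ℝ × ℝ}

theorem fderiv_injective (h : IsCoordChange θ) : Function.Injective (fderiv ℝ θ 0) :=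
  ((fderiv ℝ θ 0).toContinuousLinearEquivOfDetNeZero h.det_ne).injective

theorem fderiv_surjective (h : IsCoordChange θ) : Function.Surjective (fderiv ℝ θ 0) :=
  ((fderiv ℝ θ 0).toContinuousLinearEquivOfDetNeZero h.det_ne).surjective

theorem fderiv_comp_apply {F : Type*} [NormedAddCommGroup F] [NormedSpace ℝ F]
    {f : ℝ × ℝ → F} (hf : AnalyticAt ℝ f 0) (h : IsCoordChange θ) (v : ℝ × ℝ) :
    fderiv ℝ (fun z => f (θ z)) 0 v = fderiv ℝ f 0 (fderiv ℝ θ 0 v) := by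
  have h1 : DifferentiableAt ℝ f (θ 0) := by rw [h.map_zero]; exact hf.differentiableAt
  have h2 := fderiv_comp (g := f) (f := θ) 0 h1 h.analytic.differentiableAt
  rw [show (fun z => f (θ z)) = f ∘ θ from rfl, h2, h.map_zero]
  rfl

theorem analyticAt_det {b : ℝ × ℝ} (h : AnalyticAt ℝ θ b) :
    AnalyticAt ℝ (fun z => (fderiv ℝ θ z).det) b := by
  have h1 : AnalyticAt ℝ (fderiv ℝ θ) b := h.fderiv
  have h2 : ∀ v, AnalyticAt ℝ (fun z => fderiv ℝ θ z v) b := fun v =>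
    ((ContinuousLinearMap.apply ℝ (ℝ × ℝ) v).analyticAt _).comp h1
  have h3 : ∀ v, AnalyticAt ℝ (fun z => (fderiv ℝ θ z v).1) b := fun v =>
    ((ContinuousLinearMap.fst ℝ ℝ ℝ).analyticAt _).comp (h2 v)
  have h4 : ∀ v, AnalyticAt ℝ (fun z => (fderiv ℝ θ z v).2) b := fun v =>
    ((ContinuousLinearMap.snd ℝ ℝ ℝ).analyticAt _).comp (h2 v)
  simp only [ContinuousLinearMap.det_plane]
  exact ((h3 _).mul (h4 _)).sub ((h3 _).mul (h4 _))

end IsCoordChange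

theorem eventually_det_fderiv_comp {p θ : ℝ × ℝ → ℝ × ℝ} (hp : AnalyticAt ℝ p 0)
    (hθ : AnalyticAt ℝ θ 0) (h0 : θ 0 = 0) :
    ∀ᶠ z in 𝓝 (0 : ℝ × ℝ), (fderiv ℝ (fun z => p (θ z)) z).det =
      (fderiv ℝ p (θ z)).det * (fderiv ℝ θ z).det := by
  have ht : Tendsto θ (𝓝 0) (𝓝 0) := by
    have := hθ.continuousAt.tendsto
    rwa [h0] at this
  filter_upwards [ht.eventually hp.eventually_analyticAt, hθ.eventually_analyticAt] with z h1 h2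
  have h3 := fderiv_comp (g := p) (f := θ) z h1.differentiableAt h2.differentiableAt
  rw [show (fun z => p (θ z)) = p ∘ θ from rfl, h3, ContinuousLinearMap.det_comp_plane]

/-- Closures are local. Strict transforms are defined as closures, so this lets them be compared in
charts. -/
theorem eventually_mem_closure_iff {X : Type*} [TopologicalSpace X] {S S' : Set X} {a : X}
    (h : ∀ᶠ z in 𝓝 a, z ∈ S ↔ z ∈ S') :
    ∀ᶠ z in 𝓝 a, z ∈ closure S ↔ z ∈ closure S' := by
  filter_upwards [eventually_eventually_nhds.2 h] with z hz
  rw [mem_closure_iff_frequently, mem_closure_iff_frequently]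
  exact frequently_congr hz

/-! ### Local models: monomial mappings along transverse curves -/

/-- Local description at the origin of a mapping germ `p` of the plane and of a family of curves
`S k` meeting transversally: `p` is `∏ k, f k ^ l k` times a germ that does not vanish, and its
jacobian determinant is `∏ k, f k ^ j k` times a unit, where `f k` is a reduced equation of
`S k`. -/
structure PlaneModel {ι : Type*} [Fintype ι] (p : ℝ × ℝ → ℝ × ℝ) (S : ι → Set (ℝ × ℝ))
    (l j : ι → ℕ) (f : ι → ℝ × ℝ → ℝ) : Prop where
  analytic : ∀ k, AnalyticAt ℝ (f k) 0
  zeros : ∀ k, ∀ᶠ z in 𝓝 (0 : ℝ × ℝ), z ∈ S k ↔ f k z = 0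
  fderiv_ne : ∀ k, f k 0 = 0 → fderiv ℝ (f k) 0 ≠ 0
  transverse : ∀ k k', k ≠ k' → f k 0 = 0 → f k' 0 = 0 →
    ∀ v, fderiv ℝ (f k) 0 v = 0 → fderiv ℝ (f k') 0 v = 0 → v = 0
  map_eq : ∃ A : ℝ × ℝ → ℝ × ℝ, AnalyticAt ℝ A 0 ∧ A 0 ≠ 0 ∧
    ∀ᶠ z in 𝓝 (0 : ℝ × ℝ), p z = (∏ k, f k z ^ l k) • A z
  det_eq : ∃ w : ℝ × ℝ → ℝ, AnalyticAt ℝ w 0 ∧ w 0 ≠ 0 ∧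
    ∀ᶠ z in 𝓝 (0 : ℝ × ℝ), (fderiv ℝ p z).det = (∏ k, f k z ^ j k) * w z

namespace PlaneModel

variable {ι : Type*} [Fintype ι] {p : ℝ × ℝ → ℝ × ℝ} {S : ι → Set (ℝ × ℝ)}
    {l j : ι → ℕ} {f : ι → ℝ × ℝ → ℝ}

theorem analyticAt_prod (h : PlaneModel p S l j f) (n : ι → ℕ) :
    AnalyticAt ℝ (fun z => ∏ k, f k z ^ n k) 0 :=
  Finset.analyticAt_fun_prod _ fun k _ => (h.analytic k).fun_pow (n k)

theorem analyticAt_map (h : PlaneModel p S l j f) : AnalyticAt ℝ p 0 := by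
  obtain ⟨A, hA, -, hpA⟩ := h.map_eq
  have h1 : AnalyticAt ℝ (fun z => (∏ k, f k z ^ l k) • A z) 0 :=
    (h.analyticAt_prod l).fun_smul hA
  exact h1.congr (hpA.mono fun z hz => hz.symm)

theorem congr {p' : ℝ × ℝ → ℝ × ℝ} {S' : ι → Set (ℝ × ℝ)} (h : PlaneModel p S l j f)
    (hp : p' =ᶠ[𝓝 0] p) (hS : ∀ k, ∀ᶠ z in 𝓝 (0 : ℝ × ℝ), z ∈ S' k ↔ z ∈ S k) :
    PlaneModel p' S' l j f where
  analytic := h.analytic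
  zeros k := by
    filter_upwards [hS k, h.zeros k] with z h1 h2
    rw [h1, h2]
  fderiv_ne := h.fderiv_ne
  transverse := h.transverse
  map_eq := by
    obtain ⟨A, hA, hA0, hpA⟩ := h.map_eq
    refine ⟨A, hA, hA0, ?_⟩
    filter_upwards [hp, hpA] with z h1 h2
    rw [h1, h2]
  det_eq := by
    obtain ⟨w, hw, hw0, hpw⟩ := h.det_eq
    refine ⟨w, hw, hw0, ?_⟩
    filter_upwards [hp.fderiv (𝕜 := ℝ), hpw] with z h1 h2
    rw [h1, h2]

theorem comp (h : PlaneModel p S l j f) {θ : ℝ × ℝ → ℝ × ℝ} (hθ : IsCoordChange θ) :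
    PlaneModel (fun z => p (θ z)) (fun k => θ ⁻¹' S k) l j (fun k z => f k (θ z)) where
  analytic k := hθ.comp_analyticAt (h.analytic k)
  zeros k := hθ.eventually (h.zeros k)
  fderiv_ne k h0 h1 := by
    rw [hθ.map_zero] at h0
    refine h.fderiv_ne k h0 (ContinuousLinearMap.ext fun v => ?_)
    obtain ⟨v, rfl⟩ := hθ.fderiv_surjective v
    rw [← hθ.fderiv_comp_apply (h.analytic k), h1]
    rfl
  transverse k k' hk h0 h0' v hv hv' := by
    rw [hθ.map_zero] at h0 h0'
    rw [hθ.fderiv_comp_apply (h.analytic _)] at hv hv'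
    have := h.transverse k k' hk h0 h0' _ hv hv'
    exact hθ.fderiv_injective (by rw [this, map_zero])
  map_eq := by
    obtain ⟨A, hA, hA0, hpA⟩ := h.map_eq
    exact ⟨fun z => A (θ z), hθ.comp_analyticAt hA, by simpa only [hθ.map_zero], hθ.eventually hpA⟩
  det_eq := by
    obtain ⟨w, hw, hw0, hpw⟩ := h.det_eq
    refine ⟨fun z => w (θ z) * (fderiv ℝ θ z).det,
      (hθ.comp_analyticAt hw).fun_mul (IsCoordChange.analyticAt_det hθ.analytic),
      mul_ne_zero (by rwa [hθ.map_zero]) hθ.det_ne, ?_⟩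
    filter_upwards [hθ.eventually hpw,
      eventually_det_fderiv_comp h.analyticAt_map hθ.analytic hθ.map_zero] with z h1 h2
    rw [h2, h1, mul_assoc]

/-- The curve `S k` has points close to the origin lying on no other curve of the family. -/
theorem frequently_zero (h : PlaneModel p S l j f) {k : ι} (hk : f k 0 = 0) :
    ∃ᶠ z in 𝓝[≠] (0 : ℝ × ℝ), f k z = 0 ∧ ∀ k' ≠ k, f k' z ≠ 0 := by
  obtain ⟨w, hw⟩ := exists_isCoordChange_fst (h.analytic k) hk (h.fderiv_ne k hk)
  obtain ⟨η, hη, hl, hr⟩ := hw.exists_inverse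
  have hγ : HasDerivAt (fun t : ℝ => ((0 : ℝ), t)) ((0 : ℝ), (1 : ℝ)) 0 :=
    (hasDerivAt_const _ _).prodMk (hasDerivAt_id _)
  have hγt : Tendsto (fun t : ℝ => ((0 : ℝ), t)) (𝓝 0) (𝓝 0) := by
    exact hγ.continuousAt.tendsto
  -- As `η` inverts the coordinates `(f k, w)`, the curve `t ↦ η (0, t)` parametrizes `f k = 0` with
  -- tangent vector `v`. By transversality, every other equation vanishing at the origin has nonzero
  -- derivative along `v`.
  set v := fderiv ℝ η 0 (0, 1) with hv
  have hv0 : v ≠ 0 := fun h0 => by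
    have := hη.fderiv_injective (a₁ := ((0 : ℝ), (1 : ℝ))) (a₂ := 0) (by rw [map_zero]; exact h0)
    simp at this
  have hder : ∀ k', HasDerivAt (fun t : ℝ => f k' (η (0, t))) (fderiv ℝ (f k') 0 v) 0 := by
    intro k'
    have h1 : HasFDerivAt (fun z => f k' (η z)) (fderiv ℝ (fun z => f k' (η z)) 0)
        ((0 : ℝ), (0 : ℝ)) :=
      (hη.comp_analyticAt (h.analytic k')).differentiableAt.hasFDerivAt
    have h2 := h1.comp_hasDerivAt (0 : ℝ) hγ
    rwa [hη.fderiv_comp_apply (h.analytic k')] at h2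
  have hk1 : ∀ᶠ t in 𝓝 (0 : ℝ), f k (η (0, t)) = 0 := by
    filter_upwards [hγt.eventually hr] with t ht
    exact congrArg Prod.fst ht
  have hkv : fderiv ℝ (f k) 0 v = 0 := by
    have h1 : (fun t : ℝ => f k (η (0, t))) =ᶠ[𝓝 0] fun _ => 0 := hk1
    exact (hder k).unique ((hasDerivAt_const (0 : ℝ) (0 : ℝ)).congr_of_eventuallyEq h1)
  have hk2 : ∀ᶠ t in 𝓝[≠] (0 : ℝ), ∀ k' ≠ k, f k' (η (0, t)) ≠ 0 := by
    rw [eventually_all]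
    intro k'
    by_cases hkk : k' = k
    · exact Eventually.of_forall fun _ h => absurd hkk h
    by_cases hk' : f k' 0 = 0
    · have h1 : fderiv ℝ (f k') 0 v ≠ 0 := fun h1 =>
        hv0 (h.transverse k' k hkk hk' hk v h1 hkv)
      filter_upwards [(hder k').eventually_ne (c := 0) h1] with t ht _ using ht
    · have h1 : Tendsto (fun t : ℝ => f k' (η (0, t))) (𝓝 0) (𝓝 (f k' 0)) :=
        (h.analytic k').continuousAt.tendsto.comp (hη.tendsto.comp hγt)
      filter_upwards [nhdsWithin_le_nhds (h1.eventually_ne hk')] with t ht _ using ht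
  have hηt : Tendsto (fun t : ℝ => η (0, t)) (𝓝[≠] 0) (𝓝[≠] 0) := by
    refine tendsto_nhdsWithin_iff.2 ⟨(hη.tendsto.comp hγt).mono_left nhdsWithin_le_nhds, ?_⟩
    filter_upwards [nhdsWithin_le_nhds (hγt.eventually hr), self_mem_nhdsWithin] with t ht ht0 h0
    have h1 : η (0, t) = 0 := h0
    rw [h1, hw.map_zero] at ht
    exact ht0 (congrArg Prod.snd ht).symm
  refine hηt.frequently (Eventually.frequently ?_)
  filter_upwards [nhdsWithin_le_nhds hk1, hk2] with t h1 h2 using ⟨h1, h2⟩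

end PlaneModel

/-! ### The standard blowing-up and its effect on local models -/

/-- The standard blowing-up of the origin in one of its charts. -/
def blowMap (z : ℝ × ℝ) : ℝ × ℝ := (z.1, z.1 * z.2)

theorem analyticAt_blowMap (z : ℝ × ℝ) : AnalyticAt ℝ blowMap z :=
  analyticAt_fst.prod (analyticAt_fst.fun_mul analyticAt_snd)

theorem blowMap_zero : blowMap 0 = 0 := by simp [blowMap]

theorem blowMap_eq_zero_iff (z : ℝ × ℝ) : blowMap z = 0 ↔ z.1 = 0 := by
  constructor
  · intro h; exact congrArg Prod.fst h
  · intro h; simp [blowMap, h]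

theorem tendsto_blowMap : Tendsto blowMap (𝓝 0) (𝓝 0) := by
  have := (analyticAt_blowMap 0).continuousAt.tendsto
  rwa [blowMap_zero] at this

theorem hasFDerivAt_blowMap (z : ℝ × ℝ) :
    HasFDerivAt blowMap ((ContinuousLinearMap.fst ℝ ℝ ℝ).prod
      (z.1 • ContinuousLinearMap.snd ℝ ℝ ℝ + z.2 • ContinuousLinearMap.fst ℝ ℝ ℝ)) z :=
  hasFDerivAt_fst.prodMk (hasFDerivAt_fst.mul hasFDerivAt_snd)

/-- This simple zero is the source of the `+ 1` in the jacobian exponent of a new curve. -/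
theorem det_fderiv_blowMap (z : ℝ × ℝ) : (fderiv ℝ blowMap z).det = z.1 := by
  rw [(hasFDerivAt_blowMap z).fderiv, ContinuousLinearMap.det_plane]
  simp

theorem comp_blowMap_analyticAt {F : Type*} [NormedAddCommGroup F] [NormedSpace ℝ F]
    {f : ℝ × ℝ → F} (hf : AnalyticAt ℝ f 0) : AnalyticAt ℝ (fun z => f (blowMap z)) 0 :=
  AnalyticAt.comp (g := f) (f := blowMap) (by rwa [blowMap_zero]) (analyticAt_blowMap 0)

/-- Division of a pulled-back germ by the equation of the exceptional curve. -/
theorem exists_comp_blowMap_eq {f : ℝ × ℝ → ℝ} (hf : AnalyticAt ℝ f 0) (h0 : f 0 = 0) :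
    ∃ g : ℝ × ℝ → ℝ, AnalyticAt ℝ g 0 ∧ (∀ᶠ z in 𝓝 (0 : ℝ × ℝ), f (blowMap z) = z.1 * g z) ∧
      g 0 = fderiv ℝ f 0 (1, 0) ∧ fderiv ℝ g 0 (0, 1) = fderiv ℝ f 0 (0, 1) := by
  obtain ⟨g₁, g₂, h₁, h₂, hfg⟩ := exists_eq_fst_mul_add_snd_mul hf h0
  have hb₁ := comp_blowMap_analyticAt h₁
  have hb₂ := comp_blowMap_analyticAt h₂
  have hd : fderiv ℝ f 0 = g₁ 0 • ContinuousLinearMap.fst ℝ ℝ ℝ +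
      g₂ 0 • ContinuousLinearMap.snd ℝ ℝ ℝ := by
    have h3 : f =ᶠ[𝓝 0] fun z => z.1 * g₁ z + z.2 * g₂ z := hfg
    have h4 := (hasFDerivAt_fst (𝕜 := ℝ) (p := ((0 : ℝ × ℝ)))).fun_mul
      h₁.differentiableAt.hasFDerivAt
    have h5 := (hasFDerivAt_snd (𝕜 := ℝ) (p := ((0 : ℝ × ℝ)))).fun_mul
      h₂.differentiableAt.hasFDerivAt
    rw [h3.fderiv_eq, (h4.fun_add h5).fderiv]
    simp
  refine ⟨fun z => g₁ (blowMap z) + z.2 * g₂ (blowMap z),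
    hb₁.fun_add (analyticAt_snd.fun_mul hb₂), ?_, ?_, ?_⟩
  · filter_upwards [tendsto_blowMap.eventually hfg] with z hz
    rw [hz]
    simp only [blowMap]
    ring
  · rw [hd]
    simp [blowMap_zero]
  -- `blowMap` contracts the axis `x = 0`, so `g₁ ∘ blowMap` has no derivative in the direction `(0,
  -- 1)`; only `g₂ 0` remains.
  · have h4 : HasFDerivAt (fun z => g₁ (blowMap z)) _ 0 :=
      HasFDerivAt.comp (g := g₁) (f := blowMap) (0 : ℝ × ℝ)
        (by rw [blowMap_zero]; exact h₁.differentiableAt.hasFDerivAt) (hasFDerivAt_blowMap 0)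
    have h5 := (hasFDerivAt_snd (𝕜 := ℝ) (p := ((0 : ℝ × ℝ)))).fun_mul
      hb₂.differentiableAt.hasFDerivAt
    rw [hd, (h4.fun_add h5).fderiv]
    have h6 : ((0 : ℝ), (0 : ℝ)) = 0 := rfl
    simp [blowMap_zero, h6]

/-- Near the origin, the closure of `{g = 0} \ {x = 0}` is `{g = 0}`, for a curve `{g = 0}`
transverse to `{x = 0}`. -/
theorem eventually_mem_closure_off_axis {g : ℝ × ℝ → ℝ} (hg : AnalyticAt ℝ g 0)
    (hd : g 0 = 0 → fderiv ℝ g 0 (0, 1) ≠ 0) :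
    ∀ᶠ z in 𝓝 (0 : ℝ × ℝ), z ∈ closure {z : ℝ × ℝ | z.1 ≠ 0 ∧ g z = 0} ↔ g z = 0 := by
  have h1 : ∀ᶠ z in 𝓝 (0 : ℝ × ℝ),
      z ∈ closure {z : ℝ × ℝ | z.1 ≠ 0 ∧ g z = 0} → g z = 0 := by
    filter_upwards [hg.eventually_analyticAt] with z hz hzc
    by_contra hne
    rw [mem_closure_iff_frequently] at hzc
    exact hzc ((hz.continuousAt.eventually_ne hne).mono fun w hw hw' => hw hw'.2)
  have h2 : ∀ᶠ z in 𝓝 (0 : ℝ × ℝ), g z = 0 →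
      z ∈ closure {z : ℝ × ℝ | z.1 ≠ 0 ∧ g z = 0} := by
    by_cases h0 : g 0 = 0
    · have hθ : IsCoordChange (fun z : ℝ × ℝ => (z.1, g z)) := by
        refine .of_prodMk analyticAt_fst hg rfl h0 ?_
        rw [fderiv_fst]
        simpa using hd h0
      obtain ⟨η, hη, hl, hr⟩ := hθ.exists_inverse
      have hγt : Tendsto (fun t : ℝ => (t, (0 : ℝ))) (𝓝 0) (𝓝 0) :=
        (continuous_id.prodMk continuous_const).tendsto' _ _ rfl
      have hcl : (0 : ℝ × ℝ) ∈ closure {z : ℝ × ℝ | z.1 ≠ 0 ∧ g z = 0} := by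
        rw [mem_closure_iff_frequently]
        have h3 : Tendsto (fun t : ℝ => η (t, 0)) (𝓝[≠] 0) (𝓝 0) :=
          (hη.tendsto.comp hγt).mono_left nhdsWithin_le_nhds
        refine h3.frequently (Eventually.frequently ?_)
        filter_upwards [nhdsWithin_le_nhds (hγt.eventually hr), self_mem_nhdsWithin] with t ht ht0
        have h4 := congrArg Prod.fst ht
        have h5 := congrArg Prod.snd ht
        simp only at h4 h5
        exact ⟨by rw [h4]; exact ht0, h5⟩
      filter_upwards [hl] with z hz hgz
      by_cases hz1 : z.1 = 0
      · have : z = 0 := by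
          rw [← hz, hz1, hgz]
          exact hη.map_zero
        rwa [this]
      · exact subset_closure ⟨hz1, hgz⟩
    · filter_upwards [hg.continuousAt.eventually_ne h0] with z hz hgz
      exact absurd hgz hz
  filter_upwards [h1, h2] with z h3 h4 using ⟨h3, h4⟩

theorem eventually_det_fderiv_comp_blowMap {p : ℝ × ℝ → ℝ × ℝ} (hp : AnalyticAt ℝ p 0) :
    ∀ᶠ z in 𝓝 (0 : ℝ × ℝ), (fderiv ℝ (fun z => p (blowMap z)) z).det =
      (fderiv ℝ p (blowMap z)).det * z.1 := by
  filter_upwards [eventually_det_fderiv_comp hp (analyticAt_blowMap 0) blowMap_zero] with z hz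
  rw [hz, det_fderiv_blowMap]

/-- Collects in slot `k₀` the powers of the exceptional equation `x` that split off the pulled-back
equations. Since `l k₀ = 0`, the previous occupant of that slot contributes nothing. -/
theorem prod_update_pow {ι : Type*} [Fintype ι] [DecidableEq ι] (e l : ι → ℕ) (k₀ : ι) (x : ℝ)
    (n : ℕ) (g : ι → ℝ) (h0 : l k₀ = 0) :
    ∏ k, Function.update g k₀ x k ^ Function.update l k₀ (∑ k, e k * l k + n) k =
      (∏ k, (x ^ e k * g k) ^ l k) * x ^ n := by
  rw [← Finset.mul_prod_erase Finset.univ _ (Finset.mem_univ k₀), Function.update_self,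
    Function.update_self]
  have h1 : ∏ k ∈ Finset.univ.erase k₀, Function.update g k₀ x k ^
      Function.update l k₀ (∑ k, e k * l k + n) k = ∏ k ∈ Finset.univ.erase k₀, g k ^ l k := by
    refine Finset.prod_congr rfl fun k hk => ?_
    rw [Function.update_of_ne (Finset.ne_of_mem_erase hk),
      Function.update_of_ne (Finset.ne_of_mem_erase hk)]
  have h2 : ∏ k, g k ^ l k = ∏ k ∈ Finset.univ.erase k₀, g k ^ l k := by
    rw [← Finset.mul_prod_erase Finset.univ _ (Finset.mem_univ k₀), h0, pow_zero, one_mul]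
  simp only [mul_pow]
  rw [h1, Finset.prod_mul_distrib, h2, pow_add, ← Finset.prod_pow_eq_pow_sum]
  simp only [← pow_mul]
  ring

namespace PlaneModel

variable {ι : Type*} [Fintype ι] [DecidableEq ι]

/-- The effect of blowing-up the origin: the new curve `k₀` gets as exponents the sums of those of
the curves through the origin (plus one for the jacobian determinant). -/
theorem blowUp {p : ℝ × ℝ → ℝ × ℝ} {S : ι → Set (ℝ × ℝ)} {l j : ι → ℕ} {f : ι → ℝ × ℝ → ℝ}
    (h : PlaneModel p S l j f) (k₀ : ι) (hl : l k₀ = 0) (hj : j k₀ = 0) (e : ι → ℕ)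
    (he : ∀ k, e k = if f k 0 = 0 then 1 else 0) {S' : ι → Set (ℝ × ℝ)}
    (hS₀ : ∀ᶠ z in 𝓝 (0 : ℝ × ℝ), z ∈ S' k₀ ↔ z.1 = 0)
    (hS : ∀ k ≠ k₀, ∀ᶠ z in 𝓝 (0 : ℝ × ℝ), z ∈ S' k ↔ z ∈ closure (blowMap ⁻¹' (S k \ {0}))) :
    ∃ f', PlaneModel (fun z => p (blowMap z)) S' (Function.update l k₀ (∑ k, e k * l k + 0))
      (Function.update j k₀ (∑ k, e k * j k + 1)) f' := by
  -- `g` is the equation of the strict transform. It vanishes at the origin only if the curve is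
  -- tangent there to `(1, 0)`, the direction corresponding to this point of the exceptional curve,
  -- and then it is transverse to the exceptional curve.
  have hg : ∀ k, ∃ g : ℝ × ℝ → ℝ, AnalyticAt ℝ g 0 ∧
      (∀ᶠ z in 𝓝 (0 : ℝ × ℝ), f k (blowMap z) = z.1 ^ e k * g z) ∧
      (g 0 = 0 → f k 0 = 0 ∧ fderiv ℝ (f k) 0 (1, 0) = 0 ∧ fderiv ℝ g 0 (0, 1) ≠ 0) := by
    intro k
    rw [he k]
    by_cases h0 : f k 0 = 0
    · obtain ⟨g, hg, hfg, hg0, hgd⟩ := exists_comp_blowMap_eq (h.analytic k) h0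
      refine ⟨g, hg, by simpa [h0] using hfg, fun h1 => ⟨h0, by rw [← hg0, h1], ?_⟩⟩
      rw [hgd]
      rcases ContinuousLinearMap.plane_ne_zero (h.fderiv_ne k h0) with h2 | h2
      · exact absurd (hg0.symm.trans h1) h2
      · exact h2
    · refine ⟨fun z => f k (blowMap z), comp_blowMap_analyticAt (h.analytic k), by simp [h0],
        fun h1 => absurd ?_ h0⟩
      simpa only [blowMap_zero] using h1
  choose g hga hfg hg0 using hg
  -- Used with `n = 0` for the mapping and with `n = 1` for the jacobian, whose extra factor is `det
  -- d(blowMap) = x`.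
  have hprod : ∀ (n : ℕ) (m : ι → ℕ), m k₀ = 0 → ∀ᶠ z in 𝓝 (0 : ℝ × ℝ),
      ∏ k, Function.update g k₀ Prod.fst k z ^ Function.update m k₀ (∑ k, e k * m k + n) k =
        (∏ k, f k (blowMap z) ^ m k) * z.1 ^ n := by
    intro n m hm
    filter_upwards [eventually_all.2 hfg] with z hz
    rw [Finset.prod_congr rfl fun k _ => congrArg (· ^ m k) (hz k),
      ← prod_update_pow e m k₀ z.1 n (fun k => g k z) hm]
    refine Finset.prod_congr rfl fun k _ => ?_
    congr 1
    by_cases hk : k = k₀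
    · subst hk; simp
    · simp [hk]
  refine ⟨Function.update g k₀ Prod.fst, ?_, ?_, ?_, ?_, ?_, ?_⟩
  · intro k
    by_cases hk : k = k₀
    · subst hk; simpa using analyticAt_fst
    · simpa [hk] using hga k
  · intro k
    by_cases hk : k = k₀
    · subst hk; simpa using hS₀
    · have h1 : ∀ᶠ z in 𝓝 (0 : ℝ × ℝ), z ∈ blowMap ⁻¹' (S k \ {0}) ↔
          z ∈ {z : ℝ × ℝ | z.1 ≠ 0 ∧ g k z = 0} := by
        filter_upwards [hfg k, tendsto_blowMap.eventually (h.zeros k)] with z h2 h3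
        rw [mem_preimage, Set.mem_sdiff, h3, h2, mem_singleton_iff, blowMap_eq_zero_iff]
        constructor
        · rintro ⟨h4, h5⟩
          exact ⟨h5, (mul_eq_zero.1 h4).resolve_left (pow_ne_zero _ h5)⟩
        · rintro ⟨h4, h5⟩
          exact ⟨by rw [h5, mul_zero], h4⟩
      filter_upwards [hS k hk, eventually_mem_closure_iff h1,
        eventually_mem_closure_off_axis (hga k) fun h4 => (hg0 k h4).2.2] with z h5 h6 h7
      rw [h5, h6, h7, Function.update_of_ne hk]
  · intro k
    by_cases hk : k = k₀
    · subst hk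
      intro _ h1
      rw [Function.update_self, fderiv_fst] at h1
      have := congrArg (fun φ : (ℝ × ℝ) →L[ℝ] ℝ => φ (1, 0)) h1
      simp at this
    · rw [Function.update_of_ne hk]
      intro h1 h2
      refine (hg0 k h1).2.2 ?_
      rw [h2]
      rfl
  · have key : ∀ k ≠ k₀, g k 0 = 0 → ∀ v : ℝ × ℝ, v.1 = 0 → fderiv ℝ (g k) 0 v = 0 → v = 0 := by
      intro k _ h1 v hv hv'
      rw [ContinuousLinearMap.apply_plane, hv, zero_mul, zero_add] at hv'
      exact Prod.ext hv ((mul_eq_zero.1 hv').resolve_right (hg0 k h1).2.2)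
    intro k k' hkk
    by_cases hk : k = k₀
    · subst hk
      rw [Function.update_self, Function.update_of_ne hkk.symm, fderiv_fst]
      intro _ h2 v hv hv'
      exact key k' hkk.symm h2 v hv hv'
    by_cases hk' : k' = k₀
    · subst hk'
      rw [Function.update_self, Function.update_of_ne hk, fderiv_fst]
      intro h2 _ v hv' hv
      exact key k hk h2 v hv hv'
    · rw [Function.update_of_ne hk, Function.update_of_ne hk']
      intro h1 h2
      -- Two old curves cannot meet here after the blowing-up: both would have been tangent to `(1,
      -- 0)`.
      have h3 := h.transverse k k' hkk (hg0 k h1).1 (hg0 k' h2).1 _ (hg0 k h1).2.1 (hg0 k' h2).2.1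
      have h4 := congrArg Prod.fst h3
      simp at h4
  · obtain ⟨A, hA, hA0, hpA⟩ := h.map_eq
    refine ⟨fun z => A (blowMap z), comp_blowMap_analyticAt hA, by simpa only [blowMap_zero], ?_⟩
    filter_upwards [hprod 0 l hl, tendsto_blowMap.eventually hpA] with z h1 h2
    rw [h1, h2, pow_zero, mul_one]
  · obtain ⟨w, hw, hw0, hpw⟩ := h.det_eq
    refine ⟨fun z => w (blowMap z), comp_blowMap_analyticAt hw, by simpa only [blowMap_zero], ?_⟩
    filter_upwards [hprod 1 j hj, tendsto_blowMap.eventually hpw,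
      eventually_det_fderiv_comp_blowMap h.analyticAt_map] with z h1 h2 h3
    rw [h1, h3, h2, pow_one]
    ring

/-- The first blowing-up: the only curve `k₀` has exponents `1` and `1`. -/
theorem ofCoordChange {θ : ℝ × ℝ → ℝ × ℝ} (hθ : IsCoordChange θ) (k₀ : ι)
    {S : ι → Set (ℝ × ℝ)} (hS₀ : ∀ᶠ z in 𝓝 (0 : ℝ × ℝ), z ∈ S k₀ ↔ z.1 = 0)
    (hS : ∀ k ≠ k₀, ∀ᶠ z in 𝓝 (0 : ℝ × ℝ), z ∉ S k) :
    ∃ f, PlaneModel (fun z => θ (blowMap z)) S (Pi.single k₀ 1) (Pi.single k₀ 1) f := by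
  set f : ι → ℝ × ℝ → ℝ := Function.update (fun _ _ => 1) k₀ Prod.fst with hf
  have hf₀ : f k₀ = Prod.fst := Function.update_self ..
  have hf₁ : ∀ k ≠ k₀, f k = fun _ => 1 := fun k hk => Function.update_of_ne hk _ _
  have hprod : ∀ z, ∏ k, f k z ^ (Pi.single k₀ 1 : ι → ℕ) k = z.1 := by
    intro z
    rw [Finset.prod_eq_single k₀ (fun k _ hk => by rw [hf₁ k hk, one_pow]) (by simp),
      hf₀, Pi.single_eq_same, pow_one]
  refine ⟨f, ?_, ?_, ?_, ?_, ?_, ?_⟩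
  · intro k
    by_cases hk : k = k₀
    · rw [hk, hf₀]; exact analyticAt_fst
    · rw [hf₁ k hk]; exact analyticAt_const
  · intro k
    by_cases hk : k = k₀
    · rw [hk, hf₀]; exact hS₀
    · rw [hf₁ k hk]
      filter_upwards [hS k hk] with z hz
      simp [hz]
  · intro k
    by_cases hk : k = k₀
    · rw [hk, hf₀]
      intro _ h1
      rw [fderiv_fst] at h1
      have := congrArg (fun φ : (ℝ × ℝ) →L[ℝ] ℝ => φ (1, 0)) h1
      simp at this
    · rw [hf₁ k hk]
      simp
  · intro k k' hkk h1 h2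
    by_cases hk : k = k₀
    · rw [hf₁ k' (hk ▸ hkk.symm)] at h2
      simp at h2
    · rw [hf₁ k hk] at h1
      simp at h1
  · have h1 : AnalyticAt ℝ (fun z => (θ z).1) 0 :=
      ((ContinuousLinearMap.fst ℝ ℝ ℝ).analyticAt _).comp hθ.analytic
    have h2 : AnalyticAt ℝ (fun z => (θ z).2) 0 :=
      ((ContinuousLinearMap.snd ℝ ℝ ℝ).analyticAt _).comp hθ.analytic
    obtain ⟨g₁, hg₁, h₁, e₁, -⟩ := exists_comp_blowMap_eq h1 (by simp [hθ.map_zero])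
    obtain ⟨g₂, hg₂, h₂, e₂, -⟩ := exists_comp_blowMap_eq h2 (by simp [hθ.map_zero])
    refine ⟨fun z => (g₁ z, g₂ z), hg₁.prod hg₂, ?_, ?_⟩
    · intro h0
      -- The value at the origin of `(θ ∘ blowMap) / x` is `dθ (1, 0)`, which is nonzero because
      -- `dθ` is injective.
      have h3 : fderiv ℝ (fun z => ((θ z).1, (θ z).2)) 0 (1, 0) = 0 := by
        rw [h1.differentiableAt.fderiv_prodMk h2.differentiableAt]
        exact Prod.ext (e₁.symm.trans (congrArg Prod.fst h0))
          (e₂.symm.trans (congrArg Prod.snd h0))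
      have h4 := hθ.fderiv_injective (a₁ := ((1 : ℝ), (0 : ℝ))) (a₂ := 0)
        (by rw [map_zero]; exact h3)
      simp at h4
    · filter_upwards [h₁, h₂] with z h3 h4
      rw [hprod]
      exact Prod.ext h3 h4
  · refine ⟨fun z => (fderiv ℝ θ (blowMap z)).det,
      comp_blowMap_analyticAt (IsCoordChange.analyticAt_det hθ.analytic), ?_, ?_⟩
    · simpa only [blowMap_zero] using hθ.det_ne
    · filter_upwards [eventually_det_fderiv_comp_blowMap hθ.analytic] with z hz
      rw [hz, hprod, mul_comm]

end PlaneModel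

/-! ### Centred charts on surfaces and transport of local models -/

section Charts

variable {M : Type u} [TopologicalSpace M] [ChartedSpace (ℝ × ℝ) M] [IsManifold 𝓘(ℝ, ℝ × ℝ) ω M]
variable {N : Type v} [TopologicalSpace N] [ChartedSpace (ℝ × ℝ) N] [IsManifold 𝓘(ℝ, ℝ × ℝ) ω N]

/-- `χ` is an analytic chart centred at `a`. -/
structure IsCenteredChart (χ : OpenPartialHomeomorph M (ℝ × ℝ)) (a : M) : Prop where
  mem_atlas : χ ∈ IsManifold.maximalAtlas 𝓘(ℝ, ℝ × ℝ) ω M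
  mem_source : a ∈ χ.source
  map_eq : χ a = 0

theorem trans_mem_maximalAtlas {χ : OpenPartialHomeomorph M (ℝ × ℝ)}
    (hχ : χ ∈ IsManifold.maximalAtlas 𝓘(ℝ, ℝ × ℝ) ω M)
    {e : OpenPartialHomeomorph (ℝ × ℝ) (ℝ × ℝ)} (he : ContDiffOn ℝ ω e e.source)
    (he' : ContDiffOn ℝ ω e.symm e.target) :
    χ.trans e ∈ IsManifold.maximalAtlas 𝓘(ℝ, ℝ × ℝ) ω M := by
  refine OpenPartialHomeomorph.mem_maximalAtlas_of_contMDiffOn _ ?_ ?_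
  · exact he.contMDiffOn.comp ((contMDiffOn_of_mem_maximalAtlas hχ).mono (by
      rw [OpenPartialHomeomorph.trans_source]; exact inter_subset_left)) (by
      rw [OpenPartialHomeomorph.trans_source]; exact inter_subset_right)
  · exact (contMDiffOn_symm_of_mem_maximalAtlas hχ).comp (he'.contMDiffOn.mono (by
      rw [OpenPartialHomeomorph.trans_target]; exact inter_subset_left)) (by
      rw [OpenPartialHomeomorph.trans_target]; exact inter_subset_right)

theorem contDiff_homeomorph_trans_mem_maximalAtlas {χ : OpenPartialHomeomorph M (ℝ × ℝ)}
    (hχ : χ ∈ IsManifold.maximalAtlas 𝓘(ℝ, ℝ × ℝ) ω M) {e : (ℝ × ℝ) ≃ₜ (ℝ × ℝ)}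
    (he : ContDiff ℝ ω e) (he' : ContDiff ℝ ω e.symm) :
    χ.trans e.toOpenPartialHomeomorph ∈ IsManifold.maximalAtlas 𝓘(ℝ, ℝ × ℝ) ω M :=
  trans_mem_maximalAtlas hχ he.contDiffOn he'.contDiffOn

theorem exists_isCenteredChart (a : M) :
    ∃ χ : OpenPartialHomeomorph M (ℝ × ℝ), IsCenteredChart χ a := by
  have h := contDiff_homeomorph_trans_mem_maximalAtlas
    (IsManifold.chart_mem_maximalAtlas (I := 𝓘(ℝ, ℝ × ℝ)) (n := ω) a)
    (e := Homeomorph.addRight (-(chartAt (ℝ × ℝ) a a)))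
    (contDiff_id.add contDiff_const) (contDiff_id.add contDiff_const)
  exact ⟨_, h, by simp, by simp⟩

namespace IsCenteredChart

variable {χ : OpenPartialHomeomorph M (ℝ × ℝ)} {χ' : OpenPartialHomeomorph N (ℝ × ℝ)} {a : M}

theorem zero_mem_target (h : IsCenteredChart χ a) : (0 : ℝ × ℝ) ∈ χ.target := by
  rw [← h.map_eq]; exact χ.map_source h.mem_source

theorem symm_zero (h : IsCenteredChart χ a) : χ.symm 0 = a := by
  rw [← h.map_eq]; exact χ.left_inv h.mem_source

theorem tendsto_symm (h : IsCenteredChart χ a) : Tendsto χ.symm (𝓝 0) (𝓝 a) := by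
  have := (χ.continuousAt_symm h.zero_mem_target).tendsto
  rwa [h.symm_zero] at this

theorem tendsto (h : IsCenteredChart χ a) : Tendsto χ (𝓝 a) (𝓝 0) := by
  have := (χ.continuousAt h.mem_source).tendsto
  rwa [h.map_eq] at this

theorem contMDiffAt (h : IsCenteredChart χ a) :
    ContMDiffAt 𝓘(ℝ, ℝ × ℝ) 𝓘(ℝ, ℝ × ℝ) ω χ a :=
  contMDiffAt_of_mem_maximalAtlas h.mem_atlas h.mem_source

theorem contMDiffAt_symm (h : IsCenteredChart χ a) :
    ContMDiffAt 𝓘(ℝ, ℝ × ℝ) 𝓘(ℝ, ℝ × ℝ) ω χ.symm 0 :=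
  contMDiffAt_symm_of_mem_maximalAtlas h.mem_atlas h.zero_mem_target

theorem eventually_symm (h : IsCenteredChart χ a) : ∀ᶠ q in 𝓝 a, χ.symm (χ q) = q :=
  χ.eventually_left_inverse h.mem_source

theorem eventually_apply_symm (h : IsCenteredChart χ a) :
    ∀ᶠ z in 𝓝 (0 : ℝ × ℝ), χ (χ.symm z) = z :=
  χ.eventually_right_inverse h.zero_mem_target

theorem analyticAt_comp_symm (h : IsCenteredChart χ a) {F : Type*} [NormedAddCommGroup F]
    [NormedSpace ℝ F] {f : M → F} (hf : ContMDiffAt 𝓘(ℝ, ℝ × ℝ) 𝓘(ℝ, F) ω f a) :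
    AnalyticAt ℝ (fun z => f (χ.symm z)) 0 := by
  have h1 : ContMDiffAt 𝓘(ℝ, ℝ × ℝ) 𝓘(ℝ, F) ω (f ∘ χ.symm) 0 :=
    ContMDiffAt.comp (g := f) (f := χ.symm) 0 (by rwa [h.symm_zero]) h.contMDiffAt_symm
  exact h1.contDiffAt.analyticAt

theorem contMDiffAt_comp (h : IsCenteredChart χ a) {F : Type*} [NormedAddCommGroup F]
    [NormedSpace ℝ F] [CompleteSpace F] {f : ℝ × ℝ → F} (hf : AnalyticAt ℝ f 0) :
    ContMDiffAt 𝓘(ℝ, ℝ × ℝ) 𝓘(ℝ, F) ω (fun q => f (χ q)) a := by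
  have h1 : ContMDiffAt 𝓘(ℝ, ℝ × ℝ) 𝓘(ℝ, F) ω f (χ a) := by
    rw [h.map_eq]; exact (hf.contDiffAt (n := ω)).contMDiffAt
  exact ContMDiffAt.comp (g := f) (f := χ) a h1 h.contMDiffAt

theorem analyticAt_comp (h : IsCenteredChart χ a) {F : M → N} (h' : IsCenteredChart χ' (F a))
    (hF : ContMDiffAt 𝓘(ℝ, ℝ × ℝ) 𝓘(ℝ, ℝ × ℝ) ω F a) :
    AnalyticAt ℝ (fun z => χ' (F (χ.symm z))) 0 :=
  h.analyticAt_comp_symm (f := fun q => χ' (F q))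
    (ContMDiffAt.comp (g := χ') (f := F) a h'.contMDiffAt hF)

/-- A local analytic isomorphism is a change of coordinates in centred charts. -/
theorem isCoordChange (h : IsCenteredChart χ a) {F : M → N} {G : N → M}
    (h' : IsCenteredChart χ' (F a)) (hF : ContMDiffAt 𝓘(ℝ, ℝ × ℝ) 𝓘(ℝ, ℝ × ℝ) ω F a)
    (hG : ContMDiffAt 𝓘(ℝ, ℝ × ℝ) 𝓘(ℝ, ℝ × ℝ) ω G (F a)) (hGF : ∀ᶠ q in 𝓝 a, G (F q) = q) :
    IsCoordChange (fun z => χ' (F (χ.symm z))) := by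
  have hGa : G (F a) = a := hGF.self_of_nhds
  refine .of_leftInverse (η := fun z => χ (G (χ'.symm z))) (h.analyticAt_comp h' hF)
    (h'.analyticAt_comp (by rwa [hGa]) hG) (by rw [h.symm_zero, h'.map_eq]) ?_
  have h1 : Tendsto (fun z => F (χ.symm z)) (𝓝 0) (𝓝 (F a)) :=
    hF.continuousAt.tendsto.comp h.tendsto_symm
  filter_upwards [h.eventually_apply_symm, h.tendsto_symm.eventually hGF,
    h1.eventually h'.eventually_symm] with z h2 h3 h4
  rw [h4, h3, h2]

/-- The chart obtained by changing the coordinates. -/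
theorem exists_isCenteredChart_comp (h : IsCenteredChart χ a) {θ : ℝ × ℝ → ℝ × ℝ}
    (hθ : IsCoordChange θ) :
    ∃ χ₁ : OpenPartialHomeomorph M (ℝ × ℝ), IsCenteredChart χ₁ a ∧ ∀ q, χ₁ q = θ (χ q) := by
  obtain ⟨e, he0, he, h1, h2⟩ := hθ.exists_openPartialHomeomorph
  refine ⟨χ.trans e, ⟨trans_mem_maximalAtlas h.mem_atlas h1 h2, ?_, ?_⟩, fun q => ?_⟩
  · rw [OpenPartialHomeomorph.trans_source]
    exact ⟨h.mem_source, by rw [mem_preimage, h.map_eq]; exact he0⟩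
  · rw [OpenPartialHomeomorph.coe_trans, Function.comp_apply, h.map_eq, he, hθ.map_zero]
  · rw [OpenPartialHomeomorph.coe_trans, Function.comp_apply, he]

theorem restr (h : IsCenteredChart χ a) {U : Set M} (hU : IsOpen U) (ha : a ∈ U) :
    IsCenteredChart (χ.restr U) a where
  mem_atlas := restr_mem_maximalAtlas _ h.mem_atlas hU
  mem_source := by
    rw [OpenPartialHomeomorph.restr_source, hU.interior_eq]; exact ⟨h.mem_source, ha⟩
  map_eq := h.map_eq

end IsCenteredChart

/-- The pull-back of a local model by a local analytic isomorphism. -/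
theorem PlaneModel.pullback {ι : Type*} [Fintype ι] {π : N → ℝ × ℝ} {C : ι → Set N} {l j : ι → ℕ}
    {f : ι → ℝ × ℝ → ℝ} {a : M} {F : M → N} {G : N → M} {χ : OpenPartialHomeomorph M (ℝ × ℝ)}
    {χ' : OpenPartialHomeomorph N (ℝ × ℝ)} (hχ : IsCenteredChart χ a)
    (hχ' : IsCenteredChart χ' (F a))
    (h : PlaneModel (fun z => π (χ'.symm z)) (fun k => χ'.symm ⁻¹' C k) l j f)
    (hF : ContMDiffAt 𝓘(ℝ, ℝ × ℝ) 𝓘(ℝ, ℝ × ℝ) ω F a)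
    (hG : ContMDiffAt 𝓘(ℝ, ℝ × ℝ) 𝓘(ℝ, ℝ × ℝ) ω G (F a)) (hGF : ∀ᶠ q in 𝓝 a, G (F q) = q) :
    PlaneModel (fun z => π (F (χ.symm z))) (fun k => χ.symm ⁻¹' (F ⁻¹' C k)) l j
      (fun k z => f k (χ' (F (χ.symm z)))) := by
  have h1 : Tendsto (fun z => F (χ.symm z)) (𝓝 0) (𝓝 (F a)) :=
    hF.continuousAt.tendsto.comp hχ.tendsto_symm
  refine (h.comp (hχ.isCoordChange hχ' hF hG hGF)).congr ?_ fun k => ?_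
  · filter_upwards [h1.eventually hχ'.eventually_symm] with z hz
    rw [hz]
  · filter_upwards [h1.eventually hχ'.eventually_symm] with z hz
    rw [mem_preimage, mem_preimage, mem_preimage, mem_preimage, hz]

/-- In some centred chart at `a`, the mapping `π` and the curves `C k` have a local model. -/
def HasModel {ι : Type*} [Fintype ι] (π : M → ℝ × ℝ) (C : ι → Set M) (l j : ι → ℕ) (a : M) :
    Prop :=
  ∃ χ : OpenPartialHomeomorph M (ℝ × ℝ), IsCenteredChart χ a ∧
    ∃ f, PlaneModel (fun z => π (χ.symm z)) (fun k => χ.symm ⁻¹' C k) l j f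

namespace HasModel

variable {ι : Type*} [Fintype ι] {π : M → ℝ × ℝ} {C : ι → Set M} {l j : ι → ℕ} {a : M}

/-- Independence of the chart: pull the model back by the identity. -/
theorem exists_model (h : HasModel π C l j a) {χ : OpenPartialHomeomorph M (ℝ × ℝ)}
    (hχ : IsCenteredChart χ a) :
    ∃ f, PlaneModel (fun z => π (χ.symm z)) (fun k => χ.symm ⁻¹' C k) l j f := by
  obtain ⟨χ', hχ', f, hf⟩ := h
  exact ⟨_, hf.pullback (F := id) (G := id) hχ hχ' contMDiffAt_id contMDiffAt_id
    (Eventually.of_forall fun _ => rfl)⟩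

end HasModel

end Charts

/-! ### Point blowings-up in charts -/

section BlowUp

variable {M : Type u} [TopologicalSpace M] [ChartedSpace (ℝ × ℝ) M] [IsManifold 𝓘(ℝ, ℝ × ℝ) ω M]
variable {N : Type v} [TopologicalSpace N] [ChartedSpace (ℝ × ℝ) N] [IsManifold 𝓘(ℝ, ℝ × ℝ) ω N]

/-- The homeomorphism `(x, y) ↦ (x, y - c x - d)` of the plane. -/
def shearHomeomorph (c d : ℝ) : (ℝ × ℝ) ≃ₜ (ℝ × ℝ) where
  toFun z := (z.1, z.2 - c * z.1 - d)
  invFun z := (z.1, z.2 + c * z.1 + d)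
  left_inv z := Prod.ext rfl (by ring)
  right_inv z := Prod.ext rfl (by ring)
  continuous_toFun := by fun_prop
  continuous_invFun := by fun_prop

theorem contDiff_shearHomeomorph (c d : ℝ) : ContDiff ℝ ω (shearHomeomorph c d) :=
  contDiff_fst.prodMk ((contDiff_snd.sub (contDiff_const.mul contDiff_fst)).sub contDiff_const)

theorem contDiff_shearHomeomorph_symm (c d : ℝ) : ContDiff ℝ ω (shearHomeomorph c d).symm :=
  contDiff_fst.prodMk ((contDiff_snd.add (contDiff_const.mul contDiff_fst)).add contDiff_const)

theorem contDiff_prodComm : ContDiff ℝ ω (Homeomorph.prodComm ℝ ℝ) :=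
  contDiff_snd.prodMk contDiff_fst

/-- The point is `(0, y)` in the given chart. Translating it to the origin upstairs is compensated
by the shear of slope `y` downstairs: `x (v + y) - y x = x v`. -/
theorem exists_blowMap_of_chart {σ : M → N} {a : M} {ψ : OpenPartialHomeomorph N (ℝ × ℝ)}
    {χ : OpenPartialHomeomorph M (ℝ × ℝ)} (hψ : IsCenteredChart ψ (σ a))
    (hχ : χ ∈ IsManifold.maximalAtlas 𝓘(ℝ, ℝ × ℝ) ω M) (ha : a ∈ χ.source)
    (h : ∀ z ∈ χ.target, ψ (σ (χ.symm z)) = blowMap z) :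
    ∃ (ψ' : OpenPartialHomeomorph N (ℝ × ℝ)) (χ' : OpenPartialHomeomorph M (ℝ × ℝ)),
      IsCenteredChart ψ' (σ a) ∧ IsCenteredChart χ' a ∧
      ∀ᶠ z in 𝓝 (0 : ℝ × ℝ), ψ' (σ (χ'.symm z)) = blowMap z := by
  have h1 : (χ a).1 = 0 := by
    have := h (χ a) (χ.map_source ha)
    rw [χ.left_inv ha, hψ.map_eq] at this
    exact (blowMap_eq_zero_iff _).1 this.symm
  set y := (χ a).2
  have hψ' : IsCenteredChart (ψ.trans (shearHomeomorph y 0).toOpenPartialHomeomorph) (σ a) :=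
    ⟨contDiff_homeomorph_trans_mem_maximalAtlas hψ.mem_atlas (contDiff_shearHomeomorph _ _)
      (contDiff_shearHomeomorph_symm _ _), by simpa using hψ.mem_source, by
      simp [hψ.map_eq, shearHomeomorph]⟩
  have hχ' : IsCenteredChart (χ.trans (shearHomeomorph 0 y).toOpenPartialHomeomorph) a :=
    ⟨contDiff_homeomorph_trans_mem_maximalAtlas hχ (contDiff_shearHomeomorph _ _)
      (contDiff_shearHomeomorph_symm _ _), by simpa using ha, by
      simp [shearHomeomorph, h1, y]⟩
  refine ⟨_, _, hψ', hχ', ?_⟩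
  filter_upwards [OpenPartialHomeomorph.open_target _ |>.mem_nhds hχ'.zero_mem_target] with z hz
  have hz' : (shearHomeomorph 0 y).symm z ∈ χ.target := by
    simpa using hz
  have h2 := h _ hz'
  change shearHomeomorph y 0 (ψ (σ (χ.symm ((shearHomeomorph 0 y).symm z)))) = blowMap z
  rw [h2]
  refine Prod.ext rfl ?_
  change z.1 * (z.2 + 0 * z.1 + y) - y * z.1 - 0 = z.1 * z.2
  ring

/-- In suitable centred charts, a point blowing-up is `(x, y) ↦ (x, x y)` at each point of the
exceptional curve. -/
theorem IsPointBlowUp.exists_blowMap {σ : M → N} {c : N} (h : IsPointBlowUp σ c) {a : M}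
    (ha : σ a = c) :
    ∃ (ψ : OpenPartialHomeomorph N (ℝ × ℝ)) (χ : OpenPartialHomeomorph M (ℝ × ℝ)),
      IsCenteredChart ψ c ∧ IsCenteredChart χ a ∧
      ∀ᶠ z in 𝓝 (0 : ℝ × ℝ), ψ (σ (χ.symm z)) = blowMap z := by
  subst ha
  obtain ⟨ψ, hψ, χ₁, hχ₁, χ₂, hχ₂, hc, hψc, hsrc, -, -, h₁, h₂, -⟩ := h.local_model
  have hmem : a ∈ χ₁.source ∪ χ₂.source := by rw [hsrc]; exact hc
  rcases hmem with ha | ha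
  · exact exists_blowMap_of_chart ⟨hψ, hc, hψc⟩ hχ₁ ha h₁
  -- Exchanging the coordinates upstairs and downstairs turns the second standard chart into the
  -- first.
  · have hψ' : IsCenteredChart (ψ.trans (Homeomorph.prodComm ℝ ℝ).toOpenPartialHomeomorph) (σ a) :=
      ⟨contDiff_homeomorph_trans_mem_maximalAtlas hψ contDiff_prodComm contDiff_prodComm,
        by simpa using hc, by simp [hψc]⟩
    refine exists_blowMap_of_chart hψ'
      (χ := χ₂.trans (Homeomorph.prodComm ℝ ℝ).toOpenPartialHomeomorph)
      (contDiff_homeomorph_trans_mem_maximalAtlas hχ₂ contDiff_prodComm contDiff_prodComm)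
      (by simpa using ha) fun z hz => ?_
    have hz' : z.swap ∈ χ₂.target := by simpa using hz
    have := h₂ _ hz'
    change (ψ (σ (χ₂.symm z.swap))).swap = blowMap z
    rw [this]
    exact Prod.ext rfl (mul_comm _ _)

/-- Outside the exceptional curve, a point blowing-up is a local analytic isomorphism. -/
theorem IsPointBlowUp.exists_localInverse {σ : M → N} {c : N} (h : IsPointBlowUp σ c)
    {a : M} (ha : σ a ≠ c) : ∃ G : N → M,
      ContMDiffAt 𝓘(ℝ, ℝ × ℝ) 𝓘(ℝ, ℝ × ℝ) ω G (σ a) ∧ ∀ᶠ q in 𝓝 a, G (σ q) = q := by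
  obtain ⟨e, hs, ht, he, hsymm⟩ := h.iso_off
  refine ⟨e.symm, hsymm.contMDiffAt (e.open_target.mem_nhds ?_), ?_⟩
  · rw [ht]; exact ha
  · filter_upwards [e.open_source.mem_nhds (show a ∈ e.source by rw [hs]; exact ha)] with q hq
    rw [← he hq, e.left_inv hq]

theorem IsPointBlowUp.injOn_off {σ : M → N} {c : N} (h : IsPointBlowUp σ c) :
    InjOn σ (σ ⁻¹' {c}ᶜ) := by
  obtain ⟨e, hs, -, he, -⟩ := h.iso_off
  rw [← hs]
  exact he.injOn_iff.1 e.injOn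

theorem IsPointBlowUp.exists_eq_off {σ : M → N} {c : N} (h : IsPointBlowUp σ c) {b : N}
    (hb : b ≠ c) : ∃ a, σ a = b := by
  obtain ⟨e, -, ht, he, -⟩ := h.iso_off
  have hb' : b ∈ e.target := by rw [ht]; exact hb
  exact ⟨e.symm b, by rw [← he (e.map_target hb'), e.right_inv hb']⟩

/-- The exceptional curve of a blowing-up has at least two points. -/
theorem IsPointBlowUp.exists_ne {σ : M → N} {c : N} (h : IsPointBlowUp σ c) :
    ∃ a b, a ≠ b ∧ σ a = c ∧ σ b = c := by
  obtain ⟨ψ, hψ, χ₁, hχ₁, χ₂, hχ₂, hc, hψc, hsrc, ht, -, h₁, -, -⟩ := h.local_model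
  have h0 : (0 : ℝ × ℝ) ∈ ψ.target := by rw [← hψc]; exact ψ.map_source hc
  have hmem : ∀ y : ℝ, ((0 : ℝ), y) ∈ χ₁.target := fun y => by
    rw [ht]
    change ((0 : ℝ), (0 : ℝ) * y) ∈ ψ.target
    rw [zero_mul]
    exact h0
  have hσ : ∀ y : ℝ, σ (χ₁.symm (0, y)) = c := by
    intro y
    have h2 := h₁ _ (hmem y)
    have h3 : σ (χ₁.symm (0, y)) ∈ ψ.source := by
      have : χ₁.symm (0, y) ∈ χ₁.source ∪ χ₂.source := Or.inl (χ₁.map_target (hmem y))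
      rwa [hsrc] at this
    refine ψ.injOn h3 hc ?_
    rw [h2, hψc]
    simp
  refine ⟨χ₁.symm (0, 0), χ₁.symm (0, 1), fun h4 => ?_, hσ 0, hσ 1⟩
  have h5 := χ₁.symm.injOn (hmem 0) (hmem 1) h4
  simp at h5

end BlowUp

/-- The equation of a curve missing the origin is a unit, so its powers can be absorbed into `A` and
`w`. Away from a new exceptional curve, its exponents may therefore be set freely. -/
theorem PlaneModel.update_exponents {ι : Type*} [Fintype ι] [DecidableEq ι]
    {p : ℝ × ℝ → ℝ × ℝ} {S : ι → Set (ℝ × ℝ)} {l j : ι → ℕ} {f : ι → ℝ × ℝ → ℝ}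
    (h : PlaneModel p S l j f) {k₀ : ι} (h0 : f k₀ 0 ≠ 0) (hl : l k₀ = 0) (hj : j k₀ = 0)
    (n m : ℕ) : PlaneModel p S (Function.update l k₀ n) (Function.update j k₀ m) f := by
  have hprod : ∀ (e : ι → ℕ) (r : ℕ) (z : ℝ × ℝ), e k₀ = 0 →
      ∏ k, f k z ^ Function.update e k₀ r k = (∏ k, f k z ^ e k) * f k₀ z ^ r := by
    intro e r z he
    rw [← Finset.mul_prod_erase Finset.univ _ (Finset.mem_univ k₀),
      ← Finset.mul_prod_erase Finset.univ (fun k => f k z ^ e k) (Finset.mem_univ k₀), he,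
      pow_zero, one_mul, mul_comm, Function.update_self]
    congr 1
    refine Finset.prod_congr rfl fun k hk => ?_
    rw [Function.update_of_ne (Finset.ne_of_mem_erase hk)]
  have hne := (h.analytic k₀).continuousAt.eventually_ne h0
  refine ⟨h.analytic, h.zeros, h.fderiv_ne, h.transverse, ?_, ?_⟩
  · obtain ⟨A, hA, hA0, hpA⟩ := h.map_eq
    have h1 : AnalyticAt ℝ (fun z => (f k₀ z ^ n)⁻¹) 0 :=
      ((h.analytic k₀).fun_pow n).fun_inv (pow_ne_zero _ h0)
    refine ⟨fun z => (f k₀ z ^ n)⁻¹ • A z, h1.fun_smul hA,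
      smul_ne_zero (inv_ne_zero (pow_ne_zero _ h0)) hA0, ?_⟩
    filter_upwards [hpA, hne] with z h2 h3
    rw [hprod l n z hl, h2, smul_smul, mul_assoc, mul_inv_cancel₀ (pow_ne_zero _ h3), mul_one]
  · obtain ⟨w, hw, hw0, hpw⟩ := h.det_eq
    have h1 : AnalyticAt ℝ (fun z => (f k₀ z ^ m)⁻¹) 0 :=
      ((h.analytic k₀).fun_pow m).fun_inv (pow_ne_zero _ h0)
    refine ⟨fun z => (f k₀ z ^ m)⁻¹ * w z, h1.fun_mul hw,
      mul_ne_zero (inv_ne_zero (pow_ne_zero _ h0)) hw0, ?_⟩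
    filter_upwards [hpw, hne] with z h2 h3
    have h4 := pow_ne_zero m h3
    rw [hprod j m z hj, h2]
    field_simp

theorem IsPointBlowUp.fst_eq_zero_iff {M : Type u} [TopologicalSpace M] [ChartedSpace (ℝ × ℝ) M]
    [IsManifold 𝓘(ℝ, ℝ × ℝ) ω M] {N : Type v} [TopologicalSpace N] [ChartedSpace (ℝ × ℝ) N]
    [IsManifold 𝓘(ℝ, ℝ × ℝ) ω N] {σ : M → N} {c : N} (h : IsPointBlowUp σ c) {a : M}
    (ha : σ a = c) {ψ : OpenPartialHomeomorph N (ℝ × ℝ)} {χ : OpenPartialHomeomorph M (ℝ × ℝ)}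
    (hψ : IsCenteredChart ψ c) (hχ : IsCenteredChart χ a)
    (hb : ∀ᶠ z in 𝓝 (0 : ℝ × ℝ), ψ (σ (χ.symm z)) = blowMap z) :
    ∀ᶠ z in 𝓝 (0 : ℝ × ℝ), (σ (χ.symm z) = ψ.symm (blowMap z)) ∧ (σ (χ.symm z) = c ↔ z.1 = 0) := by
  have h1 : Tendsto (fun z => σ (χ.symm z)) (𝓝 0) (𝓝 c) := by
    have := (h.analytic.continuous.tendsto a).comp hχ.tendsto_symm
    rwa [ha] at this
  filter_upwards [hb, h1.eventually hψ.eventually_symm] with z h2 h3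
  rw [h2] at h3
  refine ⟨h3.symm, ?_⟩
  constructor
  · intro h4
    rw [h4, hψ.map_eq] at h2
    exact (blowMap_eq_zero_iff _).1 h2.symm
  · intro h4
    rw [← h3, (blowMap_eq_zero_iff _).2 h4, hψ.symm_zero]

/-! ### Local models on a blown-up surface -/

namespace HasModel

variable {ι : Type*} [Fintype ι]
variable {M : Type u} [TopologicalSpace M] [ChartedSpace (ℝ × ℝ) M] [IsManifold 𝓘(ℝ, ℝ × ℝ) ω M]
variable {N : Type v} [TopologicalSpace N] [ChartedSpace (ℝ × ℝ) N] [IsManifold 𝓘(ℝ, ℝ × ℝ) ω N]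
variable {l j : ι → ℕ}

/-- Serves twice: a curve is never reduced to a center, so strict transforms are nonempty, and each
curve has points that are not corners. -/
theorem frequently_mem {π : M → ℝ × ℝ} {C : ι → Set M} {a : M} (h : HasModel π C l j a) {k : ι}
    (hk : a ∈ C k) : ∃ᶠ q in 𝓝[≠] a, q ∈ C k ∧ ∀ k' ≠ k, q ∉ C k' := by
  obtain ⟨χ, hχ, f, hf⟩ := h
  have h0 : f k 0 = 0 := by
    rw [← (hf.zeros k).self_of_nhds, mem_preimage, hχ.symm_zero]; exact hk
  have ht : Tendsto χ.symm (𝓝[≠] 0) (𝓝[≠] a) := by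
    refine tendsto_nhdsWithin_iff.2 ⟨hχ.tendsto_symm.mono_left nhdsWithin_le_nhds, ?_⟩
    filter_upwards [nhdsWithin_le_nhds hχ.eventually_apply_symm, self_mem_nhdsWithin] with z hz hz0 h1
    have h2 : χ.symm z = a := h1
    rw [h2, hχ.map_eq] at hz
    exact hz0 hz.symm
  refine ht.frequently (((hf.frequently_zero h0).and_eventually
    (nhdsWithin_le_nhds (eventually_all.2 hf.zeros))).mono ?_)
  rintro z ⟨⟨h1, h2⟩, h3⟩
  exact ⟨(h3 k).2 h1, fun k' hk' hm => h2 k' hk' ((h3 k').1 hm)⟩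

theorem map_eq_zero_iff {π : M → ℝ × ℝ} {C : ι → Set M} {a : M} (h : HasModel π C l j a) :
    π a = 0 ↔ ∃ k, a ∈ C k ∧ l k ≠ 0 := by
  obtain ⟨χ, hχ, f, hf⟩ := h
  obtain ⟨A, -, hA0, hpA⟩ := hf.map_eq
  have h1 := hpA.self_of_nhds
  rw [hχ.symm_zero] at h1
  rw [h1, smul_eq_zero, or_iff_left hA0, Finset.prod_eq_zero_iff]
  refine exists_congr fun k => ?_
  have h2 := (hf.zeros k).self_of_nhds
  rw [mem_preimage, hχ.symm_zero] at h2
  simp [pow_eq_zero_iff', h2]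

/-- The effect of a blowing-up outside the center. -/
theorem blowUp_off [DecidableEq ι] [T1Space N] {π : N → ℝ × ℝ} {C : ι → Set N} {σ : M → N} {c : N}
    (hσ : IsPointBlowUp σ c) {a : M} (ha : σ a ≠ c) (h : HasModel π C l j (σ a))
    (hcl : ∀ k, IsClosed (C k)) {k₀ : ι} (hC : C k₀ = ∅) (hl : l k₀ = 0) (hj : j k₀ = 0)
    (n m : ℕ) :
    HasModel (π ∘ σ)
      (Function.update (fun k => closure (σ ⁻¹' (C k \ {c}))) k₀ (σ ⁻¹' {c}))
      (Function.update l k₀ n) (Function.update j k₀ m) a := by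
  obtain ⟨ψ, hψ, f, hf⟩ := h
  obtain ⟨χ, hχ⟩ := exists_isCenteredChart a
  obtain ⟨G, hG, hGσ⟩ := hσ.exists_localInverse ha
  have h0 : f k₀ 0 ≠ 0 := by
    have := (hf.zeros k₀).self_of_nhds
    rw [hC] at this
    exact fun h1 => this.2 h1
  have hne : ∀ᶠ q in 𝓝 a, σ q ≠ c :=
    hσ.analytic.continuous.continuousAt.eventually_ne ha
  refine ⟨χ, hχ, _, ((hf.update_exponents h0 hl hj n m).pullback hχ hψ
    hσ.analytic.contMDiffAt hG hGσ).congr EventuallyEq.rfl fun k => ?_⟩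
  refine hχ.tendsto_symm.eventually (p := fun q => q ∈ Function.update
    (fun k => closure (σ ⁻¹' (C k \ {c}))) k₀ (σ ⁻¹' {c}) k ↔ q ∈ σ ⁻¹' C k) ?_
  by_cases hk : k = k₀
  · subst hk
    filter_upwards [hne] with q hq
    rw [Function.update_self, hC]
    simpa using hq
  · have h1 : ∀ᶠ q in 𝓝 a, q ∈ σ ⁻¹' (C k \ {c}) ↔ q ∈ σ ⁻¹' C k := by
      filter_upwards [hne] with q hq
      simp [hq]
    filter_upwards [eventually_mem_closure_iff h1] with q hq
    rw [Function.update_of_ne hk, hq,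
      ((hcl k).preimage hσ.analytic.continuous).closure_eq]

/-- The effect of a blowing-up over the center. -/
theorem blowUp_over [DecidableEq ι] {π : N → ℝ × ℝ} {C : ι → Set N} {σ : M → N} {c : N}
    (hσ : IsPointBlowUp σ c) {a : M} (ha : σ a = c) (h : HasModel π C l j c)
    {k₀ : ι} (hl : l k₀ = 0) (hj : j k₀ = 0) (e : ι → ℕ)
    [∀ k, Decidable (c ∈ C k)] (he : ∀ k, e k = if c ∈ C k then 1 else 0) :
    HasModel (π ∘ σ)
      (Function.update (fun k => closure (σ ⁻¹' (C k \ {c}))) k₀ (σ ⁻¹' {c}))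
      (Function.update l k₀ (∑ k, e k * l k + 0)) (Function.update j k₀ (∑ k, e k * j k + 1)) a := by
  obtain ⟨ψ, χ, hψ, hχ, hb⟩ := hσ.exists_blowMap ha
  obtain ⟨f, hf⟩ := h.exists_model hψ
  have hbb := hσ.fst_eq_zero_iff ha hψ hχ hb
  have he' : ∀ k, e k = if f k 0 = 0 then 1 else 0 := by
    intro k
    have := (hf.zeros k).self_of_nhds
    rw [mem_preimage, hψ.symm_zero] at this
    simp only [he k, this]
  obtain ⟨f', hf'⟩ := hf.blowUp k₀ hl hj e he'
    (S' := fun k => χ.symm ⁻¹'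
      (Function.update (fun k => closure (σ ⁻¹' (C k \ {c}))) k₀ (σ ⁻¹' {c}) k)) (by
      filter_upwards [hbb] with z hz
      rw [Function.update_self, mem_preimage, mem_preimage, mem_singleton_iff, hz.2]) (by
      intro k hk
      rw [Function.update_of_ne hk]
      have h1 : ∀ᶠ z in 𝓝 (0 : ℝ × ℝ), z ∈ χ.symm ⁻¹' (σ ⁻¹' (C k \ {c})) ↔
          z ∈ blowMap ⁻¹' (ψ.symm ⁻¹' C k \ {0}) := by
        filter_upwards [hbb] with z hz
        rw [mem_preimage, mem_preimage, mem_preimage, Set.mem_sdiff, Set.mem_sdiff,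
          mem_singleton_iff, mem_singleton_iff, hz.2, blowMap_eq_zero_iff, hz.1, mem_preimage]
      filter_upwards [eventually_mem_closure_iff h1,
        χ.open_target.mem_nhds hχ.zero_mem_target] with z h2 h3
      rw [← h2]
      -- A chart is a local homeomorphism, so closures may be taken on the surface or in the plane.
      have h4 := χ.symm.preimage_closure (σ ⁻¹' (C k \ {c}))
      have h5 := Set.ext_iff.1 h4 z
      simp only [mem_inter_iff] at h5
      have h6 : z ∈ χ.symm.source := h3
      simpa only [h6, true_and] using h5)
  refine ⟨χ, hχ, f', hf'.congr ?_ fun k => Eventually.of_forall fun _ => Iff.rfl⟩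
  filter_upwards [hbb] with z hz
  rw [Function.comp_apply, hz.1]

/-- The first blowing-up, over the origin. -/
theorem blowUp_origin [DecidableEq ι] {σ : M → ℝ × ℝ}
    (hσ : IsPointBlowUp σ 0) {a : M} (ha : σ a = 0) (k₀ : ι) :
    HasModel σ (Function.update (fun _ => ∅) k₀ (σ ⁻¹' {0})) (Pi.single k₀ 1) (Pi.single k₀ 1)
      a := by
  obtain ⟨ψ, χ, hψ, hχ, hb⟩ := hσ.exists_blowMap ha
  have hbb := hσ.fst_eq_zero_iff ha hψ hχ hb
  have hθ : IsCoordChange ψ.symm := by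
    refine .of_leftInverse (η := ψ) hψ.contMDiffAt_symm.contDiffAt.analyticAt
      hψ.contMDiffAt.contDiffAt.analyticAt hψ.symm_zero hψ.eventually_apply_symm
  obtain ⟨f, hf⟩ := PlaneModel.ofCoordChange hθ k₀ (S := fun k => χ.symm ⁻¹'
      (Function.update (fun _ : ι => (∅ : Set M)) k₀ (σ ⁻¹' {0}) k)) (by
      filter_upwards [hbb] with z hz
      rw [Function.update_self, mem_preimage, mem_preimage, mem_singleton_iff, hz.2]) (by
      intro k hk
      rw [Function.update_of_ne hk]
      exact Eventually.of_forall fun z => id)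
  refine ⟨χ, hχ, f, hf.congr ?_ fun k => Eventually.of_forall fun _ => Iff.rfl⟩
  filter_upwards [hbb] with z hz
  rw [hz.1]

theorem id_off_origin {b : ℝ × ℝ} (hb : b ≠ 0) :
    HasModel (id : ℝ × ℝ → ℝ × ℝ) (fun _ : ι => ∅) 0 0 b := by
  obtain ⟨χ, hχ⟩ := exists_isCenteredChart b
  have hθ : AnalyticAt ℝ χ.symm 0 := hχ.contMDiffAt_symm.contDiffAt.analyticAt
  refine ⟨χ, hχ, fun _ _ => 1, fun _ => analyticAt_const, fun k => by simp, fun k => by simp,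
    fun k k' _ h => by simp at h, ⟨χ.symm, hθ, by rwa [hχ.symm_zero], by simp⟩,
    ⟨_, IsCoordChange.analyticAt_det hθ, ?_, by simp⟩⟩
  -- Translation by `-b` brings the base point to the origin without changing the differential.
  have h1 : IsCoordChange (fun z => χ.symm z - b) := by
    refine .of_leftInverse (η := fun z => χ (z + b)) (hθ.fun_sub analyticAt_const) ?_
      (by simp [hχ.symm_zero]) ?_
    · refine AnalyticAt.comp (g := χ) (f := fun z => z + b) ?_ (analyticAt_id.fun_add analyticAt_const)
      rw [zero_add]
      exact hχ.contMDiffAt.contDiffAt.analyticAt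
    · filter_upwards [hχ.eventually_apply_symm] with z hz
      rw [sub_add_cancel, hz]
  have h2 := h1.det_ne
  rwa [fderiv_sub_const] at h2

end HasModel

/-! ### Systems of exceptional curves and their exponents -/

/-- The curves `C k`, `k ∈ s`, form a divisor along which `π` has a local model everywhere. -/
structure CurveSystem {ι : Type*} [Fintype ι] {M : Type u} [TopologicalSpace M]
    [ChartedSpace (ℝ × ℝ) M] [IsManifold 𝓘(ℝ, ℝ × ℝ) ω M] (π : M → ℝ × ℝ) (C : ι → Set M)
    (l j : ι → ℕ) (s : Set ι) : Prop where
  continuous : Continuous π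
  model : ∀ a, HasModel π C l j a
  closed : ∀ k, IsClosed (C k)
  nonempty : ∀ k ∈ s, (C k).Nonempty
  pos : ∀ k ∈ s, 0 < l k
  inactive : ∀ k ∉ s, C k = ∅ ∧ l k = 0 ∧ j k = 0

namespace CurveSystem

section

variable {ι : Type*} [Fintype ι]
variable {M : Type u} [TopologicalSpace M] [ChartedSpace (ℝ × ℝ) M] [IsManifold 𝓘(ℝ, ℝ × ℝ) ω M]
variable {N : Type v} [TopologicalSpace N] [ChartedSpace (ℝ × ℝ) N] [IsManifold 𝓘(ℝ, ℝ × ℝ) ω N]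
variable {l j : ι → ℕ} {s : Set ι}

theorem mem_of_mem {π : M → ℝ × ℝ} {C : ι → Set M} (h : CurveSystem π C l j s) {a : M} {k : ι}
    (ha : a ∈ C k) : k ∈ s := by
  by_contra hk
  rw [(h.inactive k hk).1] at ha
  exact ha

theorem map_eq_zero_iff {π : M → ℝ × ℝ} {C : ι → Set M} (h : CurveSystem π C l j s) {a : M} :
    π a = 0 ↔ ∃ k, a ∈ C k := by
  rw [(h.model a).map_eq_zero_iff]
  exact exists_congr fun k => and_iff_left_of_imp fun hk => (h.pos k (h.mem_of_mem hk)).ne'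

theorem subset_zero {π : M → ℝ × ℝ} {C : ι → Set M} (h : CurveSystem π C l j s) (k : ι) :
    C k ⊆ π ⁻¹' {0} := fun _ ha => h.map_eq_zero_iff.2 ⟨k, ha⟩

/-- The new exponents involve the center only through the indicator `e` of the curves containing it.
Inactive indices keep the index type fixed along the whole tower; each blowing-up activates one. -/
theorem blowUp [DecidableEq ι] [T1Space N] {π : N → ℝ × ℝ} {C : ι → Set N} (h : CurveSystem π C l j s)
    {σ : M → N} {c : N} (hσ : IsPointBlowUp σ c) (hc : π c = 0) {k₀ : ι} (hk₀ : k₀ ∉ s)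
    {e : ι → ℕ} (he₁ : ∀ k, c ∈ C k → e k = 1) (he₀ : ∀ k, c ∉ C k → e k = 0) :
    CurveSystem (π ∘ σ) (Function.update (fun k => closure (σ ⁻¹' (C k \ {c}))) k₀ (σ ⁻¹' {c}))
      (Function.update l k₀ (∑ k, e k * l k + 0))
      (Function.update j k₀ (∑ k, e k * j k + 1)) (insert k₀ s) where
  continuous := h.continuous.comp hσ.analytic.continuous
  model a := by
    obtain ⟨hC, hl, hj⟩ := h.inactive k₀ hk₀
    by_cases ha : σ a = c
    · classical
      exact HasModel.blowUp_over hσ ha (h.model c) hl hj e fun k => by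
        by_cases hk : c ∈ C k
        · rw [he₁ k hk, if_pos hk]
        · rw [he₀ k hk, if_neg hk]
    · exact HasModel.blowUp_off hσ ha (h.model _) h.closed hC hl hj _ _
  closed k := by
    by_cases hk : k = k₀
    · rw [hk, Function.update_self]
      exact isClosed_singleton.preimage hσ.analytic.continuous
    · rw [Function.update_of_ne hk]
      exact isClosed_closure
  nonempty k hk := by
    by_cases hkk : k = k₀
    · rw [hkk, Function.update_self]
      obtain ⟨a, -, -, ha, -⟩ := hσ.exists_ne
      exact ⟨a, ha⟩
    · rw [Function.update_of_ne hkk]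
      obtain ⟨b, hb⟩ := h.nonempty k (hk.resolve_left hkk)
      obtain ⟨b', hb', hne⟩ : ∃ b' ∈ C k, b' ≠ c := by
        by_cases hbc : b = c
        · subst hbc
          obtain ⟨q, ⟨hq, -⟩, hqne⟩ :=
            (((h.model b).frequently_mem hb).and_eventually self_mem_nhdsWithin).exists
          exact ⟨q, hq, hqne⟩
        · exact ⟨b, hb, hbc⟩
      obtain ⟨a, rfl⟩ := hσ.exists_eq_off hne
      exact ⟨a, subset_closure ⟨hb', hne⟩⟩
  pos k hk := by
    by_cases hkk : k = k₀
    · rw [hkk, Function.update_self, add_zero]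
      -- The center lies over the origin, hence on some curve, whose positive exponent enters the
      -- sum.
      obtain ⟨k', hk'⟩ := h.map_eq_zero_iff.1 hc
      refine lt_of_lt_of_le (h.pos k' (h.mem_of_mem hk')) ?_
      refine le_trans ?_ (Finset.single_le_sum (fun _ _ => Nat.zero_le _) (Finset.mem_univ k'))
      rw [he₁ k' hk', one_mul]
    · rw [Function.update_of_ne hkk]
      exact h.pos k (hk.resolve_left hkk)
  inactive k hk := by
    have hkk : k ≠ k₀ := fun h1 => hk (Or.inl h1)
    obtain ⟨h1, h2, h3⟩ := h.inactive k fun h1 => hk (Or.inr h1)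
    rw [Function.update_of_ne hkk, Function.update_of_ne hkk, Function.update_of_ne hkk]
    refine ⟨?_, h2, h3⟩
    simp [h1]

theorem blowUp_origin [DecidableEq ι] {σ : M → ℝ × ℝ} (hσ : IsPointBlowUp σ 0) (k₀ : ι) :
    CurveSystem σ (Function.update (fun _ => ∅) k₀ (σ ⁻¹' {0})) (Pi.single k₀ 1) (Pi.single k₀ 1)
      {k₀} where
  continuous := hσ.analytic.continuous
  model a := by
    by_cases ha : σ a = 0
    · exact HasModel.blowUp_origin hσ ha k₀
    -- Off the origin, start from the identity of the plane with no curves; `Pi.single k₀ 1` is the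
    -- zero family updated at `k₀`.
    · have := HasModel.blowUp_off (π := id) (C := fun _ : ι => ∅) (l := 0) (j := 0) hσ ha
        (HasModel.id_off_origin ha) (fun _ => isClosed_empty) (k₀ := k₀) rfl rfl rfl 1 1
      simpa only [empty_sdiff, preimage_empty, closure_empty] using! this
  closed k := by
    by_cases hk : k = k₀
    · rw [hk, Function.update_self]
      exact isClosed_singleton.preimage hσ.analytic.continuous
    · rw [Function.update_of_ne hk]
      exact isClosed_empty
  nonempty k hk := by
    rw [mem_singleton_iff.1 hk, Function.update_self]
    obtain ⟨a, -, -, ha, -⟩ := hσ.exists_ne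
    exact ⟨a, ha⟩
  pos k hk := by
    rw [mem_singleton_iff.1 hk, Pi.single_eq_same]
    exact zero_lt_one
  inactive k hk := by
    have hkk : k ≠ k₀ := hk
    rw [Function.update_of_ne hkk, Pi.single_eq_of_ne hkk]
    exact ⟨rfl, rfl, rfl⟩

end

end CurveSystem

/-! ### Cascades preserve centers, strict transforms and exponents -/

section Diagram

variable {M M' N N' : Type*} [TopologicalSpace M] [TopologicalSpace M'] [TopologicalSpace N]
  [TopologicalSpace N'] {g : OpenPartialHomeomorph M M'} {g₀ : OpenPartialHomeomorph N N'}
  {σ : M → N} {σ' : M' → N'}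

theorem image_preimage_eq_of_comm (hs : g.source = σ ⁻¹' g₀.source)
    (ht : g.target = σ' ⁻¹' g₀.target) (hc : ∀ q ∈ g.source, σ' (g q) = g₀ (σ q)) {X : Set N}
    (hX : X ⊆ g₀.source) : g '' (σ ⁻¹' X) = σ' ⁻¹' (g₀ '' X) := by
  ext q'
  constructor
  · rintro ⟨q, hq, rfl⟩
    exact ⟨σ q, hq, (hc q (by rw [hs]; exact hX hq)).symm⟩
  · rintro ⟨x, hx, hxq⟩
    have hq' : q' ∈ g.target := by
      rw [ht, mem_preimage, ← hxq]; exact g₀.map_source (hX hx)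
    have hq := g.map_target hq'
    refine ⟨g.symm q', ?_, g.right_inv hq'⟩
    have h1 := hc _ hq
    rw [g.right_inv hq', ← hxq] at h1
    rw [hs] at hq
    rw [mem_preimage, ← g₀.injOn (hX hx) hq h1]
    exact hx

/-- The closed sets `Z` and `Z'` (the exceptional divisors) keep both closures inside the domains;
continuity of `g` and of its inverse each give one inclusion. -/
theorem image_closure_eq {X Z : Set M} {Z' : Set M'} (hZ : IsClosed Z) (hZ' : IsClosed Z')
    (hZs : Z ⊆ g.source) (hZt : Z' ⊆ g.target) (hX : X ⊆ Z) (hX' : g '' X ⊆ Z') :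
    g '' closure X = closure (g '' X) := by
  have h1 : closure X ⊆ g.source := (closure_minimal hX hZ).trans hZs
  have h2 : closure (g '' X) ⊆ g.target := (closure_minimal hX' hZ').trans hZt
  refine Subset.antisymm (g.continuousOn.mono h1).image_closure ?_
  have h3 := (g.continuousOn_symm.mono h2).image_closure
  have h4 : g.symm '' (g '' X) = X := by
    rw [image_image]
    have : ∀ x ∈ X, g.symm (g x) = x := fun x hx => g.left_inv (hZs (hX hx))
    rw [image_congr this, image_id']
  rw [h4] at h3
  intro q hq
  exact ⟨g.symm q, h3 ⟨q, hq, rfl⟩, g.right_inv (h2 hq)⟩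

/-- If `g₀ c` were not `c'`, two distinct points over `c` would be sent to distinct points over `g₀
c`, where `σ'` is injective. -/
theorem map_center_of_comm
    (hs : g.source = σ ⁻¹' g₀.source)
    (hc : ∀ q ∈ g.source, σ' (g q) = g₀ (σ q)) {c : N} {c' : N'}
    (hσ : ∃ a b, a ≠ b ∧ σ a = c ∧ σ b = c) (hσ' : InjOn σ' (σ' ⁻¹' {c'}ᶜ))
    (hcs : c ∈ g₀.source) : g₀ c = c' := by
  obtain ⟨a, b, hab, ha, hb⟩ := hσ
  have has : a ∈ g.source := by rw [hs, mem_preimage, ha]; exact hcs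
  have hbs : b ∈ g.source := by rw [hs, mem_preimage, hb]; exact hcs
  by_contra hne
  have h1 := hc a has
  have h2 := hc b hbs
  rw [ha] at h1
  rw [hb] at h2
  refine hab (g.injOn has hbs (hσ' ?_ ?_ (h1.trans h2.symm)))
  · rw [mem_preimage, h1]; exact hne
  · rw [mem_preimage, h2]; exact hne

end Diagram

namespace BlowUpTower

variable {n : ℕ} (T : BlowUpTower.{u} n)

theorem proj_zero : T.proj 0 = T.base := rfl

theorem proj_succ (i : Fin n) : T.proj i.succ = T.proj i.castSucc ∘ T.step i := rfl

theorem proj_center (i : Fin n) : T.proj i.castSucc (T.center i) = 0 := T.center_mem i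

theorem components_zero : T.components 0 = {T.base ⁻¹' {0}} := rfl

theorem components_succ (i : Fin n) : T.components i.succ =
    insert (T.step i ⁻¹' {T.center i})
      ((fun H => closure (T.step i ⁻¹' (H \ {T.center i}))) '' T.components i.castSucc) := rfl

theorem image_update_eq_components (i : Fin n) {C : Fin (n + 1) → Set (T.surf i.castSucc)}
    (h : T.components i.castSucc = C '' Iic i.castSucc) :
    T.components i.succ =
      Function.update (fun k => closure (T.step i ⁻¹' (C k \ {T.center i}))) i.succ
        (T.step i ⁻¹' {T.center i}) '' Iic i.succ := by
  have h1 : Iic i.succ = insert i.succ (Iic i.castSucc) := by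
    ext k
    simp only [mem_Iic, mem_insert_iff, Fin.le_def, Fin.ext_iff, Fin.val_succ, Fin.val_castSucc]
    omega
  rw [components_succ, h, h1, image_insert_eq, Function.update_self, image_image]
  congr 1
  refine image_congr fun k hk => ?_
  rw [Function.update_of_ne]
  rintro rfl
  simp [Fin.le_def] at hk

end BlowUpTower

namespace CascadeDiagram

variable {n : ℕ} {T : BlowUpTower.{u} n} {T' : BlowUpTower.{v} n}
  {h : OpenPartialHomeomorph (ℝ × ℝ) (ℝ × ℝ)} (D : CascadeDiagram T T' h)

theorem exc_subset_source (i : Fin (n + 1)) : T.exc i ⊆ (D.hom i).source := by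
  intro q hq
  rw [D.source_eq, mem_preimage, show T.proj i q = 0 from hq]
  exact D.zero_mem

theorem exc_subset_target (i : Fin (n + 1)) : T'.exc i ⊆ (D.hom i).target := by
  rw [← D.map_exc]
  rintro _ ⟨q, hq, rfl⟩
  exact (D.hom i).map_source (D.exc_subset_source i hq)

/-- The exceptional curves of the two towers correspond to each other and have the same
multiplicities. -/
theorem exists_curveSystem (i : Fin (n + 1)) :
    ∃ (C : Fin (n + 1) → Set (T.surf i)) (C' : Fin (n + 1) → Set (T'.surf i))
      (l j : Fin (n + 1) → ℕ), CurveSystem (T.proj i) C l j (Iic i) ∧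
      CurveSystem (T'.proj i) C' l j (Iic i) ∧ (∀ k, D.hom i '' C k = C' k) ∧
      T.components i = C '' Iic i ∧ T'.components i = C' '' Iic i := by
  induction i using Fin.induction with
  | zero =>
    have h0 : Iic (0 : Fin (n + 1)) = {0} := by
      ext k; simp
    refine ⟨Function.update (fun _ => ∅) 0 (T.base ⁻¹' {0}),
      Function.update (fun _ => ∅) 0 (T'.base ⁻¹' {0}), Pi.single 0 1, Pi.single 0 1, ?_, ?_, ?_,
      ?_, ?_⟩
    · rw [h0]; exact CurveSystem.blowUp_origin T.base_blowUp 0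
    · rw [h0]; exact CurveSystem.blowUp_origin T'.base_blowUp 0
    · intro k
      by_cases hk : k = 0
      · rw [hk, Function.update_self, Function.update_self]
        exact D.map_exc 0
      · rw [Function.update_of_ne hk, Function.update_of_ne hk, image_empty]
    · rw [h0, image_singleton, Function.update_self, T.components_zero]
    · rw [h0, image_singleton, Function.update_self, T'.components_zero]
  | succ i ih =>
    obtain ⟨C, C', l, j, hC, hC', hCC', hcomp, hcomp'⟩ := ih
    have hs : (D.hom i.succ).source = T.step i ⁻¹' (D.hom i.castSucc).source := by
      rw [D.source_eq, D.source_eq]; rfl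
    have ht : (D.hom i.succ).target = T'.step i ⁻¹' (D.hom i.castSucc).target := by
      rw [D.target_eq, D.target_eq]; rfl
    have hcs : T.center i ∈ (D.hom i.castSucc).source :=
      D.exc_subset_source _ (T.proj_center i)
    have hcen : D.hom i.castSucc (T.center i) = T'.center i :=
      map_center_of_comm hs (D.comm_step i) (T.step_blowUp i).exists_ne
        (T'.step_blowUp i).injOn_off hcs
    have hCs : ∀ k, C k ⊆ (D.hom i.castSucc).source := fun k =>
      (hC.subset_zero k).trans (D.exc_subset_source _)
    -- The incidence of centers and curves agrees on both sides, so one indicator `e`, and hence the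
    -- same new exponents, serve both towers.
    have hmem : ∀ k, T'.center i ∈ C' k ↔ T.center i ∈ C k := by
      intro k
      rw [← hcen, ← hCC']
      exact (D.hom i.castSucc).injOn.mem_image_iff (hCs k) hcs
    have hIic : Iic i.succ = insert i.succ (Iic i.castSucc) := by
      ext k
      simp only [mem_Iic, mem_insert_iff, Fin.le_def, Fin.ext_iff, Fin.val_succ, Fin.val_castSucc]
      omega
    have hnot : i.succ ∉ Iic i.castSucc := by simp [Fin.le_def]
    obtain ⟨e, he₁, he₀⟩ : ∃ e : Fin (n + 1) → ℕ, (∀ k, T.center i ∈ C k → e k = 1) ∧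
        ∀ k, T.center i ∉ C k → e k = 0 := by
      classical
      exact ⟨fun k => if T.center i ∈ C k then 1 else 0, fun k hk => if_pos hk,
        fun k hk => if_neg hk⟩
    have h1 := hC.blowUp (T.step_blowUp i) (T.proj_center i) hnot he₁ he₀
    have h2 := hC'.blowUp (T'.step_blowUp i) (T'.proj_center i) hnot (e := e)
      (fun k hk => he₁ k ((hmem k).1 hk)) (fun k hk => he₀ k (mt (hmem k).2 hk))
    rw [← hIic] at h1 h2
    refine ⟨_, _, _, _, h1, h2, fun k => ?_, T.image_update_eq_components i hcomp,
      T'.image_update_eq_components i hcomp'⟩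
    by_cases hk : k = i.succ
    · rw [hk, Function.update_self, Function.update_self,
        image_preimage_eq_of_comm hs ht (D.comm_step i) (singleton_subset_iff.2 hcs),
        image_singleton, hcen]
    · rw [Function.update_of_ne hk, Function.update_of_ne hk]
      have h3 : D.hom i.castSucc '' (C k \ {T.center i}) = C' k \ {T'.center i} := by
        rw [← hCC', ← hcen]
        ext q'
        constructor
        · rintro ⟨q, ⟨hq, hqc⟩, rfl⟩
          exact ⟨⟨q, hq, rfl⟩, fun h3 => hqc ((D.hom i.castSucc).injOn (hCs k hq) hcs h3)⟩
        · rintro ⟨⟨q, hq, rfl⟩, hqc⟩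
          exact ⟨q, ⟨hq, fun h3 => hqc (congrArg _ h3)⟩, rfl⟩
      have h4 : D.hom i.succ '' (T.step i ⁻¹' (C k \ {T.center i})) =
          T'.step i ⁻¹' (C' k \ {T'.center i}) := by
        rw [image_preimage_eq_of_comm hs ht (D.comm_step i) (sdiff_subset.trans (hCs k)), h3]
      -- The exceptional divisors are closed and contained in the domains, which allows passing to
      -- closures.
      have h5 : T.step i ⁻¹' (C k \ {T.center i}) ⊆ T.exc i.succ := fun q hq =>
        hC.subset_zero k hq.1
      have h6 : T'.step i ⁻¹' (C' k \ {T'.center i}) ⊆ T'.exc i.succ := fun q hq =>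
        hC'.subset_zero k hq.1
      rw [image_closure_eq (isClosed_singleton.preimage h1.continuous)
        (isClosed_singleton.preimage h2.continuous) (D.exc_subset_source i.succ)
        (D.exc_subset_target i.succ) h5 (by rw [h4]; exact h6), h4]

end CascadeDiagram

/-! ### The ideals of the blowing-down and of its jacobian -/

section Ideals

variable {M : Type u} [TopologicalSpace M] [ChartedSpace (ℝ × ℝ) M] [IsManifold 𝓘(ℝ, ℝ × ℝ) ω M]
variable {N : Type v} [TopologicalSpace N] [ChartedSpace (ℝ × ℝ) N] [IsManifold 𝓘(ℝ, ℝ × ℝ) ω N]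
variable {χ : OpenPartialHomeomorph M (ℝ × ℝ)} {χ' : OpenPartialHomeomorph N (ℝ × ℝ)} {a : M}

namespace IsCenteredChart

/-- The germ at `a` given by an analytic germ in a centred chart. -/
def germ (hχ : IsCenteredChart χ a) (f : ℝ × ℝ → ℝ) (hf : AnalyticAt ℝ f 0) : analyticGerms a :=
  ⟨((fun q => f (χ q) : M → ℝ) : Germ (𝓝 a) ℝ), _, hχ.contMDiffAt_comp hf, rfl⟩

theorem germ_mul (hχ : IsCenteredChart χ a) {f g : ℝ × ℝ → ℝ} (hf : AnalyticAt ℝ f 0)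
    (hg : AnalyticAt ℝ g 0) :
    hχ.germ (fun z => f z * g z) (hf.fun_mul hg) = hχ.germ f hf * hχ.germ g hg := rfl

theorem germ_congr (hχ : IsCenteredChart χ a) {f g : ℝ × ℝ → ℝ} (hf : AnalyticAt ℝ f 0)
    (hg : AnalyticAt ℝ g 0) (h : ∀ᶠ z in 𝓝 (0 : ℝ × ℝ), f z = g z) : hχ.germ f hf = hχ.germ g hg :=
  Subtype.ext (Germ.coe_eq.2 (hχ.tendsto.eventually h))

theorem eq_germ (hχ : IsCenteredChart χ a) (g : analyticGerms a) {f : M → ℝ}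
    {k : ℝ × ℝ → ℝ} (hk : AnalyticAt ℝ k 0) (hg : (g : Germ (𝓝 a) ℝ) = (f : Germ (𝓝 a) ℝ))
    (h : ∀ᶠ z in 𝓝 (0 : ℝ × ℝ), f (χ.symm z) = k z) : g = hχ.germ k hk := by
  refine Subtype.ext (hg.trans (Germ.coe_eq.2 ?_))
  filter_upwards [hχ.tendsto.eventually h, hχ.eventually_symm] with q h1 h2
  rw [← h1, h2]

theorem germ_mem_span (hχ : IsCenteredChart χ a) {f g r : ℝ × ℝ → ℝ} (hf : AnalyticAt ℝ f 0)
    (hg : AnalyticAt ℝ g 0) (hr : AnalyticAt ℝ r 0)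
    (h : ∀ᶠ z in 𝓝 (0 : ℝ × ℝ), f z = r z * g z) :
    hχ.germ f hf ∈ Ideal.span {hχ.germ g hg} := by
  rw [Ideal.mem_span_singleton']
  exact ⟨hχ.germ r hr, by rw [← hχ.germ_mul, hχ.germ_congr _ _ h]⟩

theorem span_germ_eq (hχ : IsCenteredChart χ a) {f g r : ℝ × ℝ → ℝ} (hf : AnalyticAt ℝ f 0)
    (hg : AnalyticAt ℝ g 0) (hr : AnalyticAt ℝ r 0) (hr0 : r 0 ≠ 0)
    (h : ∀ᶠ z in 𝓝 (0 : ℝ × ℝ), f z = r z * g z) :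
    Ideal.span {hχ.germ f hf} = Ideal.span {hχ.germ g hg} := by
  refine le_antisymm ?_ ?_ <;> rw [Ideal.span_singleton_le_iff_mem]
  · exact hχ.germ_mem_span hf hg hr h
  · refine hχ.germ_mem_span hg hf (hr.fun_inv hr0) ?_
    filter_upwards [h, hr.continuousAt.eventually_ne hr0] with z h1 h2
    rw [h1, inv_mul_cancel_left₀ h2]

end IsCenteredChart

theorem pullbackIdeal_span_germ (hχ : IsCenteredChart χ a) {F : M → N}
    (hχ' : IsCenteredChart χ' (F a)) (hF : ContMDiffAt 𝓘(ℝ, ℝ × ℝ) 𝓘(ℝ, ℝ × ℝ) ω F a)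
    {f : ℝ × ℝ → ℝ} (hf : AnalyticAt ℝ f 0)
    (hf' : AnalyticAt ℝ (fun z => f (χ' (F (χ.symm z)))) 0) :
    pullbackIdeal F a (Ideal.span {hχ'.germ f hf}) = Ideal.span {hχ.germ _ hf'} := by
  have hFt := hF.continuousAt.tendsto
  refine le_antisymm ?_ ?_
  · refine Ideal.span_le.2 ?_
    rintro g ⟨k, k₀, hk, hkk, hg⟩
    obtain ⟨⟨_, r, hr, rfl⟩, rfl⟩ := Ideal.mem_span_singleton'.1 hk
    have hkk' : ∀ᶠ q in 𝓝 (F a), r q * f (χ' q) = k₀ q := Germ.coe_eq.1 hkk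
    have h1 : AnalyticAt ℝ (fun z => r (F (χ.symm z))) 0 :=
      hχ.analyticAt_comp_symm (f := fun q => r (F q)) (ContMDiffAt.comp (g := r) (f := F) a hr hF)
    rw [SetLike.mem_coe, hχ.eq_germ g (h1.fun_mul hf') hg (by
      filter_upwards [(hFt.comp hχ.tendsto_symm).eventually hkk'] with z hz
      exact hz.symm)]
    exact hχ.germ_mem_span _ _ h1 (Eventually.of_forall fun _ => rfl)
  · rw [Ideal.span_singleton_le_iff_mem]
    refine Ideal.subset_span ⟨hχ'.germ f hf, fun q => f (χ' q),
      Ideal.subset_span (mem_singleton _), rfl, ?_⟩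
    refine Germ.coe_eq.2 ?_
    filter_upwards [hχ.eventually_symm] with q hq
    rw [hq]
    rfl

variable {ι : Type*} [Fintype ι] {π : M → ℝ × ℝ} {C : ι → Set M} {l j : ι → ℕ}
  {f : ι → ℝ × ℝ → ℝ}

/-- With `π = F • A` and `F = ∏ f k ^ l k`, every generator of the pull-back is a multiple of `F`;
as `A 0 ≠ 0`, one component of `π` is `F` times a unit. -/
theorem maximalPullback_eq_span (hχ : IsCenteredChart χ a)
    (h : PlaneModel (fun z => π (χ.symm z)) (fun k => χ.symm ⁻¹' C k) l j f) :
    maximalPullback π a = Ideal.span {hχ.germ _ (h.analyticAt_prod l)} := by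
  obtain ⟨A, hA, hA0, hpA⟩ := h.map_eq
  have hp := h.analyticAt_map
  have hA₁ : AnalyticAt ℝ (fun z => (A z).1) 0 :=
    ((ContinuousLinearMap.fst ℝ ℝ ℝ).analyticAt _).comp hA
  have hA₂ : AnalyticAt ℝ (fun z => (A z).2) 0 :=
    ((ContinuousLinearMap.snd ℝ ℝ ℝ).analyticAt _).comp hA
  have hp₁ : AnalyticAt ℝ (fun z => (π (χ.symm z)).1) 0 :=
    ((ContinuousLinearMap.fst ℝ ℝ ℝ).analyticAt _).comp hp
  have hp₂ : AnalyticAt ℝ (fun z => (π (χ.symm z)).2) 0 :=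
    ((ContinuousLinearMap.snd ℝ ℝ ℝ).analyticAt _).comp hp
  have hπ : Tendsto (fun z => π (χ.symm z)) (𝓝 0) (𝓝 (π a)) := by
    have := hp.continuousAt.tendsto
    rwa [hχ.symm_zero] at this
  refine le_antisymm ?_ ?_
  · refine Ideal.span_le.2 ?_
    rintro g ⟨⟨_, k, hk, rfl⟩, k₀, hk0, hkk, hg⟩
    have hka : AnalyticAt ℝ k (π a) := hk.contDiffAt.analyticAt
    have hkk' : ∀ᶠ q in 𝓝 (π a), k q = k₀ q := Germ.coe_eq.1 hkk
    have hkπ : AnalyticAt ℝ (fun z => k (π (χ.symm z))) 0 :=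
      AnalyticAt.comp (g := k) (f := fun z => π (χ.symm z)) (by rwa [hχ.symm_zero]) hp
    rw [SetLike.mem_coe, hχ.eq_germ g hkπ hg (by
      filter_upwards [hπ.eventually hkk'] with z hz
      exact hz.symm)]
    -- Over the origin, expand `k` in the two coordinates; elsewhere `F` is already a unit.
    by_cases h0 : π a = 0
    · have hk00 : k (π a) = 0 := hk0 h0
      rw [h0] at hka hk00 hπ
      obtain ⟨g₁, g₂, hg₁, hg₂, hkg⟩ := exists_eq_fst_mul_add_snd_mul hka hk00
      have hg₁π : AnalyticAt ℝ (fun z => g₁ (π (χ.symm z))) 0 :=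
        AnalyticAt.comp (g := g₁) (f := fun z => π (χ.symm z)) (by rwa [hχ.symm_zero, h0]) hp
      have hg₂π : AnalyticAt ℝ (fun z => g₂ (π (χ.symm z))) 0 :=
        AnalyticAt.comp (g := g₂) (f := fun z => π (χ.symm z)) (by rwa [hχ.symm_zero, h0]) hp
      refine hχ.germ_mem_span _ _ ((hA₁.fun_mul hg₁π).fun_add (hA₂.fun_mul hg₂π)) ?_
      filter_upwards [hπ.eventually hkg, hpA] with z h1 h2
      rw [h1]
      have h3 := congrArg Prod.fst h2
      have h4 := congrArg Prod.snd h2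
      simp only [Prod.smul_fst, Prod.smul_snd, smul_eq_mul] at h3 h4
      rw [h3, h4]
      ring
    · have h1 : ∏ k, f k 0 ^ l k ≠ 0 := by
        intro h1
        have h2 := hpA.self_of_nhds
        rw [hχ.symm_zero, h1, zero_smul] at h2
        exact h0 h2
      refine hχ.germ_mem_span _ _ (hkπ.fun_mul ((h.analyticAt_prod l).fun_inv h1)) ?_
      filter_upwards [(h.analyticAt_prod l).continuousAt.eventually_ne h1] with z hz
      rw [inv_mul_cancel_right₀ hz]
  · rw [Ideal.span_singleton_le_iff_mem]
    have hmem₁ : hχ.germ _ hp₁ ∈ maximalPullback π a := by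
      refine Ideal.subset_span ⟨⟨((Prod.fst : ℝ × ℝ → ℝ) : Germ (𝓝 (π a)) ℝ), Prod.fst,
        contDiff_fst.contMDiff.contMDiffAt, rfl⟩, Prod.fst, fun h0 => ?_, rfl, ?_⟩
      · exact congrArg Prod.fst h0
      · refine Germ.coe_eq.2 ?_
        filter_upwards [hχ.eventually_symm] with q hq
        rw [hq]
        rfl
    have hmem₂ : hχ.germ _ hp₂ ∈ maximalPullback π a := by
      refine Ideal.subset_span ⟨⟨((Prod.snd : ℝ × ℝ → ℝ) : Germ (𝓝 (π a)) ℝ), Prod.snd,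
        contDiff_snd.contMDiff.contMDiffAt, rfl⟩, Prod.snd, fun h0 => ?_, rfl, ?_⟩
      · exact congrArg Prod.snd h0
      · refine Germ.coe_eq.2 ?_
        filter_upwards [hχ.eventually_symm] with q hq
        rw [hq]
        rfl
    by_cases h1 : (A 0).1 = 0
    · have h2 : (A 0).2 ≠ 0 := fun h2 => hA0 (Prod.ext h1 h2)
      refine (Ideal.span_singleton_le_iff_mem _).2 hmem₂
        (hχ.germ_mem_span _ hp₂ (hA₂.fun_inv h2) ?_)
      filter_upwards [hpA, hA₂.continuousAt.eventually_ne h2] with z h3 h4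
      rw [h3, Prod.smul_snd, smul_eq_mul]
      field_simp
    · refine (Ideal.span_singleton_le_iff_mem _).2 hmem₁
        (hχ.germ_mem_span _ hp₁ (hA₁.fun_inv h1) ?_)
      filter_upwards [hpA, hA₁.continuousAt.eventually_ne h1] with z h3 h4
      rw [h3, Prod.smul_fst, smul_eq_mul]
      field_simp

theorem jacobianIdeal_eq_span (hχ : IsCenteredChart χ a)
    (h : PlaneModel (fun z => π (χ.symm z)) (fun k => χ.symm ⁻¹' C k) l j f) :
    jacobianIdeal π a = Ideal.span {hχ.germ _ (h.analyticAt_prod j)} := by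
  obtain ⟨w, hw, hw0, hpw⟩ := h.det_eq
  have hp := h.analyticAt_map
  refine le_antisymm ?_ ?_
  · refine Ideal.span_le.2 ?_
    rintro g ⟨η, hη, ha, hg⟩
    have hbt : η a ∈ η.target := η.map_source ha
    have hηs : ContMDiffAt 𝓘(ℝ, ℝ × ℝ) 𝓘(ℝ, ℝ × ℝ) ω η.symm (η a) :=
      contMDiffAt_symm_of_mem_maximalAtlas hη hbt
    have hθ : AnalyticAt ℝ (fun y => χ (η.symm y)) (η a) := by
      have h1 : ContMDiffAt 𝓘(ℝ, ℝ × ℝ) 𝓘(ℝ, ℝ × ℝ) ω (χ ∘ η.symm) (η a) :=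
        ContMDiffAt.comp (g := χ) (f := η.symm) (η a)
          (by rw [η.left_inv ha]; exact hχ.contMDiffAt) hηs
      exact h1.contDiffAt.analyticAt
    have hηχ : AnalyticAt ℝ (fun z => η (χ.symm z)) 0 :=
      hχ.analyticAt_comp_symm (contMDiffAt_of_mem_maximalAtlas hη ha)
    have hD : AnalyticAt ℝ (fun z => (fderiv ℝ (fun y => χ (η.symm y)) (η (χ.symm z))).det) 0 :=
      AnalyticAt.comp (g := fun y => (fderiv ℝ (fun y => χ (η.symm y)) y).det)
        (f := fun z => η (χ.symm z)) (by
          rw [hχ.symm_zero]; exact IsCoordChange.analyticAt_det hθ) hηχ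
    have hηt : Tendsto η.symm (𝓝 (η a)) (𝓝 a) := by
      have := hηs.continuousAt.tendsto
      rwa [η.left_inv ha] at this
    have hθt : Tendsto (fun y => χ (η.symm y)) (𝓝 (η a)) (𝓝 0) := hχ.tendsto.comp hηt
    -- The determinant in any other chart is a multiple of the one in `χ`. The reverse inclusion
    -- needs only `χ`, which is one of the charts allowed.
    have hdet : ∀ᶠ y in 𝓝 (η a), (fderiv ℝ (π ∘ η.symm) y).det =
        (fderiv ℝ (fun z => π (χ.symm z)) (χ (η.symm y))).det *
          (fderiv ℝ (fun y => χ (η.symm y)) y).det := by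
      have h1 : ∀ᶠ y in 𝓝 (η a), (π ∘ η.symm) =ᶠ[𝓝 y] fun y => π (χ.symm (χ (η.symm y))) := by
        refine eventually_eventually_nhds.2 ?_
        filter_upwards [hηt.eventually hχ.eventually_symm] with y hy
        rw [hy, Function.comp_apply]
      filter_upwards [h1, hθt.eventually hp.eventually_analyticAt, hθ.eventually_analyticAt]
        with y h2 h3 h4
      rw [h2.fderiv_eq (𝕜 := ℝ), ← ContinuousLinearMap.det_comp_plane]
      exact congrArg _ (fderiv_comp (g := fun z => π (χ.symm z)) (f := fun y => χ (η.symm y)) y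
        h3.differentiableAt h4.differentiableAt)
    have hηχt : Tendsto (fun z => η (χ.symm z)) (𝓝 0) (𝓝 (η a)) := by
      have := hηχ.continuousAt.tendsto
      rwa [hχ.symm_zero] at this
    rw [SetLike.mem_coe, hχ.eq_germ g (((h.analyticAt_prod j).fun_mul hw).fun_mul hD) hg (by
      filter_upwards [hηχt.eventually hdet, hpw, hχ.eventually_apply_symm,
        hχ.tendsto_symm.eventually (η.eventually_left_inverse ha)] with z h1 h2 h3 h4
      rw [h1, h4, h3, h2])]
    refine hχ.germ_mem_span _ _ (hw.fun_mul hD) (Eventually.of_forall fun z => ?_)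
    ring
  · rw [Ideal.span_singleton_le_iff_mem]
    have hdet := IsCoordChange.analyticAt_det hp
    have hmem : hχ.germ _ hdet ∈ jacobianIdeal π a :=
      Ideal.subset_span ⟨χ, hχ.mem_atlas, hχ.mem_source, rfl⟩
    refine (Ideal.span_singleton_le_iff_mem _).2 hmem
      (hχ.germ_mem_span _ hdet (hw.fun_inv hw0) ?_)
    filter_upwards [hpw, hw.continuousAt.eventually_ne hw0] with z h3 h4
    rw [h3]
    field_simp

end Ideals

namespace CascadeDiagram

variable {n : ℕ} {T : BlowUpTower.{u} n} {T' : BlowUpTower.{v} n}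
  {h : OpenPartialHomeomorph (ℝ × ℝ) (ℝ × ℝ)} (D : CascadeDiagram T T' h)

theorem pullback_ideals {C : Fin (n + 1) → Set T.total} {C' : Fin (n + 1) → Set T'.total}
    {l j : Fin (n + 1) → ℕ} {s : Set (Fin (n + 1))} (hC : CurveSystem T.toPlane C l j s)
    (hC' : CurveSystem T'.toPlane C' l j s) (hCC' : ∀ k, D.iso '' C k = C' k)
    {a : T.total} (ha : a ∈ D.iso.source) :
    pullbackIdeal D.iso a (maximalPullback T'.toPlane (D.iso a)) = maximalPullback T.toPlane a ∧
      pullbackIdeal D.iso a (jacobianIdeal T'.toPlane (D.iso a)) = jacobianIdeal T.toPlane a := by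
  obtain ⟨χ, hχ, f, hf⟩ := hC.model a
  obtain ⟨χ', hχ', f', hf'⟩ := hC'.model (D.iso a)
  have hΦ : ContMDiffAt 𝓘(ℝ, ℝ × ℝ) 𝓘(ℝ, ℝ × ℝ) ω D.iso a :=
    D.analytic.contMDiffAt (D.iso.open_source.mem_nhds ha)
  have hΨ : ContMDiffAt 𝓘(ℝ, ℝ × ℝ) 𝓘(ℝ, ℝ × ℝ) ω D.iso.symm (D.iso a) :=
    D.analytic_symm.contMDiffAt (D.iso.open_target.mem_nhds (D.iso.map_source ha))
  have hpull := hf'.pullback hχ hχ' hΦ hΨ (D.iso.eventually_left_inverse ha)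
  have hsub : ∀ k, C k ⊆ D.iso.source := fun k =>
    (hC.subset_zero k).trans (D.exc_subset_source _)
  -- Since `Φ` maps `C k` onto `C' k` and is analytic with analytic inverse, `f' k ∘ Φ` and `f k`
  -- are reduced equations of the same germ.
  have hunit : ∀ k, ∃ g : ℝ × ℝ → ℝ, AnalyticAt ℝ g 0 ∧ g 0 ≠ 0 ∧
      ∀ᶠ z in 𝓝 (0 : ℝ × ℝ), f' k (χ' (D.iso (χ.symm z))) = f k z * g z := by
    intro k
    refine exists_unit_mul_of_zeros_iff (hpull.analytic k) (hf.analytic k) (hpull.fderiv_ne k)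
      (hf.fderiv_ne k) ?_
    filter_upwards [hf.zeros k, hpull.zeros k,
      hχ.tendsto_symm.eventually (D.iso.open_source.mem_nhds ha)] with z h1 h2 h3
    rw [← h1, ← h2, mem_preimage, mem_preimage, mem_preimage, ← hCC' k]
    exact (D.iso.injOn.mem_image_iff (hsub k) h3).symm
  choose g hg hg0 hfg using hunit
  have key : ∀ m : Fin (n + 1) → ℕ,
      pullbackIdeal D.iso a (Ideal.span {hχ'.germ _ (hf'.analyticAt_prod m)}) =
        Ideal.span {hχ.germ _ (hf.analyticAt_prod m)} := by
    intro m
    rw [pullbackIdeal_span_germ hχ hχ' hΦ (hf'.analyticAt_prod m) (hpull.analyticAt_prod m)]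
    refine hχ.span_germ_eq (r := fun z => ∏ k, g k z ^ m k) _ _
      (Finset.analyticAt_fun_prod _ fun k _ => (hg k).fun_pow (m k))
      (Finset.prod_ne_zero_iff.2 fun k _ => pow_ne_zero _ (hg0 k)) ?_
    filter_upwards [eventually_all.2 hfg] with z hz
    simp only [hz, mul_pow, Finset.prod_mul_distrib]
    rw [mul_comm]
  constructor
  · rw [maximalPullback_eq_span hχ' hf', maximalPullback_eq_span hχ hf, key]
  · rw [jacobianIdeal_eq_span hχ' hf', jacobianIdeal_eq_span hχ hf, key]

end CascadeDiagram

/-! ### The Hsiang–Pati normal form in the plane -/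

theorem AnalyticAt.fderiv_apply_const {f : ℝ × ℝ → ℝ} {b : ℝ × ℝ} (h : AnalyticAt ℝ f b)
    (v : ℝ × ℝ) : AnalyticAt ℝ (fun z => fderiv ℝ f z v) b :=
  ((ContinuousLinearMap.apply ℝ ℝ v).analyticAt _).comp h.fderiv

/-- The complement of the axis is dense, so continuity suffices; this justifies cancelling powers of
the first coordinate. -/
theorem eventually_eq_of_eq_off_axis {f g : ℝ × ℝ → ℝ} (hf : AnalyticAt ℝ f 0)
    (hg : AnalyticAt ℝ g 0) (h : ∀ᶠ z in 𝓝 (0 : ℝ × ℝ), z.1 ≠ 0 → f z = g z) :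
    ∀ᶠ z in 𝓝 (0 : ℝ × ℝ), f z = g z := by
  filter_upwards [eventually_eventually_nhds.2 h, hf.eventually_analyticAt,
    hg.eventually_analyticAt] with z h1 h2 h3
  have ht : Tendsto (fun t : ℝ => z + (t, 0)) (𝓝[≠] 0) (𝓝 z) := by
    have : Tendsto (fun t : ℝ => z + (t, (0 : ℝ))) (𝓝 0) (𝓝 (z + ((0 : ℝ), (0 : ℝ)))) :=
      (continuous_const.add (continuous_id.prodMk continuous_const)).tendsto 0
    rw [show ((0 : ℝ), (0 : ℝ)) = 0 from rfl, add_zero] at this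
    exact this.mono_left nhdsWithin_le_nhds
  have hne : ∀ᶠ t in 𝓝[≠] (0 : ℝ), (z + (t, (0 : ℝ))).1 ≠ 0 := by
    by_cases hz : z.1 = 0
    · filter_upwards [self_mem_nhdsWithin] with t ht0
      simpa [hz] using ht0
    · exact ht.eventually (continuous_fst.continuousAt.eventually_ne hz)
  refine tendsto_nhds_unique_of_eventuallyEq (h2.continuousAt.tendsto.comp ht)
    (h3.continuousAt.tendsto.comp ht) ?_
  filter_upwards [ht.eventually h1, hne] with t h4 h5
  exact h4 h5

/-- Cancellation of powers of the first coordinate. -/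
theorem le_and_eventually_eq_of_pow_mul_eq {g w : ℝ × ℝ → ℝ} (hg : AnalyticAt ℝ g 0)
    (hw : AnalyticAt ℝ w 0) (hw0 : w 0 ≠ 0) {a b : ℕ}
    (h : ∀ᶠ z in 𝓝 (0 : ℝ × ℝ), z.1 ^ a * g z = z.1 ^ b * w z) :
    a ≤ b ∧ ∀ᶠ z in 𝓝 (0 : ℝ × ℝ), g z = z.1 ^ (b - a) * w z := by
  have hab : a ≤ b := by
    by_contra! hba
    -- If `b < a`, then `w = x ^ (a - b) g` would vanish at the origin.
    have h1 := eventually_eq_of_eq_off_axis ((analyticAt_fst.fun_pow (a - b)).fun_mul hg) hw (by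
      filter_upwards [h] with z hz hz1
      rw [← mul_right_inj' (pow_ne_zero b hz1), ← hz, ← mul_assoc, ← pow_add,
        Nat.add_sub_cancel' hba.le])
    have h2 := h1.self_of_nhds
    rw [Prod.fst_zero, zero_pow (Nat.sub_ne_zero_of_lt hba), zero_mul] at h2
    exact hw0 h2.symm
  refine ⟨hab, eventually_eq_of_eq_off_axis hg ((analyticAt_fst.fun_pow (b - a)).fun_mul hw) ?_⟩
  filter_upwards [h] with z hz hz1
  rw [← mul_right_inj' (pow_ne_zero a hz1), hz, ← mul_assoc, ← pow_add, Nat.add_sub_cancel' hab]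

theorem hasDerivAt_snd_slice {D : ℝ × ℝ → ℝ} {x t : ℝ} (hD : DifferentiableAt ℝ D (x, t)) :
    HasDerivAt (fun y => D (x, y)) (fderiv ℝ D (x, t) (0, 1)) t :=
  hD.hasFDerivAt.comp_hasDerivAt t ((hasDerivAt_const t x).prodMk (hasDerivAt_id t))

theorem eventually_eq_zero_on_axis {D : ℝ × ℝ → ℝ} (hD : AnalyticAt ℝ D 0) (h0 : D 0 = 0)
    (h : ∀ᶠ z in 𝓝 (0 : ℝ × ℝ), z.1 = 0 → fderiv ℝ D z (0, 1) = 0) :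
    ∀ᶠ z in 𝓝 (0 : ℝ × ℝ), z.1 = 0 → D z = 0 := by
  obtain ⟨ε, hε, hb⟩ := Metric.eventually_nhds_iff_ball.1 (h.and hD.eventually_analyticAt)
  refine Metric.eventually_nhds_iff_ball.2 ⟨ε, hε, ?_⟩
  rintro ⟨x, y⟩ hz hx
  simp only at hx
  subst hx
  have hmem : ∀ t ∈ Metric.ball (0 : ℝ) ε, ((0 : ℝ), t) ∈ Metric.ball (0 : ℝ × ℝ) ε := by
    intro t ht
    rw [mem_ball_zero_iff] at ht ⊢
    rw [Prod.norm_def]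
    simpa using ht
  have hder : ∀ t ∈ Metric.ball (0 : ℝ) ε, HasDerivAt (fun y => D (0, y)) 0 t := by
    intro t ht
    have h1 := hb _ (hmem t ht)
    have h2 := hasDerivAt_snd_slice h1.2.differentiableAt
    rwa [h1.1 rfl] at h2
  have hy : y ∈ Metric.ball (0 : ℝ) ε := by
    rw [mem_ball_zero_iff] at hz ⊢
    exact lt_of_le_of_lt (norm_snd_le ((0 : ℝ), y)) hz
  have h3 := Metric.isOpen_ball.is_const_of_deriv_eq_zero
    (convex_ball (0 : ℝ) ε).isPreconnected
    (fun t ht => (hder t ht).differentiableAt.differentiableWithinAt)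
    (fun t ht => (hder t ht).deriv) hy (Metric.mem_ball_self hε)
  exact h3.trans h0

theorem eventually_fderiv_snd_pow_mul {D W : ℝ × ℝ → ℝ} (hW : AnalyticAt ℝ W 0) (k : ℕ)
    (h : ∀ᶠ z in 𝓝 (0 : ℝ × ℝ), D z = z.1 ^ k * W z) :
    ∀ᶠ z in 𝓝 (0 : ℝ × ℝ), fderiv ℝ D z (0, 1) = z.1 ^ k * fderiv ℝ W z (0, 1) := by
  filter_upwards [eventually_eventually_nhds.2 h, hW.eventually_analyticAt] with z h1 h2
  have h3 : D =ᶠ[𝓝 z] fun z => z.1 ^ k * W z := h1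
  have h4 : DifferentiableAt ℝ (fun z : ℝ × ℝ => z.1 ^ k * W z) z :=
    (differentiableAt_fst.fun_pow k).fun_mul h2.differentiableAt
  rw [h3.fderiv_eq]
  have h5 := hasDerivAt_snd_slice (x := z.1) (t := z.2) h4
  have h6 := (hasDerivAt_snd_slice (x := z.1) (t := z.2) h2.differentiableAt).const_mul (z.1 ^ k)
  exact h5.unique h6

/-- Division of a primitive: if `∂D/∂y` is divisible by `x ^ k` and `D (x, 0) = 0`, then `D` is
divisible by `x ^ k`. -/
theorem exists_eq_pow_mul_of_fderiv (k : ℕ) {D w : ℝ × ℝ → ℝ} (hD : AnalyticAt ℝ D 0)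
    (hw : AnalyticAt ℝ w 0) (h0 : ∀ᶠ z in 𝓝 (0 : ℝ × ℝ), D (z.1, 0) = 0)
    (h : ∀ᶠ z in 𝓝 (0 : ℝ × ℝ), fderiv ℝ D z (0, 1) = z.1 ^ k * w z) :
    ∃ W : ℝ × ℝ → ℝ, AnalyticAt ℝ W 0 ∧ W 0 = 0 ∧ (∀ᶠ z in 𝓝 (0 : ℝ × ℝ), D z = z.1 ^ k * W z) ∧
      fderiv ℝ W 0 (0, 1) = w 0 := by
  induction k generalizing D with
  | zero =>
    exact ⟨D, hD, h0.self_of_nhds, by simp, by simpa using h.self_of_nhds⟩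
  | succ k ih =>
    -- On the axis `x = 0` the derivative of `D` in `y` vanishes and `D 0 = 0`, so `D` vanishes
    -- there and one factor `x` can be divided out.
    obtain ⟨D₁, hD₁, hDD⟩ := exists_eq_fst_mul hD (eventually_eq_zero_on_axis hD h0.self_of_nhds (by
      filter_upwards [h] with z hz hz1
      rw [hz, hz1, zero_pow (Nat.succ_ne_zero k), zero_mul]))
    have hp : AnalyticAt ℝ (fun z : ℝ × ℝ => (z.1, (0 : ℝ))) 0 := analyticAt_fst.prod analyticAt_const
    have hpt : Tendsto (fun z : ℝ × ℝ => (z.1, (0 : ℝ))) (𝓝 0) (𝓝 0) := hp.continuousAt.tendsto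
    have h1 : ∀ᶠ z in 𝓝 (0 : ℝ × ℝ), D₁ (z.1, 0) = 0 :=
      eventually_eq_of_eq_off_axis (f := fun z => D₁ (z.1, 0))
        (AnalyticAt.comp (g := D₁) (f := fun z : ℝ × ℝ => (z.1, (0 : ℝ))) hD₁ hp) analyticAt_const (by
        filter_upwards [h0, hpt.eventually hDD] with z h1 h2 h3
        rw [h1] at h2
        exact (mul_eq_zero.1 h2.symm).resolve_left h3)
    have h2 : ∀ᶠ z in 𝓝 (0 : ℝ × ℝ), fderiv ℝ D₁ z (0, 1) = z.1 ^ k * w z :=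
      eventually_eq_of_eq_off_axis (hD₁.fderiv_apply_const _)
        ((analyticAt_fst.fun_pow k).fun_mul hw) (by
        filter_upwards [h, eventually_fderiv_snd_pow_mul hD₁ 1 (by simpa using hDD)] with z h3 h4 h5
        rw [h3, pow_one, pow_succ'] at h4
        rw [← mul_right_inj' h5, ← h4, mul_assoc])
    obtain ⟨W, hW, hW0, hDW, hWw⟩ := ih hD₁ h1 h2
    refine ⟨W, hW, hW0, ?_, hWw⟩
    filter_upwards [hDD, hDW] with z h3 h4
    rw [h3, h4]
    ring

/-- The linear mapping of the plane with matrix `!![c, -s; s, c]`. -/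
def rotMap (c s : ℝ) : (ℝ × ℝ) →L[ℝ] (ℝ × ℝ) :=
  (c • ContinuousLinearMap.fst ℝ ℝ ℝ - s • ContinuousLinearMap.snd ℝ ℝ ℝ).prod
    (s • ContinuousLinearMap.fst ℝ ℝ ℝ + c • ContinuousLinearMap.snd ℝ ℝ ℝ)

theorem rotMap_apply (c s : ℝ) (z : ℝ × ℝ) :
    rotMap c s z = (c * z.1 - s * z.2, s * z.1 + c * z.2) := rfl

theorem det_rotMap {c s : ℝ} (h : c ^ 2 + s ^ 2 = 1) : (rotMap c s).det = 1 := by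
  rw [ContinuousLinearMap.det_plane]
  simp only [rotMap_apply]
  linarith

theorem eventually_det_fderiv_rotMap {c s : ℝ} (h : c ^ 2 + s ^ 2 = 1) {p : ℝ × ℝ → ℝ × ℝ}
    (hp : AnalyticAt ℝ p 0) : ∀ᶠ z in 𝓝 (0 : ℝ × ℝ),
      (fderiv ℝ (fun z => rotMap c s (p z)) z).det = (fderiv ℝ p z).det := by
  filter_upwards [hp.eventually_analyticAt] with z hz
  have h1 : HasFDerivAt (fun z => rotMap c s (p z)) ((rotMap c s).comp (fderiv ℝ p z)) z :=
    (rotMap c s).hasFDerivAt.comp z hz.differentiableAt.hasFDerivAt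
  rw [h1.fderiv, ContinuousLinearMap.det_comp_plane, det_rotMap h, one_mul]

/-- The first component does not depend on `y`, so the jacobian matrix is triangular. -/
theorem eventually_det_fderiv_of_fst_eq {q : ℝ × ℝ → ℝ × ℝ} (hq : AnalyticAt ℝ q 0) {α : ℝ}
    {l : ℕ} (h : ∀ᶠ z in 𝓝 (0 : ℝ × ℝ), (q z).1 = α * z.1 ^ l) :
    ∀ᶠ z in 𝓝 (0 : ℝ × ℝ), (fderiv ℝ q z).det =
      α * l * z.1 ^ (l - 1) * fderiv ℝ (fun z => (q z).2) z (0, 1) := by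
  filter_upwards [eventually_eventually_nhds.2 h, hq.eventually_analyticAt] with z h1 h2
  have hd := h2.differentiableAt
  have h3 : (fun z => (q z).1) =ᶠ[𝓝 z] fun z => α * z.1 ^ l := h1
  have h4 : HasFDerivAt (fun z : ℝ × ℝ => α * z.1 ^ l)
      (α • ((l * z.1 ^ (l - 1)) • ContinuousLinearMap.fst ℝ ℝ ℝ)) z := by
    have h5 : HasFDerivAt (fun z : ℝ × ℝ => z.1 ^ l)
        ((l * z.1 ^ (l - 1)) • ContinuousLinearMap.fst ℝ ℝ ℝ) z :=
      (hasDerivAt_pow l z.1).comp_hasFDerivAt z hasFDerivAt_fst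
    exact h5.const_mul α
  have h6 : fderiv ℝ q z = (fderiv ℝ (fun z => (q z).1) z).prod (fderiv ℝ (fun z => (q z).2) z) :=
    hd.fst.fderiv_prodMk hd.snd
  rw [h6, h3.fderiv_eq, h4.fderiv, ContinuousLinearMap.det_plane]
  simp
  left
  ring

/-- The normal form of Hsiang and Pati, in the plane. -/
theorem exists_hsiangPati_coordinates {p A : ℝ × ℝ → ℝ × ℝ} {w : ℝ × ℝ → ℝ} {l j : ℕ} (hl : 0 < l)
    (hA : AnalyticAt ℝ A 0) (hA0 : A 0 ≠ 0) (hpA : ∀ᶠ z in 𝓝 (0 : ℝ × ℝ), p z = z.1 ^ l • A z)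
    (hw : AnalyticAt ℝ w 0) (hw0 : w 0 ≠ 0)
    (hpw : ∀ᶠ z in 𝓝 (0 : ℝ × ℝ), (fderiv ℝ p z).det = z.1 ^ j * w z) :
    ∃ (m : ℕ) (c s α : ℝ) (φ : ℝ → ℝ) (θ : ℝ × ℝ → ℝ × ℝ), l ≤ m ∧ l + m = j + 1 ∧
      c ^ 2 + s ^ 2 = 1 ∧ (α = 1 ∨ α = -1) ∧ AnalyticAt ℝ φ 0 ∧ IsCoordChange θ ∧
      (∀ᶠ z in 𝓝 (0 : ℝ × ℝ), z.1 = 0 ↔ (θ z).1 = 0) ∧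
      ∀ᶠ z in 𝓝 (0 : ℝ × ℝ), rotMap c s (p z) =
        (α * (θ z).1 ^ l, (θ z).1 ^ l * φ (θ z).1 + (θ z).1 ^ m * (θ z).2) := by
  have hlR : (l : ℝ) ≠ 0 := Nat.cast_ne_zero.2 hl.ne'
  have hp : AnalyticAt ℝ p 0 :=
    ((analyticAt_fst.fun_pow l).fun_smul hA).congr (hpA.mono fun z hz => hz.symm)
  -- The identity or a quarter turn is enough.
  obtain ⟨c, s, hcs, hB0⟩ : ∃ c s : ℝ, c ^ 2 + s ^ 2 = 1 ∧ (rotMap c s (A 0)).1 ≠ 0 := by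
    by_cases h1 : (A 0).1 = 0
    · refine ⟨0, 1, by norm_num, ?_⟩
      have h2 : (A 0).2 ≠ 0 := fun h2 => hA0 (Prod.ext h1 h2)
      simpa [rotMap_apply] using h2
    · exact ⟨1, 0, by norm_num, by simpa [rotMap_apply] using h1⟩
  have hB : AnalyticAt ℝ (fun z => rotMap c s (A z)) 0 := ((rotMap c s).analyticAt _).comp hA
  have hB₁ : AnalyticAt ℝ (fun z => (rotMap c s (A z)).1) 0 :=
    ((ContinuousLinearMap.fst ℝ ℝ ℝ).analyticAt _).comp hB
  have hB₂ : AnalyticAt ℝ (fun z => (rotMap c s (A z)).2) 0 :=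
    ((ContinuousLinearMap.snd ℝ ℝ ℝ).analyticAt _).comp hB
  obtain ⟨α, hα, hαB⟩ : ∃ α : ℝ, (α = 1 ∨ α = -1) ∧ 0 < α * (rotMap c s (A 0)).1 := by
    rcases lt_or_gt_of_ne hB0 with h1 | h1
    · exact ⟨-1, Or.inr rfl, by linarith⟩
    · exact ⟨1, Or.inl rfl, by linarith⟩
  have hαα : α * α = 1 := by rcases hα with rfl | rfl <;> norm_num
  have hα0 : α ≠ 0 := fun h => by simp [h] at hαα
  have hαB' : AnalyticAt ℝ (fun z => α * (rotMap c s (A z)).1) 0 := analyticAt_const.fun_mul hB₁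
  -- The analytic positive `l`-th root, available thanks to the sign `α`. With `u = x r`, the first
  -- component becomes `α u ^ l`.
  set r : ℝ × ℝ → ℝ := fun z => Real.exp (Real.log (α * (rotMap c s (A z)).1) / l) with hr_def
  have hr : AnalyticAt ℝ r 0 :=
    ((AnalyticAt.comp (g := Real.log) (f := fun z => α * (rotMap c s (A z)).1)
      (analyticAt_log hαB) hαB').fun_div analyticAt_const hlR).rexp'
  have hrpos : ∀ z, 0 < r z := fun z => Real.exp_pos _
  have hrl : ∀ᶠ z in 𝓝 (0 : ℝ × ℝ), r z ^ l = α * (rotMap c s (A z)).1 := by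
    filter_upwards [hαB'.continuousAt.eventually (lt_mem_nhds hαB)] with z hz
    rw [hr_def, ← Real.exp_nat_mul, mul_div_cancel₀ _ hlR, Real.exp_log hz]
  have hG₁ : IsCoordChange (fun z => (z.1 * r z, z.2)) := by
    refine .of_prodMk (analyticAt_fst.fun_mul hr) analyticAt_snd (by simp) rfl ?_
    rw [fderiv_fun_mul differentiableAt_fst hr.differentiableAt, fderiv_fst, fderiv_snd]
    simp [(hrpos 0).ne']
  obtain ⟨θ₁, hθ₁, hl₁, hr₁⟩ := hG₁.exists_inverse
  have hfst : ∀ᶠ z in 𝓝 (0 : ℝ × ℝ), (θ₁ z).1 = z.1 / r (θ₁ z) := by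
    filter_upwards [hr₁] with z hz
    have := congrArg Prod.fst hz
    simp only at this
    rw [eq_div_iff (hrpos _).ne', this]
  set b : ℝ × ℝ → ℝ := fun z => (rotMap c s (A (θ₁ z))).2 / r (θ₁ z) ^ l with hb_def
  have hb : AnalyticAt ℝ b 0 :=
    (hθ₁.comp_analyticAt hB₂).fun_div ((hθ₁.comp_analyticAt hr).fun_pow l)
      (pow_ne_zero _ (hrpos _).ne')
  have hRp : AnalyticAt ℝ (fun z => rotMap c s (p z)) 0 := ((rotMap c s).analyticAt _).comp hp
  have hq : AnalyticAt ℝ (fun z => rotMap c s (p (θ₁ z))) 0 :=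
    hθ₁.comp_analyticAt (f := fun z => rotMap c s (p z)) hRp
  have hq_eq : ∀ᶠ z in 𝓝 (0 : ℝ × ℝ),
      rotMap c s (p (θ₁ z)) = (α * z.1 ^ l, z.1 ^ l * b z) := by
    filter_upwards [hθ₁.eventually hpA, hθ₁.eventually hrl, hfst] with z h1 h2 h3
    have h4 : r (θ₁ z) ^ l ≠ 0 := pow_ne_zero _ (hrpos _).ne'
    have h5 : z.1 ^ l = (θ₁ z).1 ^ l * r (θ₁ z) ^ l := by
      rw [h3, div_pow, div_mul_cancel₀ _ h4]
    rw [h1, map_smul]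
    refine Prod.ext ?_ ?_
    · rw [Prod.smul_fst, smul_eq_mul]
      simp only
      rw [h5, h2]
      linear_combination (-((θ₁ z).1 ^ l * (rotMap c s (A (θ₁ z))).1)) * hαα
    · rw [Prod.smul_snd, smul_eq_mul]
      simp only [hb_def]
      rw [h5]
      field_simp
  set w₂ : ℝ × ℝ → ℝ := fun z => w (θ₁ z) / r (θ₁ z) ^ j * (fderiv ℝ θ₁ z).det with hw₂_def
  have hw₂ : AnalyticAt ℝ w₂ 0 :=
    ((hθ₁.comp_analyticAt hw).fun_div ((hθ₁.comp_analyticAt hr).fun_pow j)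
      (pow_ne_zero _ (hrpos _).ne')).fun_mul (IsCoordChange.analyticAt_det hθ₁.analytic)
  have hw₂0 : w₂ 0 ≠ 0 := by
    refine mul_ne_zero (div_ne_zero ?_ (pow_ne_zero _ (hrpos _).ne')) hθ₁.det_ne
    rwa [hθ₁.map_zero]
  have hdet₁ : ∀ᶠ z in 𝓝 (0 : ℝ × ℝ),
      (fderiv ℝ (fun z => rotMap c s (p (θ₁ z))) z).det = z.1 ^ j * w₂ z := by
    filter_upwards [eventually_det_fderiv_comp hRp hθ₁.analytic hθ₁.map_zero,
      hθ₁.eventually (eventually_det_fderiv_rotMap hcs hp), hθ₁.eventually hpw, hfst]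
      with z h1 h2 h3 h4
    rw [h1, h2, h3, h4, hw₂_def, div_pow]
    ring
  have hsnd : ∀ᶠ z in 𝓝 (0 : ℝ × ℝ), (rotMap c s (p (θ₁ z))).2 = z.1 ^ l * b z :=
    hq_eq.mono fun z hz => by rw [hz]
  -- The exponent `2 l - 1` is `l - 1` from differentiating `u ^ l` plus `l` from the factor `u ^ l`
  -- of the second component.
  have hkey : ∀ᶠ z in 𝓝 (0 : ℝ × ℝ),
      z.1 ^ (2 * l - 1) * (α * l * fderiv ℝ b z (0, 1)) = z.1 ^ j * w₂ z := by
    filter_upwards [hdet₁, eventually_det_fderiv_of_fst_eq hq (hq_eq.mono fun z hz => by rw [hz]),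
      eventually_fderiv_snd_pow_mul hb l hsnd] with z h1 h2 h3
    rw [← h1, h2, h3, show 2 * l - 1 = (l - 1) + l by omega, pow_add]
    ring
  obtain ⟨hlj, hbw⟩ := le_and_eventually_eq_of_pow_mul_eq
    (analyticAt_const.fun_mul (hb.fderiv_apply_const _)) hw₂ hw₂0 hkey
  set k := j - (2 * l - 1) with hk
  have hαl : α * l ≠ 0 := mul_ne_zero hα0 hlR
  have hproj : AnalyticAt ℝ (fun z : ℝ × ℝ => (z.1, (0 : ℝ))) 0 :=
    analyticAt_fst.prod analyticAt_const
  have hb₀ : AnalyticAt ℝ (fun z : ℝ × ℝ => b (z.1, 0)) 0 :=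
    AnalyticAt.comp (g := b) (f := fun z : ℝ × ℝ => (z.1, (0 : ℝ))) hb hproj
  have hφ : AnalyticAt ℝ (fun x : ℝ => b (x, 0)) 0 :=
    AnalyticAt.comp (g := b) (f := fun x : ℝ => (x, (0 : ℝ))) hb
      (analyticAt_id.prod analyticAt_const)
  obtain ⟨W, hW, hW0, hDW, hWw⟩ := exists_eq_pow_mul_of_fderiv k
    (D := fun z => b z - b (z.1, 0)) (w := fun z => w₂ z / (α * l))
    (hb.fun_sub hb₀) (hw₂.fun_div analyticAt_const hαl)
    (Eventually.of_forall fun z => sub_self _) (by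
      filter_upwards [hbw, hb.eventually_analyticAt, hb₀.eventually_analyticAt] with z h1 h2 h3
      have h4 := hasDerivAt_snd_slice (x := z.1) (t := z.2) h2.differentiableAt
      have h5 : HasDerivAt (fun y : ℝ => b (z.1, y) - b (z.1, 0)) (fderiv ℝ b z (0, 1)) z.2 :=
        h4.sub_const _
      have h6 := hasDerivAt_snd_slice (x := z.1) (t := z.2) (D := fun z => b z - b (z.1, 0))
        (h2.differentiableAt.fun_sub h3.differentiableAt)
      rw [show fderiv ℝ (fun z => b z - b (z.1, 0)) z (0, 1) = fderiv ℝ b z (0, 1) from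
        h6.unique h5]
      field_simp
      linear_combination h1)
  -- `W` is the new coordinate `v`: its derivative in `y` at the origin is `w₂ 0 / (α l)`, which is
  -- nonzero.
  have hG₂ : IsCoordChange (fun z => (z.1, W z)) := by
    refine .of_prodMk analyticAt_fst hW rfl hW0 ?_
    rw [fderiv_fst, hWw]
    simpa using ⟨hw₂0, hα0, hl.ne'⟩
  -- Here `m = l + k` with `k = j - (2 l - 1)`, whence `l + m = j + 1`; the subtraction is exact by
  -- `hlj`.
  refine ⟨l + k, c, s, α, fun x => b (x, 0), _, by omega, by omega, hcs, hα, hφ, hG₂.comp hG₁,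
    ?_, ?_⟩
  · refine Eventually.of_forall fun z => ?_
    simp [(hrpos z).ne']
  · filter_upwards [hG₁.eventually hq_eq, hl₁, hG₁.eventually hDW] with z h1 h2 h3
    rw [h2] at h1
    rw [h1]
    refine Prod.ext rfl ?_
    simp only at h3 ⊢
    rw [pow_add]
    linear_combination (z.1 * r z) ^ l * h3

/-- The exponents of the normal form are determined by those of the mapping and of its jacobian
determinant. -/
theorem eq_of_hsiangPati_coordinates {p A : ℝ × ℝ → ℝ × ℝ} {w : ℝ × ℝ → ℝ} {l j l₁ m₁ : ℕ}
    (hA : AnalyticAt ℝ A 0) (hA0 : A 0 ≠ 0) (hpA : ∀ᶠ z in 𝓝 (0 : ℝ × ℝ), p z = z.1 ^ l • A z)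
    (hw : AnalyticAt ℝ w 0) (hw0 : w 0 ≠ 0)
    (hpw : ∀ᶠ z in 𝓝 (0 : ℝ × ℝ), (fderiv ℝ p z).det = z.1 ^ j * w z)
    (hl₁ : 0 < l₁) (hlm : l₁ ≤ m₁) {c s α β : ℝ} (hcs : c ^ 2 + s ^ 2 = 1) (hα : α ≠ 0)
    (hβ : β ≠ 0) {φ : ℝ → ℝ} (hφ : AnalyticAt ℝ φ 0)
    (h : ∀ᶠ z in 𝓝 (0 : ℝ × ℝ), rotMap c s (p z) =
      (α * z.1 ^ l₁, z.1 ^ l₁ * φ z.1 + β * z.1 ^ m₁ * z.2)) :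
    l₁ = l ∧ l₁ + m₁ = j + 1 := by
  have hlR : (l₁ : ℝ) ≠ 0 := Nat.cast_ne_zero.2 hl₁.ne'
  have hp : AnalyticAt ℝ p 0 :=
    ((analyticAt_fst.fun_pow l).fun_smul hA).congr (hpA.mono fun z hz => hz.symm)
  have hA₁ : AnalyticAt ℝ (fun z => (A z).1) 0 :=
    ((ContinuousLinearMap.fst ℝ ℝ ℝ).analyticAt _).comp hA
  have hA₂ : AnalyticAt ℝ (fun z => (A z).2) 0 :=
    ((ContinuousLinearMap.snd ℝ ℝ ℝ).analyticAt _).comp hA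
  have hφ' : AnalyticAt ℝ (fun z : ℝ × ℝ => φ z.1) 0 :=
    AnalyticAt.comp (g := φ) (f := fun z : ℝ × ℝ => z.1) hφ analyticAt_fst
  set Y : ℝ × ℝ → ℝ := fun z => φ z.1 + β * z.1 ^ (m₁ - l₁) * z.2 with hY_def
  have hY : AnalyticAt ℝ Y 0 :=
    hφ'.fun_add ((analyticAt_const.fun_mul (analyticAt_fst.fun_pow _)).fun_mul analyticAt_snd)
  have hYeq : ∀ z : ℝ × ℝ, z.1 ^ l₁ * φ z.1 + β * z.1 ^ m₁ * z.2 = z.1 ^ l₁ * Y z := by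
    intro z
    have h1 : z.1 ^ m₁ = z.1 ^ l₁ * z.1 ^ (m₁ - l₁) := by
      rw [← pow_add, Nat.add_sub_cancel' hlm]
    rw [h1, hY_def]
    ring
  have e₁ : ∀ᶠ z in 𝓝 (0 : ℝ × ℝ), z.1 ^ l * (c * (A z).1 - s * (A z).2) = z.1 ^ l₁ * α := by
    filter_upwards [hpA, h] with z h1 h2
    have h3 := congrArg Prod.fst h2
    rw [h1, rotMap_apply] at h3
    simp only [Prod.smul_fst, Prod.smul_snd, smul_eq_mul] at h3
    linear_combination h3
  have e₂ : ∀ᶠ z in 𝓝 (0 : ℝ × ℝ), z.1 ^ l * (s * (A z).1 + c * (A z).2) = z.1 ^ l₁ * Y z := by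
    filter_upwards [hpA, h] with z h1 h2
    have h3 := congrArg Prod.snd h2
    rw [h1, rotMap_apply] at h3
    simp only [Prod.smul_fst, Prod.smul_snd, smul_eq_mul] at h3
    linear_combination h3 + hYeq z
  have hle : l ≤ l₁ := (le_and_eventually_eq_of_pow_mul_eq
    ((analyticAt_const.fun_mul hA₁).fun_sub (analyticAt_const.fun_mul hA₂))
    (w := fun _ => α) analyticAt_const hα e₁).1
  -- Undo the rotation: each component of `x ^ l A` is `x ^ l₁` times an analytic germ, and one
  -- component of `A` is a unit.
  have hge : l₁ ≤ l := by
    by_cases h1 : (A 0).1 = 0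
    · have h2 : (A 0).2 ≠ 0 := fun h2 => hA0 (Prod.ext h1 h2)
      refine (le_and_eventually_eq_of_pow_mul_eq
        (((analyticAt_const (v := c)).fun_mul hY).fun_sub (analyticAt_const (v := s * α))) hA₂ h2
        ?_).1
      filter_upwards [e₁, e₂] with z h3 h4
      linear_combination s * h3 - c * h4 + z.1 ^ l * (A z).2 * hcs
    · refine (le_and_eventually_eq_of_pow_mul_eq
        (((analyticAt_const (v := s)).fun_mul hY).fun_add (analyticAt_const (v := c * α))) hA₁ h1
        ?_).1
      filter_upwards [e₁, e₂] with z h3 h4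
      linear_combination -c * h3 - s * h4 + z.1 ^ l * (A z).1 * hcs
  refine ⟨le_antisymm hge hle, ?_⟩
  have hRp : AnalyticAt ℝ (fun z => rotMap c s (p z)) 0 := ((rotMap c s).analyticAt _).comp hp
  have hder : ∀ᶠ z in 𝓝 (0 : ℝ × ℝ),
      fderiv ℝ (fun z => (rotMap c s (p z)).2) z (0, 1) = β * z.1 ^ m₁ := by
    filter_upwards [eventually_eventually_nhds.2 h, hRp.eventually_analyticAt] with z h1 h2
    have h3 : (fun z => (rotMap c s (p z)).2) =ᶠ[𝓝 z]
        fun z => z.1 ^ l₁ * φ z.1 + β * z.1 ^ m₁ * z.2 := h1.mono fun y hy => congrArg Prod.snd hy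
    have h4 := h3.symm.differentiableAt_iff.2 h2.differentiableAt.snd
    rw [h3.fderiv_eq]
    have h5 := hasDerivAt_snd_slice (x := z.1) (t := z.2) h4
    have h6 : HasDerivAt (fun y : ℝ => z.1 ^ l₁ * φ z.1 + β * z.1 ^ m₁ * y)
        (β * z.1 ^ m₁ * 1) z.2 := ((hasDerivAt_id z.2).const_mul _).const_add _
    rw [mul_one] at h6
    exact h5.unique h6
  have e₃ : ∀ᶠ z in 𝓝 (0 : ℝ × ℝ), z.1 ^ j * w z = z.1 ^ (l₁ - 1 + m₁) * (α * l₁ * β) := by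
    filter_upwards [hpw, eventually_det_fderiv_rotMap hcs hp,
      eventually_det_fderiv_of_fst_eq hRp (h.mono fun z hz => by rw [hz]), hder] with z h1 h2 h3 h4
    rw [← h1, ← h2, h3, h4, pow_add]
    ring
  -- Both cofactors in `e₃` are units, so comparing in both directions gives `j = l₁ - 1 + m₁`.
  have h1 := (le_and_eventually_eq_of_pow_mul_eq hw (w := fun _ => α * l₁ * β) analyticAt_const
    (mul_ne_zero (mul_ne_zero hα hlR) hβ) e₃).1
  have h2 := (le_and_eventually_eq_of_pow_mul_eq (g := fun _ => α * l₁ * β) analyticAt_const hw hw0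
    (e₃.mono fun z hz => hz.symm)).1
  omega

/-! ### Hsiang–Pati data along the exceptional curves -/

namespace PlaneModel

variable {ι : Type*} [Fintype ι] {p : ℝ × ℝ → ℝ × ℝ} {S : ι → Set (ℝ × ℝ)}
    {l j : ι → ℕ} {f : ι → ℝ × ℝ → ℝ}

/-- If the union of the curves is the first axis, only one of them goes through the origin. -/
theorem exists_fst_eq_mul (h : PlaneModel p S l j f)
    (hz : ∀ᶠ z in 𝓝 (0 : ℝ × ℝ), z.1 = 0 ↔ ∃ k, f k z = 0) {k : ι} (hk : f k 0 = 0) :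
    (∀ k' ≠ k, f k' 0 ≠ 0) ∧ ∃ g : ℝ × ℝ → ℝ, AnalyticAt ℝ g 0 ∧ g 0 ≠ 0 ∧
      ∀ᶠ z in 𝓝 (0 : ℝ × ℝ), z.1 = f k z * g z := by
  -- An equation vanishing at the origin divides `x`. Differentiating `x = f k * g` shows that `g`
  -- is a unit and that the curve is tangent to the axis; two such curves would not be transverse.
  have key : ∀ k, f k 0 = 0 → fderiv ℝ (f k) 0 (0, 1) = 0 ∧ ∃ g : ℝ × ℝ → ℝ, AnalyticAt ℝ g 0 ∧
      g 0 ≠ 0 ∧ ∀ᶠ z in 𝓝 (0 : ℝ × ℝ), z.1 = f k z * g z := by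
    intro k hk
    obtain ⟨g, hg, hfg⟩ := exists_eq_mul_of_zeros (f := Prod.fst) analyticAt_fst (h.analytic k) hk
      (h.fderiv_ne k hk) (hz.mono fun z h1 h2 => h1.2 ⟨k, h2⟩)
    have h1 : (Prod.fst : ℝ × ℝ → ℝ) =ᶠ[𝓝 0] fun z => f k z * g z := hfg
    have h2 := h1.fderiv_eq (𝕜 := ℝ)
    rw [fderiv_fst, fderiv_fun_mul (h.analytic k).differentiableAt hg.differentiableAt, hk,
      zero_smul, zero_add] at h2
    have h3 := congrArg (fun φ : (ℝ × ℝ) →L[ℝ] ℝ => φ (1, 0)) h2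
    have h4 := congrArg (fun φ : (ℝ × ℝ) →L[ℝ] ℝ => φ (0, 1)) h2
    simp only [ContinuousLinearMap.coe_fst', smul_apply, smul_eq_mul] at h3 h4
    have hg0 : g 0 ≠ 0 := fun h5 => by simp [h5] at h3
    exact ⟨(mul_eq_zero.1 h4.symm).resolve_left hg0, g, hg, hg0, hfg⟩
  refine ⟨fun k' hk' h0 => ?_, (key k hk).2⟩
  have := h.transverse k' k hk' h0 hk _ (key k' h0).1 (key k hk).1
  simp at this

/-- The local model near a point of exactly one curve, in coordinates where it is the first
axis. -/
theorem exists_eq_fst_pow (h : PlaneModel p S l j f)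
    (hz : ∀ᶠ z in 𝓝 (0 : ℝ × ℝ), z.1 = 0 ↔ ∃ k, f k z = 0) {k : ι} (hk : f k 0 = 0) :
    (∃ A : ℝ × ℝ → ℝ × ℝ, AnalyticAt ℝ A 0 ∧ A 0 ≠ 0 ∧
      ∀ᶠ z in 𝓝 (0 : ℝ × ℝ), p z = z.1 ^ l k • A z) ∧
    ∃ w : ℝ × ℝ → ℝ, AnalyticAt ℝ w 0 ∧ w 0 ≠ 0 ∧
      ∀ᶠ z in 𝓝 (0 : ℝ × ℝ), (fderiv ℝ p z).det = z.1 ^ j k * w z := by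
  classical
  obtain ⟨hne, g, hg, hg0, hfg⟩ := h.exists_fst_eq_mul hz hk
  have hU : ∀ m : ι → ℕ, ∃ U : ℝ × ℝ → ℝ, AnalyticAt ℝ U 0 ∧ U 0 ≠ 0 ∧
      ∀ᶠ z in 𝓝 (0 : ℝ × ℝ), ∏ k, f k z ^ m k = z.1 ^ m k * U z := by
    intro m
    refine ⟨fun z => (g z ^ m k)⁻¹ * ∏ k' ∈ Finset.univ.erase k, f k' z ^ m k',
      ((hg.fun_pow _).fun_inv (pow_ne_zero _ hg0)).fun_mul
        (Finset.analyticAt_fun_prod _ fun k' _ => (h.analytic k').fun_pow _),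
      mul_ne_zero (inv_ne_zero (pow_ne_zero _ hg0)) (Finset.prod_ne_zero_iff.2 fun k' hk' =>
        pow_ne_zero _ (hne k' (Finset.ne_of_mem_erase hk'))), ?_⟩
    filter_upwards [hfg, hg.continuousAt.eventually_ne hg0] with z h1 h2
    have h3 := pow_ne_zero (m k) h2
    rw [← Finset.mul_prod_erase Finset.univ _ (Finset.mem_univ k), h1, mul_pow]
    field_simp
  constructor
  · obtain ⟨A, hA, hA0, hpA⟩ := h.map_eq
    obtain ⟨U, hU, hU0, hfU⟩ := hU l
    refine ⟨fun z => U z • A z, hU.fun_smul hA, smul_ne_zero hU0 hA0, ?_⟩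
    filter_upwards [hpA, hfU] with z h1 h2
    rw [h1, h2, smul_smul]
  · obtain ⟨w, hw, hw0, hpw⟩ := h.det_eq
    obtain ⟨U, hU, hU0, hfU⟩ := hU j
    refine ⟨fun z => U z * w z, hU.fun_mul hw, mul_ne_zero hU0 hw0, ?_⟩
    filter_upwards [hpw, hfU] with z h1 h2
    rw [h1, h2, mul_assoc]

end PlaneModel

section AdaptedCharts

variable {M : Type u} [TopologicalSpace M] [ChartedSpace (ℝ × ℝ) M] [IsManifold 𝓘(ℝ, ℝ × ℝ) ω M]
  {χ : OpenPartialHomeomorph M (ℝ × ℝ)} {a : M} {E : Set M}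

theorem IsAdaptedChart.isCenteredChart (h : IsAdaptedChart E a χ) : IsCenteredChart χ a :=
  ⟨h.1, h.2.1, h.2.2.1⟩

theorem IsAdaptedChart.eventually (h : IsAdaptedChart E a χ) :
    ∀ᶠ z in 𝓝 (0 : ℝ × ℝ), χ.symm z ∈ E ↔ z.1 = 0 := by
  filter_upwards [χ.open_target.mem_nhds h.isCenteredChart.zero_mem_target] with z hz
  rw [h.2.2.2 _ (χ.map_target hz), χ.right_inv hz]

/-- Restriction of a centred chart so that a local property holds on the whole domain. -/
theorem IsCenteredChart.exists_restr (h : IsCenteredChart χ a) {P : M → Prop}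
    (hP : ∀ᶠ q in 𝓝 a, P q) : ∃ χ₁ : OpenPartialHomeomorph M (ℝ × ℝ), IsCenteredChart χ₁ a ∧
      (∀ q, χ₁ q = χ q) ∧ ∀ q ∈ χ₁.source, P q := by
  obtain ⟨U, hU, hUo, haU⟩ := eventually_nhds_iff.1 hP
  refine ⟨χ.restr U, h.restr hUo haU, fun q => rfl, fun q hq => hU q ?_⟩
  rw [OpenPartialHomeomorph.restr_source, hUo.interior_eq] at hq
  exact hq.2

end AdaptedCharts

namespace CurveSystem

variable {ι : Type*} [Fintype ι]
variable {M : Type u} [TopologicalSpace M] [ChartedSpace (ℝ × ℝ) M] [IsManifold 𝓘(ℝ, ℝ × ℝ) ω M]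
variable {l j : ι → ℕ} {s : Set ι} {π : M → ℝ × ℝ} {C : ι → Set M} {a : M} {k : ι}

theorem eventually_fst_eq_zero_iff (h : CurveSystem π C l j s)
    {χ : OpenPartialHomeomorph M (ℝ × ℝ)} (hχ : IsAdaptedChart (π ⁻¹' {0}) a χ)
    {f : ι → ℝ × ℝ → ℝ}
    (hf : PlaneModel (fun z => π (χ.symm z)) (fun k => χ.symm ⁻¹' C k) l j f) :
    ∀ᶠ z in 𝓝 (0 : ℝ × ℝ), z.1 = 0 ↔ ∃ k, f k z = 0 := by
  filter_upwards [hχ.eventually, eventually_all.2 hf.zeros] with z h1 h2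
  rw [← h1, mem_preimage, mem_singleton_iff, h.map_eq_zero_iff]
  exact exists_congr h2

theorem model_zero_of_mem {χ : OpenPartialHomeomorph M (ℝ × ℝ)} (hχ : IsCenteredChart χ a)
    {f : ι → ℝ × ℝ → ℝ}
    (hf : PlaneModel (fun z => π (χ.symm z)) (fun k => χ.symm ⁻¹' C k) l j f) (ha : a ∈ C k) :
    f k 0 = 0 := by
  rw [← (hf.zeros k).self_of_nhds, mem_preimage, hχ.symm_zero]
  exact ha

/-- Existence of the Hsiang–Pati form at regular points. -/
theorem exists_hasHsiangPatiForm (h : CurveSystem π C l j s) (ha : a ∈ C k)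
    (hreg : IsRegularPoint (π ⁻¹' {0}) a) :
    ∃ m, l k + m = j k + 1 ∧ HasHsiangPatiForm (π ⁻¹' {0}) π a (l k) m := by
  obtain ⟨χ, hχ⟩ := hreg
  have hχc := hχ.isCenteredChart
  obtain ⟨f, hf⟩ := (h.model a).exists_model hχc
  obtain ⟨⟨A, hA, hA0, hpA⟩, w, hw, hw0, hpw⟩ :=
    hf.exists_eq_fst_pow (h.eventually_fst_eq_zero_iff hχ hf) (model_zero_of_mem hχc hf ha)
  have hl := h.pos k (h.mem_of_mem ha)
  obtain ⟨m, c, s, α, φ, θ, hlm, hm, hcs, hα, hφ, hθ, hax, hpθ⟩ :=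
    exists_hsiangPati_coordinates hl hA hA0 hpA hw hw0 hpw
  refine ⟨m, hm, hl, hlm, ?_⟩
  obtain ⟨χ₁, hχ₁, hχθ⟩ := hχc.exists_isCenteredChart_comp hθ
  obtain ⟨χ₂, hχ₂, hχχ, hP⟩ := hχ₁.exists_restr
    (((hχc.tendsto.eventually hax).and (hχc.tendsto.eventually hpθ)).and
      (hχc.eventually_symm.and (χ.open_source.mem_nhds hχc.mem_source)))
  refine ⟨χ₂, ⟨hχ₂.mem_atlas, hχ₂.mem_source, hχ₂.map_eq, fun q hq => ?_⟩, c, s, α, 1, hcs, hα,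
    Or.inl rfl, φ, hφ, fun q hq => ?_⟩
  · rw [hχχ, hχθ, ← (hP q hq).1.1]
    exact hχ.2.2.2 q (hP q hq).2.2
  · have h1 := (hP q hq).1.2
    rw [(hP q hq).2.1, rotMap_apply] at h1
    rw [hχχ, hχθ, one_mul]
    exact ⟨congrArg Prod.fst h1, congrArg Prod.snd h1⟩

/-- Uniqueness of the exponents of the Hsiang–Pati form. -/
theorem eq_of_hasHsiangPatiForm (h : CurveSystem π C l j s) (ha : a ∈ C k) {l₁ m₁ : ℕ}
    (hHP : HasHsiangPatiForm (π ⁻¹' {0}) π a l₁ m₁) : l₁ = l k ∧ l₁ + m₁ = j k + 1 := by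
  obtain ⟨hl₁, hlm, χ, hχ, c, s, α, β, hcs, hα, hβ, φ, hφ, hq⟩ := hHP
  have hχc := hχ.isCenteredChart
  obtain ⟨f, hf⟩ := (h.model a).exists_model hχc
  obtain ⟨⟨A, hA, hA0, hpA⟩, w, hw, hw0, hpw⟩ :=
    hf.exists_eq_fst_pow (h.eventually_fst_eq_zero_iff hχ hf) (model_zero_of_mem hχc hf ha)
  have hα0 : α ≠ 0 := by rcases hα with rfl | rfl <;> norm_num
  have hβ0 : β ≠ 0 := by rcases hβ with rfl | rfl <;> norm_num
  refine eq_of_hsiangPati_coordinates hA hA0 hpA hw hw0 hpw hl₁ hlm hcs hα0 hβ0 hφ ?_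
  filter_upwards [χ.open_target.mem_nhds hχc.zero_mem_target] with z hz
  have h1 := hq _ (χ.map_target hz)
  rw [χ.right_inv hz] at h1
  rw [rotMap_apply]
  exact Prod.ext h1.1 h1.2

/-- Each curve of the system has regular points. -/
theorem exists_regularPoint (h : CurveSystem π C l j s) (hk : k ∈ s) :
    ∃ a ∈ C k, IsRegularPoint (π ⁻¹' {0}) a := by
  obtain ⟨b, hb⟩ := h.nonempty k hk
  -- At a point of `C k` on no other curve, the divisor is locally the smooth curve `f k = 0`, and
  -- `f k` serves as the coordinate `u`.
  obtain ⟨a, ha, hne⟩ := ((h.model b).frequently_mem hb).exists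
  refine ⟨a, ha, ?_⟩
  obtain ⟨χ, hχ, f, hf⟩ := h.model a
  have h0 := model_zero_of_mem hχ hf ha
  obtain ⟨v, hv⟩ := exists_isCoordChange_fst (hf.analytic k) h0 (hf.fderiv_ne k h0)
  obtain ⟨χ₁, hχ₁, hχθ⟩ := hχ.exists_isCenteredChart_comp hv
  have hCk : ∀ᶠ q in 𝓝 a, q ∈ C k ↔ f k (χ q) = 0 := by
    filter_upwards [hχ.tendsto.eventually (hf.zeros k), hχ.eventually_symm] with q h1 h2
    rw [← h1, mem_preimage, h2]
  have hC : ∀ᶠ q in 𝓝 a, ∀ k' ≠ k, q ∉ C k' := by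
    rw [eventually_all]
    intro k'
    by_cases hk' : k' = k
    · exact Eventually.of_forall fun q h1 => absurd hk' h1
    · filter_upwards [(h.closed k').isOpen_compl.mem_nhds (hne k' hk')] with q hq _ using hq
  obtain ⟨χ₂, hχ₂, hχχ, hP⟩ := hχ₁.exists_restr (hCk.and hC)
  refine ⟨χ₂, hχ₂.mem_atlas, hχ₂.mem_source, hχ₂.map_eq, fun q hq => ?_⟩
  obtain ⟨h1, h2⟩ := hP q hq
  rw [hχχ, hχθ, mem_preimage, mem_singleton_iff, h.map_eq_zero_iff, ← h1]
  constructor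
  · rintro ⟨k', hk'⟩
    by_cases hkk : k' = k
    · rwa [← hkk]
    · exact absurd hk' (h2 k' hkk)
  · exact fun h3 => ⟨k, h3⟩

/-- The Hsiang–Pati form along a curve of the system, in terms of its exponents. -/
theorem forall_hasHsiangPatiForm_iff (h : CurveSystem π C l j s) (hk : k ∈ s) (d : ℕ × ℕ) :
    (∀ a ∈ C k, IsRegularPoint (π ⁻¹' {0}) a →
      HasHsiangPatiForm (π ⁻¹' {0}) π a d.1 d.2) ↔ d = (l k, j k + 1 - l k) := by
  constructor
  · intro hd
    -- A regular point is needed for uniqueness, since without one the hypothesis on `d` would be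
    -- vacuous.
    obtain ⟨a, ha, hreg⟩ := h.exists_regularPoint hk
    obtain ⟨h1, h2⟩ := h.eq_of_hasHsiangPatiForm ha (hd a ha hreg)
    exact Prod.ext h1 (by simp only; omega)
  · rintro rfl a ha hreg
    obtain ⟨m, hm, hHP⟩ := h.exists_hasHsiangPatiForm ha hreg
    rwa [show j k + 1 - l k = m by omega]

end CurveSystem

theorem corollary4p2 {n : ℕ} (T : BlowUpTower.{u} n) (T' : BlowUpTower.{v} n)
    (h : OpenPartialHomeomorph (ℝ × ℝ) (ℝ × ℝ)) (D : CascadeDiagram T T' h) :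
    (∀ a ∈ D.iso.source,
      pullbackIdeal D.iso a (maximalPullback T'.toPlane (D.iso a)) =
          maximalPullback T.toPlane a ∧
      pullbackIdeal D.iso a (jacobianIdeal T'.toPlane (D.iso a)) =
          jacobianIdeal T.toPlane a) ∧
    ∀ H ∈ T.components (Fin.last n),
      D.iso '' H ∈ T'.components (Fin.last n) ∧
      (∃! d : ℕ × ℕ, T.IsHsiangPatiData H d) ∧
      ∀ d : ℕ × ℕ, T.IsHsiangPatiData H d ↔ T'.IsHsiangPatiData (D.iso '' H) d := by
  obtain ⟨C, C', l, j, hC, hC', hCC', hcomp, hcomp'⟩ := D.exists_curveSystem (Fin.last n)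
  refine ⟨fun a ha => D.pullback_ideals hC hC' hCC' ha, fun H hH => ?_⟩
  rw [hcomp] at hH
  obtain ⟨k, hk, rfl⟩ := hH
  have h1 : ∀ d, T.IsHsiangPatiData (C k) d ↔ d = (l k, j k + 1 - l k) :=
    hC.forall_hasHsiangPatiForm_iff hk
  have h2 : ∀ d, T'.IsHsiangPatiData (C' k) d ↔ d = (l k, j k + 1 - l k) :=
    hC'.forall_hasHsiangPatiForm_iff hk
  rw [show D.iso '' C k = C' k from hCC' k]
  refine ⟨?_, ⟨_, (h1 _).2 rfl, fun d hd => (h1 d).1 hd⟩, fun d => ?_⟩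
  · rw [hcomp']
    exact ⟨k, hk, rfl⟩
  · rw [h1, h2]
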